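/- Let $\mathbb B^d$ be the set of nonoriented nearest neighbour bonds $\{x,y\}$ of $\mathbb Z^d$ ($|x-y|=1$). Each bond is uniquely of the form $\{x,x+e_i\}$. For $u:\mathbb Z^d\to\mathbb R$ set $\nabla u(\{x,x+e_i\}):=u(x+e_i)-u(x)$, and for $F:\mathbb B^d\to\mathbb R$ set $\nabla^*F(x):=\sum_{i=1}^d\bigl(F(\{x-e_i,x\})-F(\{x,x+e_i\})\bigr)$. For $n\in\mathbb N$ let $B(n):=([-n,n]\cap\mathbb Z)^d$. For a finite set $S\subset\mathbb Z^d$ and $r\in(0,\infty)$ let $\|u\|_{\underline L^r(S)}:=\bigl(\frac1{|S|}\sum_{x\in S}|u(x)|^r\bigr)^{1/r}$; for $F:\mathbb B^d\to\mathbb R$ let $\|F\|_{\underline L^r(S)}$ be the analogous normalized norm over the set of bonds both of whose end points lie in $S$; for $r=\infty$ these norms are the corresponding maxima. For $\omega:\mathbb B^d\to(0,\infty)$ and $p,q\in(1,\infty]$ put $$\Lambda^\omega(S):=\|\omega\|_{\underline L^p(S)}\,\|\omega^{-1}\|_{\underline L^q(S)} .$$ **Theorem.** Let $d\ge 3$ and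 let $p,q\in(1,\infty]$ satisfy $\frac1p+\frac1q<\frac2{d-1}$ (with $\frac1\infty=0$). Then $\delta:=\frac1{d-1}-\frac1{2p}-\frac1{2q}>0$, and there exists a constant $c=c(d,p,q)\in[1,\infty)$ such that for every $\omega:\mathbb B^d\to(0,\infty)$, every solution $u:\mathbb Z^d\to\mathbb R$ of $\nabla^*(\omega\nabla u)=0$ in $\mathbb Z^d$, and every integer $n\ge1$, $$\max_{x\in B(n)}|u(x)|\le c\,\Lambda^\omega(B(4n))^{\frac{\delta+1}{2\delta}}\,\|u\|_{\underline L^{2p'}(B(4n))},$$ where $p':=\frac p{p-1}$ (and $p'=1$ if $p=\infty$). -/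

import Mathlib

open scoped ENNReal

namespace RandomConductance

/-- The vertex set of the lattice `ℤ^d`. -/
abbrev Vertex (d : ℕ) : Type := Fin d → ℤ

/-- The nonoriented nearest neighbour bonds of `ℤ^d`. The pair `(x, i)` stands for the bond
`{x, x + e_i}`; every nearest neighbour pair is of this form for exactly one `(x, i)`, see
`bondEnds_injective` and `range_bondEnds`. -/
abbrev Bond (d : ℕ) : Type := Vertex d × Fin d

/-- The end point `x` of the bond `{x, x + e_i}`. -/
def lower {d : ℕ} (e : Bond d) : Vertex d := e.1

/-- The end point `x + e_i` of the bond `{x, x + e_i}`. -/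
def upper {d : ℕ} (e : Bond d) : Vertex d := e.1 + Pi.single e.2 1

/-- The unordered pair of end points of a bond. -/
def bondEnds {d : ℕ} (e : Bond d) : Sym2 (Vertex d) := s(lower e, upper e)

/-- Different indices `(x, i)` give different nonoriented bonds. -/
theorem bondEnds_injective {d : ℕ} : Function.Injective (bondEnds (d := d)) := by
  rintro ⟨x, i⟩ ⟨y, j⟩ h
  simp only [bondEnds, lower, upper, Sym2.eq_iff] at h
  rcases h with ⟨hx, hy⟩ | ⟨hx, hy⟩
  · subst hx
    have h1 := congrFun (add_left_cancel hy) i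
    by_cases hij : i = j
    · rw [hij]
    · rw [Pi.single_eq_same, Pi.single_eq_of_ne hij] at h1
      exact absurd h1 one_ne_zero
  · exfalso
    have h1 := congrFun hx j
    have h2 := congrFun hy j
    simp only [Pi.add_apply, Pi.single_eq_same] at h1 h2
    have h3 : (0 : ℤ) ≤ (Pi.single i 1 : Vertex d) j := by
      rw [Pi.single_apply]; split_ifs <;> norm_num
    omega

/-- The nonoriented bonds are exactly the pairs of vertices at Euclidean distance one. -/
theorem range_bondEnds {d : ℕ} :
    Set.range (bondEnds (d := d)) =
      {s : Sym2 (Vertex d) | ∃ x y : Vertex d, s = s(x, y) ∧ ∑ i, (x i - y i) ^ 2 = 1} := by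
  ext s
  constructor
  · rintro ⟨⟨x, i⟩, rfl⟩
    refine ⟨x, x + Pi.single i 1, rfl, ?_⟩
    rw [Finset.sum_eq_single i] <;> simp +contextual
  · rintro ⟨x, y, rfl, h⟩
    obtain ⟨i, hi⟩ : ∃ i, x i - y i ≠ 0 := by
      by_contra hc
      push Not at hc
      simp [hc] at h
    have hsplit := Finset.add_sum_erase Finset.univ (fun j => (x j - y j) ^ 2) (Finset.mem_univ i)
    have hnn : 0 ≤ ∑ j ∈ Finset.univ.erase i, (x j - y j) ^ 2 :=
      Finset.sum_nonneg fun j _ => sq_nonneg _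
    have hpos : 0 < (x i - y i) ^ 2 := by positivity
    have h0 : ∑ j ∈ Finset.univ.erase i, (x j - y j) ^ 2 = 0 := by omega
    have hi1 : (x i - y i) ^ 2 = 1 := by omega
    have hj : ∀ j, j ≠ i → x j = y j := by
      intro j hji
      have := (Finset.sum_eq_zero_iff_of_nonneg fun j _ => sq_nonneg (x j - y j)).1 h0 j
        (Finset.mem_erase.2 ⟨hji, Finset.mem_univ j⟩)
      have := pow_eq_zero_iff (two_ne_zero) |>.1 this
      omega
    rcases (by simpa using hi1 : x i - y i = 1 ∨ x i - y i = -1) with h1 | h1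
    · refine ⟨(y, i), ?_⟩
      rw [bondEnds, lower, upper, Sym2.eq_swap]
      congr 2
      ext j
      by_cases hji : j = i
      · subst hji; simp; omega
      · simp [hji, hj j hji]
    · refine ⟨(x, i), ?_⟩
      rw [bondEnds, lower, upper]
      congr 2
      ext j
      by_cases hji : j = i
      · subst hji; simp; omega
      · simp [hji, hj j hji]

/-- The box `B(y, n) = y + ([-n, n] ∩ ℤ)^d`. -/
noncomputable def box {d : ℕ} (y : Vertex d) (n : ℕ) : Finset (Vertex d) :=
  Fintype.piFinset fun i => Finset.Icc (y i - n) (y i + n)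

/-- The set of bonds both of whose end points lie in `S`. -/
noncomputable def bondsIn {d : ℕ} (S : Finset (Vertex d)) : Finset (Bond d) :=
  (S ×ˢ Finset.univ).filter fun e => upper e ∈ S

theorem mem_bondsIn {d : ℕ} {S : Finset (Vertex d)} {e : Bond d} :
    e ∈ bondsIn S ↔ lower e ∈ S ∧ upper e ∈ S := by
  simp [bondsIn, lower]

/-- The discrete derivative `∇f`, a function on bonds. -/
def grad {d : ℕ} (f : Vertex d → ℝ) : Bond d → ℝ := fun e => f (upper e) - f (lower e)

/-- The discrete divergence
`∇^*F (x) = ∑_i (F {x - e_i, x} - F {x, x + e_i})`. -/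
def dvg {d : ℕ} (F : Bond d → ℝ) : Vertex d → ℝ :=
  fun x => ∑ i : Fin d, (F (x - Pi.single i 1, i) - F (x, i))

/-- The normalized `L^p` norm of `f` over a finite set `S` (of vertices or of bonds):
`((1 / |S|) ∑_{x ∈ S} |f x| ^ p) ^ (1 / p)` for finite `p`, and the maximum of `|f|` over `S`
for `p = ∞`. -/
noncomputable def avgNorm {ι : Type*} (p : ℝ≥0∞) (S : Finset ι) (f : ι → ℝ) : ℝ :=
  if p = ∞ then ⨆ x : S, |f x|
  else ((S.card : ℝ)⁻¹ * ∑ x ∈ S, |f x| ^ p.toReal) ^ (1 / p.toReal)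

/-- The quantity `Λ^ω(S)`: the product of the normalized `L^p` norm of `ω` and the normalized
`L^q` norm of `ω⁻¹`, both over the bonds inside `S`. -/
noncomputable def ellipticity {d : ℕ} (p q : ℝ≥0∞) (ω : Bond d → ℝ) (S : Finset (Vertex d)) : ℝ :=
  avgNorm p (bondsIn S) ω * avgNorm q (bondsIn S) fun e => (ω e)⁻¹

/-- The exponent `δ = 1 / (d - 1) - 1 / (2p) - 1 / (2q)`, where `1 / ∞ = 0`. -/
noncomputable def gap (d : ℕ) (p q : ℝ≥0∞) : ℝ :=
  1 / ((d : ℝ) - 1) - (p⁻¹).toReal / 2 - (q⁻¹).toReal / 2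

end RandomConductance
open RandomConductance

namespace RandomConductance

/-! The proof is a Moser iteration in which the cutoff of Caccioppoli's inequality is adapted to ω
and u. Testing the equation with η² times an odd power of u bounds the ω-energy of |u|^α by the sum
of ω (∇η)² |u|^(2α). With a linear cutoff, Hölder and Sobolev on d-dimensional boxes would require
1/p + 1/q < 2/d. But a radial cutoff need only drop on some of the spheres between the radii ρ and
σ, and these can be chosen: by pigeonhole (`exists_good_subset`) at least half of them carry no more
than a constant times the average share of both the weight ω and the Sobolev energy of |u|^α. On
such a sphere, whose faces are cubes of dimension m = d - 1, the Sobolev inequality of dimension m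
applies (`sum_layer_le`). This replaces d by d - 1 in the condition.

The outcome, `energy_le_sobolevSum`, bounds the ω-energy in the small box by a W^{1,t} norm in the
large one, where 1/t = (1 - 1/p)/2 + 1/m. Hölder against ω⁻¹ (`gradNorm_sq_le`) bounds the same
energy below by an L^r norm of the gradient, where 1/r = (1 + 1/q)/2. Then 1/t - 1/r = δ, and the
assumption on p and q says exactly that δ > 0. Hölder once more bounds the W^{1,t} norm of
|u|^(α(1+δ)) by the W^{1,r} norm of |u|^α to the power 1 + δ (`sobolevNorm_rpow_le`), which closes
the iteration step `sobolevNorm_step` at a cost of order √(αΛ) (n/(σ - ρ))².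

The step is iterated with α = (1+δ)^k on the radii n + ⌊n/2^k⌋. The factors √Λ accumulate to the
power (1+δ)/δ, which is the exponent of the theorem. On the lattice about log₂ n steps suffice: a
value at a point is at most n^d times the final norm, and the root of order (1+δ)^K of n^d is
bounded (`natCast_pow_le_rpow`). -/

/-! ### Hölder's inequality and convexity bounds for powers -/

/-- Hölder with exponents 1/(1-θ) and 1/θ. The interpolation form includes the end points θ = 0 and
θ = 1, so that for instance the Sobolev inequality at t = 1 needs no separate case. -/
theorem sum_rpow_mul_rpow_le {ι : Type*} (s : Finset ι) {A B : ι → ℝ} {θ : ℝ}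
    (hθ₀ : 0 ≤ θ) (hθ₁ : θ ≤ 1) (hA : ∀ i ∈ s, 0 ≤ A i) (hB : ∀ i ∈ s, 0 ≤ B i) :
    ∑ i ∈ s, A i ^ (1 - θ) * B i ^ θ ≤ (∑ i ∈ s, A i) ^ (1 - θ) * (∑ i ∈ s, B i) ^ θ := by
  rcases hθ₀.eq_or_lt with rfl | h0
  · simp
  rcases hθ₁.eq_or_lt with rfl | h1
  · simp
  have hc : Real.HolderConjugate (1 / (1 - θ)) (1 / θ) := by
    rw [Real.holderConjugate_iff]
    constructor
    · rw [lt_div_iff₀ (by linarith)]; linarith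
    · simp
  have h := Real.inner_le_Lp_mul_Lq_of_nonneg s hc
    (fun i hi => Real.rpow_nonneg (hA i hi) (1 - θ)) (fun i hi => Real.rpow_nonneg (hB i hi) θ)
  rw [one_div_one_div, one_div_one_div] at h
  refine h.trans (le_of_eq ?_)
  congr 2
  · refine Finset.sum_congr rfl fun i hi => ?_
    rw [← Real.rpow_mul (hA i hi), mul_one_div_cancel (by linarith), Real.rpow_one]
  · refine Finset.sum_congr rfl fun i hi => ?_
    rw [← Real.rpow_mul (hB i hi), mul_one_div_cancel (by linarith), Real.rpow_one]

/-- Tangent line bound for the convex function `x ↦ x ^ β` at the larger point. -/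
theorem rpow_sub_rpow_le {x y β : ℝ} (hβ : 1 ≤ β) (hx : 0 ≤ x) (hxy : x ≤ y) :
    y ^ β - x ^ β ≤ β * y ^ (β - 1) * (y - x) := by
  rcases (hx.trans hxy).eq_or_lt with h | hy
  · have : x = y := le_antisymm hxy (h ▸ hx)
    simp [this]
  have h := one_add_mul_self_le_rpow_one_add (s := x / y - 1) (by
    have := div_nonneg hx hy.le; linarith) hβ
  rw [add_sub_cancel, Real.div_rpow hx hy.le, le_div_iff₀ (Real.rpow_pos_of_pos hy _)] at h
  have e : y ^ β = y ^ (β - 1) * y := by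
    rw [← Real.rpow_add_one hy.ne', sub_add_cancel]
  have e2 : (1 + β * (x / y - 1)) * y ^ β = y ^ β + β * y ^ (β - 1) * (x - y) := by
    rw [e]; field_simp
  linarith

/-- Tangent line bound for the convex function `x ↦ x ^ β` at the smaller point. -/
theorem le_rpow_sub_rpow {x y β : ℝ} (hβ : 1 ≤ β) (hx : 0 ≤ x) (hxy : x ≤ y) :
    x ^ (β - 1) * (y - x) ≤ y ^ β - x ^ β := by
  rcases hx.eq_or_lt with rfl | hx
  · rcases hβ.eq_or_lt with rfl | hb
    · simp
    · rw [Real.zero_rpow (by linarith), Real.zero_rpow (by linarith)]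
      have := Real.rpow_nonneg hxy β
      linarith
  have e : ∀ z : ℝ, 0 < z → z ^ β = z ^ (β - 1) * z := fun z hz => by
    rw [← Real.rpow_add_one hz.ne', sub_add_cancel]
  have hm : x ^ (β - 1) ≤ y ^ (β - 1) := Real.rpow_le_rpow hx.le hxy (by linarith)
  rw [e x hx, e y (hx.trans_le hxy)]
  nlinarith

/-- Symmetric in x and y, so that sums over bonds split into one over lower and one over upper end
points. -/
theorem abs_rpow_sub_rpow_le {x y β : ℝ} (hβ : 1 ≤ β) (hx : 0 ≤ x) (hy : 0 ≤ y) :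
    |y ^ β - x ^ β| ≤ β * (x ^ (β - 1) + y ^ (β - 1)) * |y - x| := by
  wlog hxy : x ≤ y generalizing x y
  · have := this hy hx (le_of_not_ge hxy)
    rwa [abs_sub_comm, abs_sub_comm x y, add_comm] at this
  rw [abs_of_nonneg (sub_nonneg.2 (Real.rpow_le_rpow hx hxy (by linarith))),
    abs_of_nonneg (sub_nonneg.2 hxy)]
  refine (rpow_sub_rpow_le hβ hx hxy).trans ?_
  have h1 := Real.rpow_nonneg hx (β - 1)
  gcongr
  linarith

/-! ### The pointwise Caccioppoli inequality -/

/-- One factor is bounded by the tangent at y, which produces α y^(α-1) (y - x); what remains,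
y^(α-1) (y^α - x^α), is at most y^(2α-1) - x^(2α-1) since x^(α-1) ≤ y^(α-1). Linearity of the
constant in α makes an iteration step cost only √α. -/
theorem sq_rpow_sub_rpow_le {x y α : ℝ} (hα : 1 ≤ α) (hx : 0 ≤ x) (hxy : x ≤ y) :
    (y ^ α - x ^ α) ^ 2 ≤ α * ((y - x) * (y ^ (2 * α - 1) - x ^ (2 * α - 1))) := by
  rcases (hx.trans hxy).eq_or_lt with h | hy
  · have : x = y := le_antisymm hxy (h ▸ hx)
    simp [this]
  have h1 := rpow_sub_rpow_le hα hx hxy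
  have h0 : x ^ α ≤ y ^ α := Real.rpow_le_rpow hx hxy (by linarith)
  have h2 : y ^ (α - 1) * (y ^ α - x ^ α) ≤ y ^ (2 * α - 1) - x ^ (2 * α - 1) := by
    have e1 : y ^ (2 * α - 1) = y ^ (α - 1) * y ^ α := by
      rw [← Real.rpow_add hy]; ring_nf
    have e2 : x ^ (2 * α - 1) = x ^ (α - 1) * x ^ α := by
      rw [← Real.rpow_add' hx (by linarith)]; ring_nf
    have h3 : x ^ (α - 1) ≤ y ^ (α - 1) := Real.rpow_le_rpow hx hxy (by linarith)
    have := Real.rpow_nonneg hx α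
    rw [e1, e2]; nlinarith
  calc (y ^ α - x ^ α) ^ 2 = (y ^ α - x ^ α) * (y ^ α - x ^ α) := sq _
    _ ≤ α * y ^ (α - 1) * (y - x) * (y ^ α - x ^ α) := by
        gcongr
    _ = α * ((y - x) * (y ^ (α - 1) * (y ^ α - x ^ α))) := by ring
    _ ≤ _ := by
        gcongr

/-- With D = y^(2α-1) - x^(2α-1) and f = x^(2α-1), the tested difference is g² (y-x) D + (g² -
h²)(y-x) f, and its first term controls the left side. In the second, g² - h² ≥ -|g-h| (2g + |g-h|):
the part linear in |g-h| is absorbed by Young's inequality, the quadratic part is an error term. The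
errors 2 + 1 give 3, and the factor 2α makes 6α. -/
theorem energy_bound_of_le {x y g h α : ℝ} (hα : 1 ≤ α) (hx : 0 ≤ x) (hxy : x ≤ y) (hg : 0 ≤ g) :
    g ^ 2 * (y ^ α - x ^ α) ^ 2 ≤
      2 * α * ((y - x) * (g ^ 2 * y ^ (2 * α - 1) - h ^ 2 * x ^ (2 * α - 1)))
        + 6 * α * (g - h) ^ 2 * (y ^ α) ^ 2 := by
  have h1 := sq_rpow_sub_rpow_le hα hx hxy
  have hx2 : x ^ (2 * α - 1) = x ^ (α - 1) * x ^ α := by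
      rw [← Real.rpow_add' hx (by linarith)]; ring_nf
  have h2 := le_rpow_sub_rpow (β := 2 * α - 1) (by linarith) hx hxy
  have h3 : x ^ (2 * α - 1 - 1) = (x ^ (α - 1)) ^ 2 := by
    rw [← Real.rpow_natCast, ← Real.rpow_mul hx]; push_cast; ring_nf
  have h4 : x ^ α ≤ y ^ α := Real.rpow_le_rpow hx hxy (by linarith)
  have h5 : x ^ (2 * α - 1) * (y - x) ≤ (y ^ α) ^ 2 := by
    have e : y ^ α = y ^ (α - 1) * y ∨ y = 0 := by
      rcases (hx.trans hxy).eq_or_lt with h | h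
      · exact Or.inr h.symm
      · left; rw [← Real.rpow_add_one h.ne', sub_add_cancel]
    rcases e with e | e
    · have h6 : x ^ (α - 1) ≤ y ^ (α - 1) := Real.rpow_le_rpow hx hxy (by linarith)
      have h7 := Real.rpow_nonneg hx (α - 1)
      have h8 := Real.rpow_nonneg hx α
      rw [hx2]
      calc x ^ (α - 1) * x ^ α * (y - x) ≤ y ^ (α - 1) * y ^ α * y := by
            have h9 : 0 ≤ y ^ α := h8.trans h4
            have h10 : 0 ≤ y ^ (α - 1) := h7.trans h6
            gcongr
            linarith
        _ = (y ^ α) ^ 2 := by nth_rewrite 2 [e]; rw [sq, e]; ring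
    · have : x = 0 := le_antisymm (e ▸ hxy) hx
      rw [e, this]; simp; positivity
  set D := y ^ (2 * α - 1) - x ^ (2 * α - 1) with hD
  set f := x ^ (2 * α - 1) with hf
  have hw : 0 ≤ y - x := sub_nonneg.2 hxy
  have hf0 : 0 ≤ f := Real.rpow_nonneg hx _
  have hy0 : 0 ≤ y ^ α := Real.rpow_nonneg (hx.trans hxy) _
  have hD0 : 0 ≤ D := le_trans (by positivity) h2
  -- Young's inequality; it needs ((y-x) f)² ≤ (y-x) D y^(2α), which comes from the tangent bound
  -- x^(2α-2) (y-x) ≤ D.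
  have hc : 2 * g * |g - h| * ((y - x) * f) ≤
      1 / 2 * g ^ 2 * ((y - x) * D) + 2 * (g - h) ^ 2 * (y ^ α) ^ 2 := by
    have hsq : ((y - x) * f) ^ 2 ≤ ((y - x) * D) * (y ^ α) ^ 2 := by
      have : ((y - x) * f) ^ 2 = (y - x) * (x ^ (2 * α - 1 - 1) * (y - x)) * (x ^ α) ^ 2 := by
        rw [h3, hx2]; ring
      rw [this]
      have := Real.rpow_nonneg hx α
      gcongr
    set P := (y - x) * D
    set Q := y ^ α
    set X := (y - x) * f
    have hP : 0 ≤ P := by positivity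
    have hX : 0 ≤ X := by positivity
    have hXle : X ≤ Real.sqrt P * Q := by
      rw [← Real.sqrt_sq hy0, ← Real.sqrt_mul hP]
      exact Real.le_sqrt_of_sq_le hsq
    have hs := Real.sq_sqrt hP
    have habs := abs_nonneg (g - h)
    have hab2 := sq_abs (g - h)
    calc 2 * g * |g - h| * X ≤ 2 * g * |g - h| * (Real.sqrt P * Q) := by gcongr
      _ ≤ 1 / 2 * g ^ 2 * Real.sqrt P ^ 2 + 2 * |g - h| ^ 2 * Q ^ 2 := by
          nlinarith [sq_nonneg (g * Real.sqrt P - 2 * |g - h| * Q)]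
      _ = _ := by rw [hs, hab2]
  have hlow : -(|g - h| * (2 * g + |g - h|) * ((y - x) * f)) ≤ (g ^ 2 - h ^ 2) * ((y - x) * f) := by
    have : -(|g - h| * (2 * g + |g - h|)) ≤ g ^ 2 - h ^ 2 := by
      rcases abs_cases (g - h) with ⟨e, _⟩ | ⟨e, _⟩ <;> rw [e] <;> nlinarith
    have h9 : 0 ≤ (y - x) * f := by positivity
    nlinarith
  have hsq2 : |g - h| * |g - h| * ((y - x) * f) ≤ (g - h) ^ 2 * (y ^ α) ^ 2 := by
    rw [← sq, sq_abs]
    gcongr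
    linarith
  have key : 1 / 2 * g ^ 2 * ((y - x) * D) - 3 * (g - h) ^ 2 * (y ^ α) ^ 2 ≤
      (y - x) * (g ^ 2 * y ^ (2 * α - 1) - h ^ 2 * f) := by
    have : (y - x) * (g ^ 2 * y ^ (2 * α - 1) - h ^ 2 * f) =
      g ^ 2 * ((y - x) * D) + (g ^ 2 - h ^ 2) * ((y - x) * f) := by rw [hD]; ring
    rw [this]; linarith
  have hα0 : 0 ≤ α := by linarith
  calc g ^ 2 * (y ^ α - x ^ α) ^ 2 ≤ g ^ 2 * (α * ((y - x) * D)) := by gcongr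
    _ ≤ 2 * α * ((y - x) * (g ^ 2 * y ^ (2 * α - 1) - h ^ 2 * f)
        + 3 * (g - h) ^ 2 * (y ^ α) ^ 2) := by
        have := mul_le_mul_of_nonneg_left key (by positivity : 0 ≤ 2 * α)
        linarith
    _ = _ := by ring

/-- The odd power `s ↦ sign s |s| ^ (2α - 1)`. -/
noncomputable def oddPow (α s : ℝ) : ℝ := s * |s| ^ (2 * α - 2)

theorem abs_oddPow {α s : ℝ} (hα : 1 ≤ α) : |s| * |s| ^ (2 * α - 2) = |s| ^ (2 * α - 1) := by
  rw [← Real.rpow_one_add' (abs_nonneg s) (by linarith)]; ring_nf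

/-- Pointwise Caccioppoli inequality on one bond. -/
theorem energy_bound {x y g h α : ℝ} (hα : 1 ≤ α) (hg : 0 ≤ g) (hh : 0 ≤ h) :
    min g h ^ 2 * (|y| ^ α - |x| ^ α) ^ 2 ≤
      2 * α * ((y - x) * (g ^ 2 * oddPow α y - h ^ 2 * oddPow α x))
        + 6 * α * (g - h) ^ 2 * max (|x| ^ α) (|y| ^ α) ^ 2 := by
  -- Passing to absolute values leaves the diagonal terms unchanged and can only decrease the right
  -- side, because xy ≤ |x||y|.
  have hred : (|y| - |x|) * (g ^ 2 * |y| ^ (2 * α - 1) - h ^ 2 * |x| ^ (2 * α - 1)) ≤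
      (y - x) * (g ^ 2 * oddPow α y - h ^ 2 * oddPow α x) := by
    rw [← abs_oddPow hα, ← abs_oddPow hα, oddPow, oddPow]
    have hy := Real.rpow_nonneg (abs_nonneg y) (2 * α - 2)
    have hx := Real.rpow_nonneg (abs_nonneg x) (2 * α - 2)
    have hxy : x * y ≤ |x| * |y| := by rw [← abs_mul]; exact le_abs_self _
    have h1 := mul_le_mul_of_nonneg_right hxy (by positivity : 0 ≤ g ^ 2 * |y| ^ (2 * α - 2))
    have h2 := mul_le_mul_of_nonneg_right hxy (by positivity : 0 ≤ h ^ 2 * |x| ^ (2 * α - 2))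
    have ex := abs_mul_abs_self x
    have ey := abs_mul_abs_self y
    have e1 : |y| * |y| * (g ^ 2 * |y| ^ (2 * α - 2)) = y * y * (g ^ 2 * |y| ^ (2 * α - 2)) := by
      rw [ey]
    have e2 : |x| * |x| * (h ^ 2 * |x| ^ (2 * α - 2)) = x * x * (h ^ 2 * |x| ^ (2 * α - 2)) := by
      rw [ex]
    nlinarith
  have hα0 : 0 ≤ α := by linarith
  -- The one-sided bound keeps the cutoff value at the end point where |u| is larger. Either end
  -- point may be that one, hence the minimum in the statement.
  rcases le_total |x| |y| with hxy | hxy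
  · have h1 := energy_bound_of_le (h := h) hα (abs_nonneg x) hxy hg
    rw [max_eq_right (Real.rpow_le_rpow (abs_nonneg x) hxy hα0)]
    have h2 : min g h ^ 2 ≤ g ^ 2 := by
      have := le_min hg hh
      gcongr
      exact min_le_left _ _
    have h3 := mul_le_mul_of_nonneg_right h2 (sq_nonneg (|y| ^ α - |x| ^ α))
    have h4 := mul_le_mul_of_nonneg_left hred (by positivity : 0 ≤ 2 * α)
    linarith
  · have h1 := energy_bound_of_le (h := g) hα (abs_nonneg y) hxy hh
    rw [max_eq_left (Real.rpow_le_rpow (abs_nonneg y) hxy hα0)]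
    have h2 : min g h ^ 2 ≤ h ^ 2 := by
      have := le_min hg hh
      gcongr
      exact min_le_right _ _
    have h3 := mul_le_mul_of_nonneg_right h2 (sq_nonneg (|y| ^ α - |x| ^ α))
    have h4 := mul_le_mul_of_nonneg_left hred (by positivity : 0 ≤ 2 * α)
    have e : (|x| ^ α - |y| ^ α) ^ 2 = (|y| ^ α - |x| ^ α) ^ 2 := by ring
    have e' : (g - h) ^ 2 = (h - g) ^ 2 := by ring
    rw [e] at h1
    rw [e']
    linarith

/-! ### The Sobolev inequality on discrete cubes -/

theorem lintegral_pi_count {m : ℕ} (g : Vertex m → ℝ≥0∞) :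
    ∫⁻ x, g x ∂(MeasureTheory.Measure.pi fun _ : Fin m =>
      (MeasureTheory.Measure.count : MeasureTheory.Measure ℤ)) = ∑' x, g x := by
  rw [MeasureTheory.lintegral_countable']
  simp [MeasureTheory.Measure.pi_singleton]

theorem mem_box_zero {d : ℕ} {x : Vertex d} {n : ℕ} :
    x ∈ box 0 n ↔ ∀ i, -(n : ℤ) ≤ x i ∧ x i ≤ n := by
  simp [box]

theorem update_mem_box {d : ℕ} {x : Vertex d} {n : ℕ} (hx : x ∈ box 0 n) {i : Fin d} {t : ℤ}
    (ht : t ∈ Finset.Icc (-(n : ℤ)) n) : Function.update x i t ∈ box 0 n := by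
  rw [mem_box_zero] at hx ⊢
  intro j
  by_cases h : j = i
  · subst h; simpa using ht
  · simpa [Function.update_of_ne h] using hx j

/-- Discrete Loomis-Whitney inequality in Gagliardo's form. -/
theorem sum_rpow_le_of_le_sum_line {m : ℕ} (hm : 2 ≤ m) (k : ℕ) {f F : Vertex m → ℝ}
    (hf : ∀ x, 0 ≤ f x) (hF : ∀ x, 0 ≤ F x)
    (h : ∀ x ∈ box 0 k, ∀ i, f x ≤ ∑ t ∈ Finset.Icc (-(k : ℤ)) k, F (Function.update x i t)) :
    ∑ x ∈ box (0 : Vertex m) k, f x ^ ((m : ℝ) / (m - 1)) ≤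
      (∑ x ∈ box (0 : Vertex m) k, F x) ^ ((m : ℝ) / (m - 1)) := by
  have hm' : (2 : ℝ) ≤ m := by exact_mod_cast hm
  -- Extension by zero turns sums over the box and over its segments into integrals over the whole
  -- lattice and over whole lines.
  set G : Vertex m → ℝ≥0∞ := fun x => if x ∈ box 0 k then ENNReal.ofReal (F x) else 0 with hG
  have hp : Real.HolderConjugate (Fintype.card (Fin m)) ((m : ℝ) / (m - 1)) := by
    rw [Fintype.card_fin, Real.holderConjugate_iff]
    refine ⟨by linarith, ?_⟩
    have : (m : ℝ) ≠ 0 := by linarith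
    field_simp
    ring
  have key := MeasureTheory.lintegral_prod_lintegral_pow_le
    (fun _ : Fin m => (MeasureTheory.Measure.count : MeasureTheory.Measure ℤ)) hp
    (f := G) (measurable_of_countable G)
  rw [lintegral_pi_count, lintegral_pi_count] at key
  have e1 : ∑' x, G x = ENNReal.ofReal (∑ x ∈ box (0 : Vertex m) k, F x) := by
    rw [tsum_eq_sum (s := box 0 k) (fun x hx => by simp [hG, hx]),
      ENNReal.ofReal_sum_of_nonneg fun x _ => hF x]
    exact Finset.sum_congr rfl fun x hx => by simp [hG, hx]
  have e2 : ENNReal.ofReal (∑ x ∈ box (0 : Vertex m) k, f x ^ ((m : ℝ) / (m - 1))) ≤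
      ∑' x, ∏ i, (∫⁻ t, G (Function.update x i t) ∂MeasureTheory.Measure.count) ^
        ((1 : ℝ) / ((Fintype.card (Fin m) : ℝ) - 1)) := by
    rw [ENNReal.ofReal_sum_of_nonneg fun x _ => Real.rpow_nonneg (hf x) _]
    refine le_trans (Finset.sum_le_sum fun x hx => ?_) (ENNReal.sum_le_tsum (box 0 k))
    have hline : ∀ i, ENNReal.ofReal (f x) ≤
        ∫⁻ t, G (Function.update x i t) ∂MeasureTheory.Measure.count := by
      intro i
      rw [MeasureTheory.lintegral_count]
      refine le_trans ?_ (ENNReal.sum_le_tsum (Finset.Icc (-(k : ℤ)) k))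
      refine (ENNReal.ofReal_le_ofReal (h x hx i)).trans (le_of_eq ?_)
      rw [ENNReal.ofReal_sum_of_nonneg fun t _ => hF _]
      exact Finset.sum_congr rfl fun t ht => by
        simp only [hG]; rw [if_pos (update_mem_box hx ht)]
    -- The power m/(m-1) is a product of m factors f^(1/(m-1)), one for each direction, each bounded
    -- along its own line.
    calc ENNReal.ofReal (f x ^ ((m : ℝ) / (m - 1)))
        = ∏ i : Fin m, ENNReal.ofReal (f x) ^ ((1 : ℝ) / ((Fintype.card (Fin m) : ℝ) - 1)) := by
          rw [Finset.prod_const, Finset.card_univ, Fintype.card_fin, ← ENNReal.rpow_natCast,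
            ← ENNReal.rpow_mul, one_div_mul_eq_div, ENNReal.ofReal_rpow_of_nonneg (hf x)
              (div_nonneg (by linarith) (by linarith))]
      _ ≤ _ := by
          refine Finset.prod_le_prod' fun i _ => ENNReal.rpow_le_rpow (hline i) ?_
          rw [Fintype.card_fin]
          exact div_nonneg zero_le_one (by linarith)
  have h3 := e2.trans key
  rw [e1, ENNReal.ofReal_rpow_of_nonneg (Finset.sum_nonneg fun x _ => hF x)
    (div_nonneg (by linarith) (by linarith))] at h3
  exact (ENNReal.ofReal_le_ofReal_iff (Real.rpow_nonneg (Finset.sum_nonneg fun x _ => hF x) _)).1 h3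

theorem sub_le_sum_abs_sub (g : ℤ → ℝ) (k : ℕ) {s t : ℤ} (hs : s ∈ Finset.Icc (-(k : ℤ)) k)
    (ht : t ∈ Finset.Icc (-(k : ℤ)) k) :
    g s - g t ≤ ∑ j ∈ Finset.Ico (-(k : ℤ)) k, |g (j + 1) - g j| := by
  have aux : ∀ (n : ℕ) (a : ℤ), |g (a + n) - g a| ≤ ∑ j ∈ Finset.Ico a (a + n), |g (j + 1) - g j| := by
    intro n a
    induction n with
    | zero => simp
    | succ n ih =>
      have : Finset.Ico a (a + (n + 1 : ℕ)) = insert (a + n) (Finset.Ico a (a + n)) := by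
        ext j; simp; omega
      rw [this, Finset.sum_insert (by simp)]
      push_cast
      rw [← add_assoc]
      calc |g (a + n + 1) - g a| = |(g (a + n + 1) - g (a + n)) + (g (a + n) - g a)| := by ring_nf
        _ ≤ _ := (abs_add_le _ _).trans (by linarith)
  have aux2 : ∀ a b : ℤ, a ∈ Finset.Icc (-(k : ℤ)) k → b ∈ Finset.Icc (-(k : ℤ)) k → a ≤ b →
      |g b - g a| ≤ ∑ j ∈ Finset.Ico (-(k : ℤ)) k, |g (j + 1) - g j| := by
    intro a b ha hb hab
    have h := aux (b - a).toNat a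
    rw [Int.toNat_of_nonneg (by omega), add_sub_cancel] at h
    refine h.trans (Finset.sum_le_sum_of_subset_of_nonneg ?_ fun _ _ _ => abs_nonneg _)
    simp only [Finset.mem_Icc] at ha hb
    exact Finset.Ico_subset_Ico ha.1 hb.2
  rcases le_total s t with h | h
  · exact (le_abs_self _).trans (by rw [abs_sub_comm]; exact aux2 s t hs ht h)
  · exact (le_abs_self _).trans (aux2 t s ht hs h)

/-- Any nonnegative sum over bonds of a box, written as a sum over vertices. -/
theorem sum_bondsIn {d : ℕ} (S : Finset (Vertex d)) (g : Bond d → ℝ) :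
    ∑ e ∈ bondsIn S, g e = ∑ x ∈ S, ∑ i, if (x, i) ∈ bondsIn S then g (x, i) else 0 := by
  rw [← Finset.sum_product (s := S) (t := Finset.univ)
    (f := fun e : Bond d => if e ∈ bondsIn S then g e else 0), ← Finset.sum_filter]
  refine Finset.sum_congr ?_ fun _ _ => rfl
  ext e
  simp only [Finset.mem_filter, Finset.mem_product, Finset.mem_univ, and_true, mem_bondsIn, lower]
  tauto

/-- The Gagliardo-Nirenberg inequality on a discrete cube. -/
theorem sum_rpow_le_sum_grad {m : ℕ} (hm : 2 ≤ m) (k : ℕ) {L : ℝ} (hL : 0 < L)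
    (hLk : L ≤ 2 * k + 1) {f : Vertex m → ℝ} (hf : ∀ x, 0 ≤ f x) :
    ∑ x ∈ box (0 : Vertex m) k, f x ^ ((m : ℝ) / (m - 1)) ≤
      (∑ e ∈ bondsIn (box (0 : Vertex m) k), |grad f e| + L⁻¹ * ∑ x ∈ box (0 : Vertex m) k, f x)
        ^ ((m : ℝ) / (m - 1)) := by
  set F : Vertex m → ℝ := fun x =>
    (∑ i, if (x, i) ∈ bondsIn (box 0 k) then |grad f (x, i)| else 0) + L⁻¹ * f x with hF
  have hs : ∑ x ∈ box (0 : Vertex m) k, F x =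
      ∑ e ∈ bondsIn (box (0 : Vertex m) k), |grad f e| + L⁻¹ * ∑ x ∈ box (0 : Vertex m) k, f x := by
    rw [sum_bondsIn, Finset.mul_sum, ← Finset.sum_add_distrib]
  have hnn : ∀ x (i : Fin m), 0 ≤ if (x, i) ∈ bondsIn (box 0 k) then |grad f (x, i)| else 0 := by
    intro x i; split_ifs <;> simp
  rw [← hs]
  refine sum_rpow_le_of_le_sum_line hm k hf
    (fun x => add_nonneg (Finset.sum_nonneg fun i _ => hnn x i)
      (mul_nonneg (inv_nonneg.2 hL.le) (hf x))) fun x hx i => ?_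
  set I := Finset.Icc (-(k : ℤ)) k
  set g : ℤ → ℝ := fun t => f (Function.update x i t) with hg
  have hxi : x i ∈ I := by
    have := mem_box_zero.1 hx i
    simpa [I] using this
  set D := ∑ j ∈ Finset.Ico (-(k : ℤ)) k, |g (j + 1) - g j| with hD
  -- There is no boundary condition, so f x is compared with every point of its line; averaging over
  -- t then yields the zero order term.
  have h1 : ∀ t ∈ I, f x ≤ D + g t := by
    intro t ht
    have := sub_le_sum_abs_sub g k hxi ht
    simp only [hg, Function.update_eq_self] at this
    simp only [hg, D]
    linarith
  have hcard : (I.card : ℝ) = 2 * k + 1 := by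
    have : I.card = 2 * k + 1 := by
      simp only [I, Int.card_Icc]; omega
    rw [this]; push_cast; ring
  have hD0 : 0 ≤ D := Finset.sum_nonneg fun _ _ => abs_nonneg _
  have h2 : f x ≤ D + L⁻¹ * ∑ t ∈ I, g t := by
    have h3 := Finset.sum_le_sum h1
    rw [Finset.sum_const, Finset.sum_add_distrib, Finset.sum_const, nsmul_eq_mul, nsmul_eq_mul,
      hcard] at h3
    have h4 : 0 ≤ ∑ t ∈ I, g t := Finset.sum_nonneg fun t _ => hf _
    have h5 : (2 * (k : ℝ) + 1) * (f x - D) ≤ ∑ t ∈ I, g t := by linarith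
    -- Any L ≤ 2k+1 may replace the length of the line: if f x ≤ D the left side is nonpositive.
    have h6 : L * (f x - D) ≤ ∑ t ∈ I, g t := by
      rcases le_total 0 (f x - D) with h | h
      · exact (mul_le_mul_of_nonneg_right hLk h).trans h5
      · exact (mul_nonpos_of_nonneg_of_nonpos hL.le h).trans h4
    have := mul_le_mul_of_nonneg_left h6 (inv_nonneg.2 hL.le)
    rw [inv_mul_cancel_left₀ hL.ne'] at this
    linarith
  refine h2.trans ?_
  simp only [hF, Finset.sum_add_distrib, ← Finset.mul_sum]
  refine add_le_add ?_ le_rfl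
  rw [hD]
  have hsub : Finset.Ico (-(k : ℤ)) k ⊆ I := Finset.Ico_subset_Icc_self
  refine le_trans (Finset.sum_le_sum fun j hj => ?_) (Finset.sum_le_sum_of_subset_of_nonneg hsub
    fun j _ _ => Finset.sum_nonneg fun i' _ => hnn _ i')
  refine le_trans (le_of_eq ?_) (Finset.single_le_sum (fun i' _ => hnn _ i') (Finset.mem_univ i))
  have hup : upper ((Function.update x i j, i) : Bond m) = Function.update x i (j + 1) := by
    ext l
    by_cases h : l = i
    · subst h; simp [upper]
    · simp [upper, h]
  have hmem : ((Function.update x i j, i) : Bond m) ∈ bondsIn (box 0 k) := by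
    rw [mem_bondsIn, hup]
    refine ⟨update_mem_box hx (hsub hj), update_mem_box hx ?_⟩
    simp only [Finset.mem_Ico, Finset.mem_Icc] at hj ⊢
    omega
  rw [if_pos hmem, grad, hup]
  rfl

theorem sum_bondsIn_lower_le {d : ℕ} (S : Finset (Vertex d)) {g : Vertex d → ℝ}
    (hg : ∀ x, 0 ≤ g x) : ∑ e ∈ bondsIn S, g (lower e) ≤ d * ∑ x ∈ S, g x := by
  calc ∑ e ∈ bondsIn S, g (lower e) ≤ ∑ e ∈ S ×ˢ (Finset.univ : Finset (Fin d)), g e.1 :=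
        Finset.sum_le_sum_of_subset_of_nonneg (Finset.filter_subset _ _) fun _ _ _ => hg _
    _ = _ := by rw [Finset.sum_product]; simp [Finset.mul_sum]

/-- A vertex is the upper end point of at most one bond in each direction. -/
theorem sum_bondsIn_upper_le {d : ℕ} (S : Finset (Vertex d)) {g : Vertex d → ℝ}
    (hg : ∀ x, 0 ≤ g x) : ∑ e ∈ bondsIn S, g (upper e) ≤ d * ∑ x ∈ S, g x := by
  have hinj : Set.InjOn (fun e : Bond d => (upper e, e.2)) (bondsIn S : Set (Bond d)) := by
    rintro ⟨x, i⟩ - ⟨y, j⟩ - h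
    simp only [upper, Prod.mk.injEq] at h
    obtain ⟨h1, rfl⟩ := h
    rw [add_right_cancel h1]
  calc ∑ e ∈ bondsIn S, g (upper e)
      = ∑ e ∈ (bondsIn S).image (fun e : Bond d => (upper e, e.2)), g e.1 := by
        rw [Finset.sum_image hinj]
    _ ≤ ∑ e ∈ S ×ˢ (Finset.univ : Finset (Fin d)), g e.1 := by
        refine Finset.sum_le_sum_of_subset_of_nonneg ?_ fun _ _ _ => hg _
        intro e he
        obtain ⟨e', he', rfl⟩ := Finset.mem_image.1 he
        simpa using (mem_bondsIn.1 he').2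
    _ = _ := by rw [Finset.sum_product]; simp [Finset.mul_sum]

/-- The scaled first order energy of `v` with exponent `t` on the set `S`, at length scale `L`. -/
noncomputable def sobolevSum {d : ℕ} (t L : ℝ) (v : Vertex d → ℝ) (S : Finset (Vertex d)) : ℝ :=
  ∑ e ∈ bondsIn S, |grad v e| ^ t + L ^ (-t) * ∑ x ∈ S, |v x| ^ t

theorem sobolevSum_nonneg {d : ℕ} {t L : ℝ} (hL : 0 ≤ L) (v : Vertex d → ℝ)
    (S : Finset (Vertex d)) : 0 ≤ sobolevSum t L v S :=
  add_nonneg (Finset.sum_nonneg fun _ _ => Real.rpow_nonneg (abs_nonneg _) _)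
    (mul_nonneg (Real.rpow_nonneg hL _)
      (Finset.sum_nonneg fun _ _ => Real.rpow_nonneg (abs_nonneg _) _))

/-- The Sobolev inequality on a discrete cube. -/
theorem sobolev_box {m : ℕ} (hm : 2 ≤ m) {t T : ℝ} (ht : 1 ≤ t) (hT : 0 < T)
    (htT : 1 / T = 1 / t - 1 / m) :
    ∃ C : ℝ, 0 ≤ C ∧ ∀ (k : ℕ) (L : ℝ), 0 < L → L ≤ 2 * k + 1 →
      ∀ g : Vertex m → ℝ, (∀ x, 0 ≤ g x) →
        ∑ x ∈ box 0 k, g x ^ T ≤ C * sobolevSum t L g (box 0 k) ^ (T / t) := by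
  have hm' : (2 : ℝ) ≤ m := by exact_mod_cast hm
  have hm0 : (0 : ℝ) < m := by linarith
  have ht0 : 0 < t := by linarith
  have hθ1 : 1 / t ≤ 1 := by rw [div_le_one ht0]; exact ht
  have hθ0 : 0 ≤ 1 / t := by positivity
  -- The case t = 1 is applied to g^β. This choice gives β m/(m-1) = T on the left and T (1 - 1/t) =
  -- β - 1, so that Hölder on g^(β-1) |∇g| reproduces the sum G of g^T.
  set β := T * (1 - 1 / m) with hβ
  have hTT : T * (1 / T) = 1 := mul_one_div_cancel hT.ne'
  have hβT : T * (1 - 1 / t) = β - 1 := by rw [htT] at hTT; rw [hβ]; linarith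
  have hβ1 : 1 ≤ β := by
    have : 0 ≤ T * (1 - 1 / t) := mul_nonneg hT.le (by linarith)
    linarith
  set C₁ := 2 * β * m + 1 with hC₁
  have hC0 : 0 < C₁ := by positivity
  refine ⟨C₁ ^ T, by positivity, fun k L hL hLk g hg => ?_⟩
  set S := box (0 : Vertex m) k
  set H := sobolevSum t L g S with hH
  set G := ∑ x ∈ S, g x ^ T with hG
  have hgT : ∀ x, 0 ≤ g x ^ T := fun x => Real.rpow_nonneg (hg x) _
  have hG0 : 0 ≤ G := Finset.sum_nonneg fun x _ => hgT x
  have hH0 : 0 ≤ H := sobolevSum_nonneg hL.le g S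
  -- G has to be positive because a power of it is cancelled at the end.
  rcases hG0.eq_or_lt with hz | hGpos
  · rw [← hz]; positivity
  have hpow : ∀ x, (g x ^ T) ^ (1 - 1 / t) = g x ^ (β - 1) := fun x => by
    rw [← Real.rpow_mul (hg x), hβT]
  have hpow2 : ∀ y : ℝ, 0 ≤ y → (y ^ t) ^ (1 / t) = y := fun y hy => by
    rw [← Real.rpow_mul hy, mul_one_div_cancel ht0.ne', Real.rpow_one]
  have hE1 : ∑ e ∈ bondsIn S, |grad g e| ^ t ≤ H := by
    rw [hH, sobolevSum]
    have : 0 ≤ L ^ (-t) * ∑ x ∈ S, |g x| ^ t := mul_nonneg (Real.rpow_nonneg hL.le _)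
      (Finset.sum_nonneg fun _ _ => Real.rpow_nonneg (abs_nonneg _) _)
    linarith
  have hE2 : ∑ x ∈ S, (L⁻¹ * g x) ^ t ≤ H := by
    rw [hH, sobolevSum]
    have h1 : 0 ≤ ∑ e ∈ bondsIn S, |grad g e| ^ t :=
      Finset.sum_nonneg fun _ _ => Real.rpow_nonneg (abs_nonneg _) _
    have h2 : ∑ x ∈ S, (L⁻¹ * g x) ^ t = L ^ (-t) * ∑ x ∈ S, |g x| ^ t := by
      rw [Finset.mul_sum]
      refine Finset.sum_congr rfl fun x _ => ?_
      rw [Real.mul_rpow (inv_nonneg.2 hL.le) (hg x), abs_of_nonneg (hg x), Real.rpow_neg hL.le,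
        Real.inv_rpow hL.le]
    linarith
  have hmθ : (m : ℝ) ^ (1 - 1 / t) ≤ m := by
    calc (m : ℝ) ^ (1 - 1 / t) ≤ (m : ℝ) ^ (1 : ℝ) :=
          Real.rpow_le_rpow_of_exponent_le (by linarith) (by linarith)
      _ = m := Real.rpow_one _
  have hside : ∀ ε : Bond m → Vertex m, ∑ e ∈ bondsIn S, g (ε e) ^ T ≤ m * G →
      ∑ e ∈ bondsIn S, g (ε e) ^ (β - 1) * |grad g e| ≤ m * (G ^ (1 - 1 / t) * H ^ (1 / t)) := by
    intro ε hε
    have h := sum_rpow_mul_rpow_le (bondsIn S) (A := fun e => g (ε e) ^ T)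
      (B := fun e => |grad g e| ^ t) hθ0 hθ1 (fun e _ => hgT _)
      (fun e _ => Real.rpow_nonneg (abs_nonneg _) _)
    simp only [hpow, hpow2 _ (abs_nonneg _)] at h
    refine h.trans ?_
    calc _ ≤ (m * G) ^ (1 - 1 / t) * H ^ (1 / t) := by
          refine mul_le_mul (Real.rpow_le_rpow (Finset.sum_nonneg fun e _ => hgT _) hε
            (by linarith)) (Real.rpow_le_rpow (Finset.sum_nonneg fun e _ =>
              Real.rpow_nonneg (abs_nonneg _) _) hE1 hθ0) ?_ (by positivity)
          exact Real.rpow_nonneg (Finset.sum_nonneg fun e _ =>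
              Real.rpow_nonneg (abs_nonneg _) _) _
      _ = (m : ℝ) ^ (1 - 1 / t) * (G ^ (1 - 1 / t) * H ^ (1 / t)) := by
          rw [Real.mul_rpow hm0.le hG0]; ring
      _ ≤ _ := by gcongr
  have hlow := hside lower (sum_bondsIn_lower_le S hgT)
  have hup := hside upper (sum_bondsIn_upper_le S hgT)
  have hzero : L⁻¹ * ∑ x ∈ S, g x ^ β ≤ G ^ (1 - 1 / t) * H ^ (1 / t) := by
    have h := sum_rpow_mul_rpow_le S (A := fun x => g x ^ T)
      (B := fun x => (L⁻¹ * g x) ^ t) hθ0 hθ1 (fun x _ => hgT _)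
      (fun x _ => Real.rpow_nonneg (mul_nonneg (inv_nonneg.2 hL.le) (hg x)) _)
    simp only [hpow, hpow2 _ (mul_nonneg (inv_nonneg.2 hL.le) (hg _))] at h
    calc L⁻¹ * ∑ x ∈ S, g x ^ β = ∑ x ∈ S, g x ^ (β - 1) * (L⁻¹ * g x) := by
          rw [Finset.mul_sum]
          refine Finset.sum_congr rfl fun x _ => ?_
          have : g x ^ β = g x ^ (β - 1) * g x := by
            rw [← Real.rpow_add_one' (hg x) (by linarith), sub_add_cancel]
          rw [this]; ring
      _ ≤ _ := h.trans (mul_le_mul_of_nonneg_left (Real.rpow_le_rpow (Finset.sum_nonneg fun x _ =>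
          Real.rpow_nonneg (mul_nonneg (inv_nonneg.2 hL.le) (hg x)) _) hE2 hθ0) (by positivity))
  have hA : ∑ e ∈ bondsIn S, |grad (fun x => g x ^ β) e| + L⁻¹ * ∑ x ∈ S, g x ^ β ≤
      C₁ * (G ^ (1 - 1 / t) * H ^ (1 / t)) := by
    have h1 : ∑ e ∈ bondsIn S, |grad (fun x => g x ^ β) e| ≤
        β * (∑ e ∈ bondsIn S, g (lower e) ^ (β - 1) * |grad g e| +
          ∑ e ∈ bondsIn S, g (upper e) ^ (β - 1) * |grad g e|) := by
      rw [← Finset.sum_add_distrib, Finset.mul_sum]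
      refine Finset.sum_le_sum fun e _ => ?_
      refine (abs_rpow_sub_rpow_le hβ1 (hg (lower e)) (hg (upper e))).trans (le_of_eq ?_)
      rw [grad]; ring
    have h2 : β * (∑ e ∈ bondsIn S, g (lower e) ^ (β - 1) * |grad g e| +
          ∑ e ∈ bondsIn S, g (upper e) ^ (β - 1) * |grad g e|) ≤
        β * (m * (G ^ (1 - 1 / t) * H ^ (1 / t)) + m * (G ^ (1 - 1 / t) * H ^ (1 / t))) := by
      gcongr
    rw [hC₁]
    linarith
  have hmain := sum_rpow_le_sum_grad hm k hL hLk (f := fun x => g x ^ β)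
    (fun x => Real.rpow_nonneg (hg x) _)
  have hmm : β * ((m : ℝ) / (m - 1)) = T := by
    rw [hβ]; field_simp [show (m : ℝ) - 1 ≠ 0 by linarith]
  simp only [← Real.rpow_mul (hg _), hmm] at hmain
  have hA0 : 0 ≤ ∑ e ∈ bondsIn S, |grad (fun x => g x ^ β) e| + L⁻¹ * ∑ x ∈ S, g x ^ β :=
    add_nonneg (Finset.sum_nonneg fun _ _ => abs_nonneg _) (mul_nonneg (inv_nonneg.2 hL.le)
      (Finset.sum_nonneg fun x _ => Real.rpow_nonneg (hg x) _))
  have hκ : 0 < (m : ℝ) / (m - 1) := div_pos hm0 (by linarith)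
  have h1 : G ^ (1 - 1 / (m : ℝ)) ≤ C₁ * (G ^ (1 - 1 / t) * H ^ (1 / t)) := by
    have := Real.rpow_le_rpow hG0 hmain (z := 1 - 1 / (m : ℝ)) (by
      rw [sub_nonneg, div_le_one hm0]; linarith)
    rw [← Real.rpow_mul hA0] at this
    have e : (m : ℝ) / (m - 1) * (1 - 1 / m) = 1 := by
      field_simp [show (m : ℝ) - 1 ≠ 0 by linarith]
    rw [e, Real.rpow_one] at this
    exact this.trans hA
  -- Dividing by G^(1-1/t) leaves the exponent (1 - 1/m) - (1 - 1/t) = 1/T.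
  have h2 : G ^ (1 / T) ≤ C₁ * H ^ (1 / t) := by
    have e : 1 - 1 / (m : ℝ) = 1 / T + (1 - 1 / t) := by rw [htT]; ring
    rw [e, Real.rpow_add hGpos] at h1
    refine le_of_mul_le_mul_right ?_ (Real.rpow_pos_of_pos hGpos (1 - 1 / t))
    linarith
  calc G = (G ^ (1 / T)) ^ T := by rw [← Real.rpow_mul hG0, one_div_mul_cancel hT.ne', Real.rpow_one]
    _ ≤ (C₁ * H ^ (1 / t)) ^ T := Real.rpow_le_rpow (by positivity) h2 hT.le
    _ = C₁ ^ T * H ^ (T / t) := by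
        rw [Real.mul_rpow hC0.le (by positivity), ← Real.rpow_mul hH0]
        ring_nf

/-! ### Summation by parts and Caccioppoli's inequality -/

/-- The sup norm of a lattice point. -/
def radius {d : ℕ} (x : Vertex d) : ℕ := Finset.univ.sup fun i => (x i).natAbs

theorem radius_le_iff {d : ℕ} {x : Vertex d} {n : ℕ} : radius x ≤ n ↔ ∀ i, (x i).natAbs ≤ n := by
  simp [radius]

theorem mem_box_zero_iff_radius {d : ℕ} {x : Vertex d} {n : ℕ} : x ∈ box 0 n ↔ radius x ≤ n := by
  rw [mem_box_zero, radius_le_iff]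
  exact forall_congr' fun i => by omega

theorem natAbs_le_radius {d : ℕ} (x : Vertex d) (i : Fin d) : (x i).natAbs ≤ radius x :=
  radius_le_iff.1 le_rfl i

theorem radius_upper_le {d : ℕ} (e : Bond d) : radius (upper e) ≤ radius (lower e) + 1 := by
  rw [radius_le_iff]
  intro j
  have := natAbs_le_radius (lower e) j
  simp only [upper, lower, Pi.add_apply, Pi.single_apply] at this ⊢
  split_ifs <;> omega

theorem radius_lower_le {d : ℕ} (e : Bond d) : radius (lower e) ≤ radius (upper e) + 1 := by
  rw [radius_le_iff]
  intro j
  have := natAbs_le_radius (upper e) j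
  simp only [upper, lower, Pi.add_apply, Pi.single_apply] at this ⊢
  split_ifs at this <;> omega

theorem box_mono {d : ℕ} {m n : ℕ} (h : m ≤ n) : box (0 : Vertex d) m ⊆ box 0 n := fun x hx => by
  rw [mem_box_zero_iff_radius] at hx ⊢; omega

theorem bondsIn_mono {d : ℕ} {S T : Finset (Vertex d)} (h : S ⊆ T) : bondsIn S ⊆ bondsIn T :=
  fun e he => by
    rw [mem_bondsIn] at he ⊢; exact ⟨h he.1, h he.2⟩

/-- Summation by parts against a function supported inside a box. -/
theorem sum_mul_grad {d : ℕ} {σ : ℕ} (F : Bond d → ℝ) {φ : Vertex d → ℝ}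
    (hφ : ∀ x, σ ≤ radius x → φ x = 0) :
    ∑ e ∈ bondsIn (box (0 : Vertex d) σ), F e * grad φ e =
      ∑ x ∈ box (0 : Vertex d) σ, φ x * dvg F x := by
  set S := box (0 : Vertex d) σ
  have h1 : ∑ e ∈ bondsIn S, F e * φ (lower e) = ∑ x ∈ S, ∑ i, F (x, i) * φ x := by
    rw [← Finset.sum_product (s := S) (t := Finset.univ) (f := fun e : Bond d => F e * φ e.1)]
    refine Finset.sum_subset (Finset.filter_subset _ _) fun e he he' => ?_
    -- A bond that leaves the box starts at radius σ, where φ vanishes, so no boundary term appears.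
    suffices h : φ (lower e) = 0 by rw [h, mul_zero]
    refine hφ _ ?_
    have hup : upper e ∉ S := fun h => he' (mem_bondsIn.2 ⟨(Finset.mem_product.1 he).1, h⟩)
    rw [mem_box_zero_iff_radius] at hup
    have := radius_upper_le e
    omega
  have h2 : ∑ e ∈ bondsIn S, F e * φ (upper e) =
      ∑ x ∈ S, ∑ i, F (x - Pi.single i 1, i) * φ x := by
    have hprod := Finset.sum_product S Finset.univ
      (fun e : Bond d => F (e.1 - Pi.single e.2 1, e.2) * φ e.1)
    refine Eq.trans ?_ hprod
    have hinj : Set.InjOn (fun e : Bond d => (upper e, e.2)) (bondsIn S : Set (Bond d)) := by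
      rintro ⟨x, i⟩ - ⟨y, j⟩ - h
      simp only [upper, Prod.mk.injEq] at h
      obtain ⟨h1, rfl⟩ := h
      rw [add_right_cancel h1]
    have himg : (bondsIn S).image (fun e : Bond d => (upper e, e.2)) ⊆ S ×ˢ Finset.univ := by
      intro e he
      obtain ⟨e', he', rfl⟩ := Finset.mem_image.1 he
      simpa using (mem_bondsIn.1 he').2
    rw [← Finset.sum_subset himg, Finset.sum_image hinj]
    · refine Finset.sum_congr rfl fun e _ => ?_
      simp [upper]
    · intro e he he'
      rw [hφ e.1, mul_zero]
      set e₀ : Bond d := (e.1 - Pi.single e.2 1, e.2) with he₀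
      have hup : upper e₀ = e.1 := by simp [upper, he₀]
      have hlow : lower e₀ ∉ S := fun h => he' (Finset.mem_image.2 ⟨e₀, mem_bondsIn.2
        ⟨h, by rw [hup]; exact (Finset.mem_product.1 he).1⟩, by rw [hup]⟩)
      rw [mem_box_zero_iff_radius] at hlow
      have := radius_lower_le e₀
      rw [hup] at this
      omega
  simp only [grad, mul_sub, Finset.sum_sub_distrib, h1, h2, dvg, Finset.mul_sum]
  simp only [mul_comm]

/-- Caccioppoli's inequality for powers of a harmonic function. -/
theorem caccioppoli {d : ℕ} {ω : Bond d → ℝ} (hω : ∀ e, 0 < ω e) {u : Vertex d → ℝ}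
    (hu : ∀ x, dvg (fun e => ω e * grad u e) x = 0) {α : ℝ} (hα : 1 ≤ α) {ρ σ : ℕ} (hρσ : ρ ≤ σ)
    {η : Vertex d → ℝ} (hη0 : ∀ x, 0 ≤ η x) (hη1 : ∀ x, radius x ≤ ρ → η x = 1)
    (hησ : ∀ x, σ ≤ radius x → η x = 0) :
    ∑ e ∈ bondsIn (box (0 : Vertex d) ρ), ω e * grad (fun x => |u x| ^ α) e ^ 2 ≤
      6 * α * ∑ e ∈ bondsIn (box (0 : Vertex d) σ), ω e * (grad η e ^ 2 *
        ((|u (lower e)| ^ α) ^ 2 + (|u (upper e)| ^ α) ^ 2)) := by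
  have hα0 : 0 ≤ α := by linarith
  -- The test function is η² sign(u) |u|^(2α-1); its pairing with the flux ω∇u vanishes by the
  -- equation.
  have hibp := sum_mul_grad (σ := σ) (fun e => ω e * grad u e)
    (φ := fun x => η x ^ 2 * oddPow α (u x)) (fun x hx => by simp [hησ x hx])
  simp only [hu, mul_zero, Finset.sum_const_zero] at hibp
  have hpt : ∀ e : Bond d, ω e * (min (η (upper e)) (η (lower e)) ^ 2 *
      grad (fun x => |u x| ^ α) e ^ 2) ≤
      2 * α * (ω e * grad u e * grad (fun x => η x ^ 2 * oddPow α (u x)) e) +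
      6 * α * (ω e * (grad η e ^ 2 *
        ((|u (lower e)| ^ α) ^ 2 + (|u (upper e)| ^ α) ^ 2))) := by
    intro e
    have h := energy_bound (x := u (lower e)) (y := u (upper e)) hα (hη0 (upper e)) (hη0 (lower e))
    have hmax : max (|u (lower e)| ^ α) (|u (upper e)| ^ α) ^ 2 ≤
        (|u (lower e)| ^ α) ^ 2 + (|u (upper e)| ^ α) ^ 2 := by
      rcases max_choice (|u (lower e)| ^ α) (|u (upper e)| ^ α) with h | h <;> rw [h] <;>
        nlinarith [sq_nonneg (|u (lower e)| ^ α), sq_nonneg (|u (upper e)| ^ α)]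
    have h2 := mul_le_mul_of_nonneg_left hmax
      (by positivity : 0 ≤ 6 * α * (η (upper e) - η (lower e)) ^ 2)
    have h3 := mul_le_mul_of_nonneg_left (h.trans (add_le_add le_rfl h2)) (hω e).le
    simp only [grad]
    linarith
  calc ∑ e ∈ bondsIn (box (0 : Vertex d) ρ), ω e * grad (fun x => |u x| ^ α) e ^ 2
      = ∑ e ∈ bondsIn (box (0 : Vertex d) ρ), ω e * (min (η (upper e)) (η (lower e)) ^ 2 *
          grad (fun x => |u x| ^ α) e ^ 2) := by
        refine Finset.sum_congr rfl fun e he => ?_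
        rw [mem_bondsIn, mem_box_zero_iff_radius, mem_box_zero_iff_radius] at he
        rw [hη1 _ he.1, hη1 _ he.2]; simp
    _ ≤ ∑ e ∈ bondsIn (box (0 : Vertex d) σ), ω e * (min (η (upper e)) (η (lower e)) ^ 2 *
          grad (fun x => |u x| ^ α) e ^ 2) :=
        Finset.sum_le_sum_of_subset_of_nonneg (bondsIn_mono (box_mono hρσ)) fun e _ _ =>
          mul_nonneg (hω e).le (by positivity)
    _ ≤ _ := Finset.sum_le_sum fun e _ => hpt e
    _ = _ := by
        rw [Finset.sum_add_distrib, ← Finset.mul_sum, hibp, mul_zero, zero_add, ← Finset.mul_sum]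

/-! ### Radial cutoffs that drop on chosen layers -/

/-- The bonds connecting the spheres of radius `k` and `k + 1`. -/
noncomputable def layer (d k : ℕ) : Finset (Bond d) :=
  (bondsIn (box 0 (k + 1))).filter fun e => radius (lower e) ≠ radius (upper e) ∧
    min (radius (lower e)) (radius (upper e)) = k

theorem mem_layer {d k : ℕ} {e : Bond d} : e ∈ layer d k ↔
    (radius (lower e) = k ∧ radius (upper e) = k + 1) ∨
      (radius (lower e) = k + 1 ∧ radius (upper e) = k) := by
  have h1 := radius_upper_le e
  have h2 := radius_lower_le e
  simp only [layer, Finset.mem_filter, mem_bondsIn, mem_box_zero_iff_radius]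
  omega

theorem layer_subset {d k σ : ℕ} (h : k < σ) : layer d k ⊆ bondsIn (box 0 σ) := fun e he => by
  rw [mem_layer] at he
  rw [mem_bondsIn, mem_box_zero_iff_radius, mem_box_zero_iff_radius]
  omega

/-- Caccioppoli's inequality with a radial cutoff that decreases on the layers in `G` only. -/
theorem caccioppoli_layers {d : ℕ} {ω : Bond d → ℝ} (hω : ∀ e, 0 < ω e) {u : Vertex d → ℝ}
    (hu : ∀ x, dvg (fun e => ω e * grad u e) x = 0) {α : ℝ} (hα : 1 ≤ α) {ρ σ : ℕ} (hρσ : ρ ≤ σ)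
    {G : Finset ℕ} (hG : G ⊆ Finset.Ico ρ σ) (hG0 : G.Nonempty) :
    ∑ e ∈ bondsIn (box (0 : Vertex d) ρ), ω e * grad (fun x => |u x| ^ α) e ^ 2 ≤
      6 * α * ((G.card : ℝ)⁻¹ ^ 2 * ∑ k ∈ G, ∑ e ∈ layer d k, ω e *
        ((|u (lower e)| ^ α) ^ 2 + (|u (upper e)| ^ α) ^ 2)) := by
  have hα0 : 0 ≤ α := by linarith
  have hc : (0 : ℝ) < G.card := by exact_mod_cast hG0.card_pos
  -- The cutoff falls from 1 to 0 in equal steps 1/|G|, one on each layer of G; the square of the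
  -- step is the prefactor of the estimate.
  set Φ : ℕ → ℝ := fun k => 1 - (G.card : ℝ)⁻¹ * (G.filter (· < k)).card with hΦ
  have hstep : ∀ k, Φ (k + 1) - Φ k = -(if k ∈ G then (G.card : ℝ)⁻¹ else 0) := by
    intro k
    have : G.filter (· < k + 1) = if k ∈ G then insert k (G.filter (· < k)) else G.filter (· < k) := by
      split_ifs with h
      · ext j; simp only [Finset.mem_filter, Finset.mem_insert]
        constructor
        · rintro ⟨h1, h2⟩; rcases Nat.lt_succ_iff_lt_or_eq.1 h2 with h | h <;> tauto
        · rintro (rfl | ⟨h1, h2⟩)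
          · exact ⟨h, by omega⟩
          · exact ⟨h1, by omega⟩
      · ext j; simp only [Finset.mem_filter]
        refine and_congr_right fun hj => ?_
        have : j ≠ k := fun e => h (e ▸ hj)
        omega
    simp only [hΦ, this]
    split_ifs
    · rw [Finset.card_insert_of_notMem (by simp)]; push_cast; ring
    · ring
  refine (caccioppoli hω hu hα hρσ (η := fun x => Φ (radius x)) (fun x => ?_) (fun x hx => ?_)
    (fun x hx => ?_)).trans ?_
  · have h1 : ((G.filter (· < radius x)).card : ℝ) ≤ G.card := by
      exact_mod_cast Finset.card_filter_le _ _
    have h2 := mul_le_mul_of_nonneg_left h1 (inv_nonneg.2 hc.le)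
    rw [inv_mul_cancel₀ hc.ne'] at h2
    simp only [hΦ]; linarith
  · have : G.filter (· < radius x) = ∅ := by
      refine Finset.filter_eq_empty_iff.2 fun j hj => ?_
      have := Finset.mem_Ico.1 (hG hj); omega
    simp [hΦ, this]
  · have : G.filter (· < radius x) = G := by
      refine Finset.filter_eq_self.2 fun j hj => ?_
      have := Finset.mem_Ico.1 (hG hj); omega
    simp only [hΦ, this]
    rw [inv_mul_cancel₀ hc.ne', sub_self]
  · gcongr 6 * α * ?_
    set M : Bond d → ℝ := fun e => (|u (lower e)| ^ α) ^ 2 + (|u (upper e)| ^ α) ^ 2 with hM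
    have hM0 : ∀ e, 0 ≤ M e := fun e => by positivity
    have hgrad : ∀ e : Bond d, grad (fun x => Φ (radius x)) e ^ 2 ≤
        (G.card : ℝ)⁻¹ ^ 2 * ∑ k ∈ G, if e ∈ layer d k then 1 else 0 := by
      intro e
      have hnn : ∀ k ∈ G, (0 : ℝ) ≤ if e ∈ layer d k then 1 else 0 := fun k _ => by
        split_ifs <;> norm_num
      -- A bond with both ends on the same sphere does not see the radial cutoff.
      by_cases heq : radius (lower e) = radius (upper e)
      · simp only [grad, heq, sub_self]
        rw [zero_pow two_ne_zero]
        exact mul_nonneg (by positivity) (Finset.sum_nonneg hnn)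
      have h1 := radius_upper_le e
      have h2 := radius_lower_le e
      obtain ⟨k, hk⟩ : ∃ k, e ∈ layer d k := by
        simp only [mem_layer]
        rcases Nat.lt_or_gt_of_ne heq with h | h
        · exact ⟨radius (lower e), Or.inl ⟨rfl, by omega⟩⟩
        · exact ⟨radius (upper e), Or.inr ⟨by omega, rfl⟩⟩
      have hsq : grad (fun x => Φ (radius x)) e ^ 2 = (if k ∈ G then (G.card : ℝ)⁻¹ else 0) ^ 2 := by
        rcases mem_layer.1 hk with ⟨ha, hb⟩ | ⟨ha, hb⟩ <;> simp only [grad, ha, hb]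
        · rw [hstep, neg_sq]
        · rw [← neg_sub, hstep, neg_neg]
      rw [hsq]
      split_ifs with hkG
      · have := Finset.single_le_sum hnn hkG
        rw [if_pos hk] at this
        have h3 : 0 ≤ (G.card : ℝ)⁻¹ ^ 2 := by positivity
        nlinarith
      · rw [zero_pow two_ne_zero]
        exact mul_nonneg (by positivity) (Finset.sum_nonneg hnn)
    calc ∑ e ∈ bondsIn (box (0 : Vertex d) σ), ω e * (grad (fun x => Φ (radius x)) e ^ 2 * M e)
        ≤ ∑ e ∈ bondsIn (box (0 : Vertex d) σ), (G.card : ℝ)⁻¹ ^ 2 * ∑ k ∈ G,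
            (if e ∈ layer d k then ω e * M e else 0) := by
          refine Finset.sum_le_sum fun e _ => ?_
          have h1 := mul_le_mul_of_nonneg_right (hgrad e) (mul_nonneg (hω e).le (hM0 e))
          calc _ = grad (fun x => Φ (radius x)) e ^ 2 * (ω e * M e) := by ring
            _ ≤ _ := h1
            _ = _ := by
              rw [mul_assoc, Finset.sum_mul]
              congr 1
              exact Finset.sum_congr rfl fun k _ => by split_ifs <;> simp
      _ = _ := by
          rw [← Finset.mul_sum, Finset.sum_comm]
          congr 1
          refine Finset.sum_congr rfl fun k hk => ?_
          rw [← Finset.sum_filter]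
          refine Finset.sum_congr ?_ fun _ _ => rfl
          ext e
          simp only [Finset.mem_filter, and_iff_right_iff_imp]
          exact fun h => layer_subset (Finset.mem_Ico.1 (hG hk)).2 h

/-! ### Hyperplane slices and the Sobolev inequality on spheres -/

/-- The contribution of the vertex `x` to `sobolevSum t L v (box 0 R)`. -/
noncomputable def jet {d : ℕ} (t L : ℝ) (v : Vertex d → ℝ) (R : ℕ) (x : Vertex d) : ℝ :=
  (∑ i, if (x, i) ∈ bondsIn (box 0 R) then |grad v (x, i)| ^ t else 0) + L ^ (-t) * |v x| ^ t

theorem jet_nonneg {d : ℕ} {t L : ℝ} (hL : 0 ≤ L) (v : Vertex d → ℝ) (R : ℕ) (x : Vertex d) :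
    0 ≤ jet t L v R x := by
  refine add_nonneg (Finset.sum_nonneg fun i _ => ?_)
    (mul_nonneg (Real.rpow_nonneg hL _) (Real.rpow_nonneg (abs_nonneg _) _))
  split_ifs
  · exact Real.rpow_nonneg (abs_nonneg _) _
  · exact le_rfl

theorem sum_jet {d : ℕ} (t L : ℝ) (v : Vertex d → ℝ) (R : ℕ) :
    ∑ x ∈ box 0 R, jet t L v R x = sobolevSum t L v (box 0 R) := by
  simp only [jet, Finset.sum_add_distrib, sobolevSum, sum_bondsIn, Finset.mul_sum]

/-- The part of `sobolevSum t L v (box 0 R)` carried by the hyperplane `x i = s`. -/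
noncomputable def slab {d : ℕ} (t L : ℝ) (v : Vertex d → ℝ) (R : ℕ) (i : Fin d) (s : ℤ) : ℝ :=
  ∑ x ∈ (box 0 R).filter (fun x => x i = s), jet t L v R x

theorem slab_nonneg {d : ℕ} {t L : ℝ} (hL : 0 ≤ L) (v : Vertex d → ℝ) (R : ℕ) (i : Fin d)
    (s : ℤ) : 0 ≤ slab t L v R i s :=
  Finset.sum_nonneg fun x _ => jet_nonneg hL v R x

/-- Distinct parallel hyperplanes are disjoint, and each bond is counted at its lower end point
only. -/
theorem sum_slab_le {d : ℕ} {t L : ℝ} (hL : 0 ≤ L) (v : Vertex d → ℝ) (R : ℕ) (i : Fin d)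
    (I : Finset ℕ) {s : ℕ → ℤ} (hs : Function.Injective s) :
    ∑ k ∈ I, slab t L v R i (s k) ≤ sobolevSum t L v (box 0 R) := by
  simp only [slab, ← sum_jet]
  rw [← Finset.sum_biUnion]
  · refine Finset.sum_le_sum_of_subset_of_nonneg ?_ fun x _ _ => jet_nonneg hL v R x
    intro x hx
    obtain ⟨k, -, hk⟩ := Finset.mem_biUnion.1 hx
    exact (Finset.mem_filter.1 hk).1
  · intro k _ l _ hkl
    refine Finset.disjoint_left.2 fun x hx hx' => hkl (hs ?_)
    rw [← (Finset.mem_filter.1 hx).2, ← (Finset.mem_filter.1 hx').2]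

/-- The embedding of `ℤ^m` as the hyperplane `x i = s` of `ℤ^(m+1)`. -/
def slice {m : ℕ} (i : Fin (m + 1)) (s : ℤ) (z : Vertex m) : Vertex (m + 1) :=
  Fin.insertNth (α := fun _ => ℤ) i s z

@[simp] theorem slice_same {m : ℕ} (i : Fin (m + 1)) (s : ℤ) (z : Vertex m) : slice i s z i = s := by
  simp [slice]

@[simp] theorem slice_succAbove {m : ℕ} (i : Fin (m + 1)) (s : ℤ) (z : Vertex m) (j : Fin m) :
    slice i s z (i.succAbove j) = z j := by
  simp [slice]

theorem slice_injective {m : ℕ} (i : Fin (m + 1)) (s : ℤ) :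
    Function.Injective (slice (m := m) i s) := fun z w h => by
  ext j
  simpa using congrFun h (i.succAbove j)

theorem slice_add_single {m : ℕ} (i : Fin (m + 1)) (s : ℤ) (z : Vertex m) (j : Fin m) :
    slice i s (z + Pi.single j 1) = slice i s z + Pi.single (i.succAbove j) 1 := by
  ext l
  rcases Fin.eq_self_or_eq_succAbove i l with rfl | ⟨l, rfl⟩
  · simp [Fin.ne_succAbove]
  · simp [Pi.single_apply]

theorem slice_removeNth {m : ℕ} (i : Fin (m + 1)) (x : Vertex (m + 1)) :
    slice i (x i) (fun j => x (i.succAbove j)) = x := by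
  ext l
  rcases Fin.eq_self_or_eq_succAbove i l with rfl | ⟨l, rfl⟩ <;> simp

theorem slice_mem_box {m : ℕ} {i : Fin (m + 1)} {s : ℤ} {z : Vertex m} {k R : ℕ}
    (hs : s.natAbs ≤ R) (hk : k ≤ R) (hz : z ∈ box 0 k) : slice i s z ∈ box 0 R := by
  rw [mem_box_zero_iff_radius, radius_le_iff] at hz ⊢
  intro l
  rcases Fin.eq_self_or_eq_succAbove i l with rfl | ⟨l, rfl⟩
  · simpa using hs
  · simpa using (hz l).trans hk

/-- The bonds of the slice are the tangential bonds of the hyperplane; those in direction i are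
counted in the slab but not needed. -/
theorem sobolevSum_slice_le {m : ℕ} {t L : ℝ} (hL : 0 ≤ L) (v : Vertex (m + 1) → ℝ) {k R : ℕ}
    (hk : k ≤ R) (i : Fin (m + 1)) {s : ℤ} (hs : s.natAbs ≤ R) :
    sobolevSum t L (fun z => v (slice i s z)) (box 0 k) ≤ slab t L v R i s := by
  have himg : (box (0 : Vertex m) k).image (slice i s) ⊆ (box 0 R).filter (fun x => x i = s) := by
    intro x hx
    obtain ⟨z, hz, rfl⟩ := Finset.mem_image.1 hx
    simpa using slice_mem_box hs hk hz
  rw [← sum_jet, slab]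
  refine le_trans ?_ (Finset.sum_le_sum_of_subset_of_nonneg himg fun x _ _ => jet_nonneg hL v R x)
  rw [Finset.sum_image ((slice_injective i s).injOn)]
  refine Finset.sum_le_sum fun z _ => ?_
  simp only [jet]
  refine add_le_add ?_ le_rfl
  rw [Fin.sum_univ_succAbove _ i]
  have hnn : ∀ l, 0 ≤ if (slice i s z, l) ∈ bondsIn (box 0 R) then |grad v (slice i s z, l)| ^ t
      else 0 := fun l => by
    split_ifs
    · exact Real.rpow_nonneg (abs_nonneg _) _
    · exact le_rfl
  refine le_trans (Finset.sum_le_sum fun j _ => ?_) (le_add_of_nonneg_left (hnn i))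
  have hup : upper ((slice i s z, i.succAbove j) : Bond (m + 1)) =
      slice i s (upper ((z, j) : Bond m)) := by
    simp only [upper, slice_add_single]
  have hgrad : grad (fun z => v (slice i s z)) (z, j) = grad v (slice i s z, i.succAbove j) := by
    simp only [grad, hup]; rfl
  by_cases h : (z, j) ∈ bondsIn (box (0 : Vertex m) k)
  · have h' : (slice i s z, i.succAbove j) ∈ bondsIn (box (0 : Vertex (m + 1)) R) := by
      rw [mem_bondsIn, hup]
      rw [mem_bondsIn] at h
      exact ⟨slice_mem_box hs hk h.1, slice_mem_box hs hk h.2⟩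
    rw [if_pos h, if_pos h', hgrad]
  · rw [if_neg h]
    exact hnn _

/-- The energy of `v` on the faces of the spheres of radius `k` and `k + 1`. -/
noncomputable def layerEnergy {d : ℕ} (t L : ℝ) (v : Vertex d → ℝ) (R k : ℕ) : ℝ :=
  ∑ i, (slab t L v R i k + slab t L v R i (k + 1) + slab t L v R i (-k) +
    slab t L v R i (-(k + 1)))

theorem layerEnergy_nonneg {d : ℕ} {t L : ℝ} (hL : 0 ≤ L) (v : Vertex d → ℝ) (R k : ℕ) :
    0 ≤ layerEnergy t L v R k := by
  refine Finset.sum_nonneg fun i _ => ?_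
  have := slab_nonneg (t := t) hL v R i
  exact add_nonneg (add_nonneg (add_nonneg (this _) (this _)) (this _)) (this _)

/-- In each direction the four hyperplanes of a layer trace out four families without repetition as
k varies. Hence the layer energies are on average of order 1/|I| times the total, which is what the
pigeonhole argument uses. -/
theorem sum_layerEnergy_le {d : ℕ} {t L : ℝ} (hL : 0 ≤ L) (v : Vertex d → ℝ) (R : ℕ)
    (I : Finset ℕ) :
    ∑ k ∈ I, layerEnergy t L v R k ≤ 4 * d * sobolevSum t L v (box 0 R) := by
  simp only [layerEnergy]
  rw [Finset.sum_comm]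
  calc _ ≤ ∑ i : Fin d, 4 * sobolevSum t L v (box 0 R) := by
        refine Finset.sum_le_sum fun i _ => ?_
        simp only [Finset.sum_add_distrib]
        have h1 := sum_slab_le (t := t) hL v R i I (s := fun k => (k : ℤ))
          (fun k l h => by simp only at h; omega)
        have h2 := sum_slab_le (t := t) hL v R i I (s := fun k => (k : ℤ) + 1)
          (fun k l h => by simp only at h; omega)
        have h3 := sum_slab_le (t := t) hL v R i I (s := fun k => -(k : ℤ))
          (fun k l h => by simp only at h; omega)
        have h4 := sum_slab_le (t := t) hL v R i I (s := fun k => -((k : ℤ) + 1))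
          (fun k l h => by simp only at h; omega)
        linarith
    _ = _ := by simp; ring

theorem slab_le_layerEnergy {d : ℕ} {t L : ℝ} (hL : 0 ≤ L) (v : Vertex d → ℝ) (R k : ℕ)
    (i : Fin d) {s : ℤ} (hs : s = k ∨ s = k + 1 ∨ s = -k ∨ s = -(k + 1)) :
    slab t L v R i s ≤ layerEnergy t L v R k := by
  have hn := fun i => slab_nonneg (t := t) hL v R i
  refine le_trans ?_ (Finset.single_le_sum (f := fun i => slab t L v R i k +
    slab t L v R i (k + 1) + slab t L v R i (-k) + slab t L v R i (-(k + 1)))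
    (fun i _ => add_nonneg (add_nonneg (add_nonneg (hn i _) (hn i _)) (hn i _)) (hn i _))
    (Finset.mem_univ i))
  have h1 := hn i k
  have h2 := hn i (k + 1)
  have h3 := hn i (-k)
  have h4 := hn i (-(k + 1))
  rcases hs with rfl | rfl | rfl | rfl <;> linarith

/-- A bond is determined by its direction, the coordinate of one end point in that direction, and
the other coordinates of that point. This injection moves a layer into finitely many hyperplane
cubes; ε selects the lower or the upper end point. -/
theorem sum_layer_le_sum_slice {m k : ℕ} (ε : Bond (m + 1) → Vertex (m + 1)) (P : Finset ℤ)
    (hinj : Function.Injective fun e => (ε e, e.2))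
    (hP : ∀ e ∈ layer (m + 1) k, ε e e.2 ∈ P)
    (hk : ∀ e ∈ layer (m + 1) k, ∀ j, j ≠ e.2 → (ε e j).natAbs ≤ k)
    {g : Vertex (m + 1) → ℝ} (hg : ∀ x, 0 ≤ g x) :
    ∑ e ∈ layer (m + 1) k, g (ε e) ≤ ∑ i, ∑ s ∈ P, ∑ z ∈ box (0 : Vertex m) k, g (slice i s z) := by
  set φ : Bond (m + 1) → Fin (m + 1) × ℤ × Vertex m := fun e =>
    (e.2, ε e e.2, fun j => ε e (e.2.succAbove j)) with hφ
  have hφinj : Function.Injective φ := by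
    intro e e' h
    refine hinj ?_
    simp only [hφ, Prod.mk.injEq] at h
    obtain ⟨h1, h2, h3⟩ := h
    have : ε e = ε e' := by
      rw [← slice_removeNth e.2 (ε e), ← slice_removeNth e'.2 (ε e'), h2, h3, h1]
    simp [this, h1]
  calc ∑ e ∈ layer (m + 1) k, g (ε e)
      = ∑ y ∈ (layer (m + 1) k).image φ, g (slice y.1 y.2.1 y.2.2) := by
        rw [Finset.sum_image hφinj.injOn]
        refine Finset.sum_congr rfl fun e _ => ?_
        simp only [hφ, slice_removeNth]
    _ ≤ ∑ y ∈ Finset.univ ×ˢ (P ×ˢ box (0 : Vertex m) k), g (slice y.1 y.2.1 y.2.2) := by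
        refine Finset.sum_le_sum_of_subset_of_nonneg ?_ fun _ _ _ => hg _
        intro y hy
        obtain ⟨e, he, rfl⟩ := Finset.mem_image.1 hy
        simp only [Finset.mem_product, Finset.mem_univ, true_and, hφ]
        refine ⟨hP e he, ?_⟩
        rw [mem_box_zero_iff_radius, radius_le_iff]
        exact fun j => hk e he _ (Fin.succAbove_ne _ _)
    _ = _ := by simp only [Finset.sum_product]

/-- Only the coordinate in the direction of the bond changes, so it must be the one that attains the
radius k + 1 at the outer end. All other coordinates stay within k, which places both end points on
faces over the cube of radius k. -/
theorem layer_coord {d k : ℕ} {e : Bond d} (he : e ∈ layer d k) :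
    ((lower e e.2 = k ∧ upper e e.2 = k + 1) ∨
      (lower e e.2 = -(k + 1) ∧ upper e e.2 = -k)) ∧
    ∀ j, j ≠ e.2 → (lower e j).natAbs ≤ k ∧ (upper e j).natAbs ≤ k := by
  have hsame : upper e e.2 = lower e e.2 + 1 := by simp [upper, lower]
  have hne : ∀ j, j ≠ e.2 → upper e j = lower e j := fun j hj => by simp [upper, lower, hj]
  have key : ∀ x : Vertex d, radius x = k + 1 → (∀ j, j ≠ e.2 → (x j).natAbs ≤ k) →
      (x e.2).natAbs = k + 1 := by
    intro x hx h
    have h1 := natAbs_le_radius x e.2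
    by_contra hc
    have : radius x ≤ k := radius_le_iff.2 fun j => by
      by_cases hj : j = e.2
      · subst hj; omega
      · exact h j hj
    omega
  rcases mem_layer.1 he with ⟨h1, h2⟩ | ⟨h1, h2⟩
  · have hj : ∀ j, j ≠ e.2 → (lower e j).natAbs ≤ k ∧ (upper e j).natAbs ≤ k := fun j hj => by
      have := natAbs_le_radius (lower e) j
      rw [hne j hj]; omega
    have h3 := key _ h2 fun j h => (hj j h).2
    have h4 := natAbs_le_radius (lower e) e.2
    exact ⟨Or.inl (by omega), hj⟩
  · have hj : ∀ j, j ≠ e.2 → (lower e j).natAbs ≤ k ∧ (upper e j).natAbs ≤ k := fun j hj => by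
      have := natAbs_le_radius (upper e) j
      rw [hne j hj] at this ⊢; omega
    have h3 := key _ h1 fun j h => (hj j h).1
    have h4 := natAbs_le_radius (upper e) e.2
    exact ⟨Or.inr (by omega), hj⟩

/-- The Sobolev inequality on the faces of a layer. -/
theorem sum_layer_le {m : ℕ} (hm : 2 ≤ m) {t T : ℝ} (ht : 1 ≤ t) (hT : 0 < T)
    (htT : 1 / T = 1 / t - 1 / m) :
    ∃ C : ℝ, 0 ≤ C ∧ ∀ (k R : ℕ) (L : ℝ), k < R → 0 < L → L ≤ 2 * k + 1 →
      ∀ v : Vertex (m + 1) → ℝ, (∀ x, 0 ≤ v x) →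
        ∑ e ∈ layer (m + 1) k, v (lower e) ^ T ≤ C * layerEnergy t L v R k ^ (T / t) ∧
        ∑ e ∈ layer (m + 1) k, v (upper e) ^ T ≤ C * layerEnergy t L v R k ^ (T / t) := by
  obtain ⟨C, hC, h⟩ := sobolev_box hm ht hT htT
  -- There are m + 1 directions, with two opposite faces in each.
  refine ⟨(m + 1) * (2 * C), by positivity, fun k R L hk hL hLk v hv => ?_⟩
  have hvT : ∀ x, 0 ≤ v x ^ T := fun x => Real.rpow_nonneg (hv x) _
  have hslice : ∀ (i : Fin (m + 1)) (s : ℤ), (s = k ∨ s = k + 1 ∨ s = -k ∨ s = -(k + 1)) →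
      ∑ z ∈ box (0 : Vertex m) k, v (slice i s z) ^ T ≤ C * layerEnergy t L v R k ^ (T / t) := by
    intro i s hs
    refine (h k L hL hLk (fun z => v (slice i s z)) fun z => hv _).trans ?_
    have h1 := sobolevSum_slice_le (t := t) hL.le v hk.le i (s := s) (by omega)
    have h2 := slab_le_layerEnergy (t := t) hL.le v R k i hs
    gcongr
    · exact sobolevSum_nonneg hL.le _ _
    · exact h1.trans h2
  have hsum : ∀ a b : ℤ, (a = k ∨ a = k + 1 ∨ a = -k ∨ a = -(k + 1)) →
      (b = k ∨ b = k + 1 ∨ b = -k ∨ b = -(k + 1)) → a ≠ b →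
      ∑ i, ∑ s ∈ {a, b}, ∑ z ∈ box (0 : Vertex m) k, v (slice i s z) ^ T ≤
        (m + 1) * (2 * C) * layerEnergy t L v R k ^ (T / t) := by
    intro a b ha hb hab
    calc _ ≤ ∑ _i : Fin (m + 1), 2 * (C * layerEnergy t L v R k ^ (T / t)) := by
          refine Finset.sum_le_sum fun i _ => ?_
          rw [Finset.sum_pair hab]
          linarith [hslice i a ha, hslice i b hb]
      _ = _ := by simp; ring
  have hinj1 : Function.Injective fun e : Bond (m + 1) => (lower e, e.2) := fun e e' h => by
    simpa [lower, Prod.ext_iff] using h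
  have hinj2 : Function.Injective fun e : Bond (m + 1) => (upper e, e.2) := by
    rintro ⟨x, i⟩ ⟨y, j⟩ h
    simp only [upper, Prod.mk.injEq] at h
    obtain ⟨h1, rfl⟩ := h
    rw [add_right_cancel h1]
  constructor
  · refine (sum_layer_le_sum_slice lower {(k : ℤ), -((k : ℤ) + 1)} hinj1 (fun e he => ?_)
      (fun e he j hj => ((layer_coord he).2 j hj).1) hvT).trans
      (hsum _ _ (by omega) (by omega) (by omega))
    rcases (layer_coord he).1 with h | h <;> simp [h.1]
  · refine (sum_layer_le_sum_slice upper {(k : ℤ) + 1, -(k : ℤ)} hinj2 (fun e he => ?_)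
      (fun e he j hj => ((layer_coord he).2 j hj).2) hvT).trans
      (hsum _ _ (by omega) (by omega) (by omega))
    rcases (layer_coord he).1 with h | h <;> simp [h.2]

/-! ### Hölder in normalized norms and the choice of good layers -/

theorem avgNorm_nonneg {ι : Type*} (p : ℝ≥0∞) (S : Finset ι) (f : ι → ℝ) : 0 ≤ avgNorm p S f := by
  unfold avgNorm
  split_ifs
  · exact Real.iSup_nonneg fun _ => abs_nonneg _
  · exact Real.rpow_nonneg (mul_nonneg (by positivity)
      (Finset.sum_nonneg fun _ _ => Real.rpow_nonneg (abs_nonneg _) _)) _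

theorem abs_le_avgNorm_top {ι : Type*} {S : Finset ι} {f : ι → ℝ} {x : ι} (hx : x ∈ S) :
    |f x| ≤ avgNorm ∞ S f := by
  rw [avgNorm, if_pos rfl]
  exact le_ciSup (f := fun x : S => |f x|) (Set.finite_range _).bddAbove ⟨x, hx⟩

theorem sum_rpow_eq_card_mul_avgNorm {ι : Type*} {p : ℝ≥0∞} (hp0 : p ≠ 0) (hp : p ≠ ∞)
    (S : Finset ι) (f : ι → ℝ) :
    ∑ x ∈ S, |f x| ^ p.toReal = S.card * avgNorm p S f ^ p.toReal := by
  have h0 : 0 < p.toReal := ENNReal.toReal_pos hp0 hp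
  have h1 : 0 ≤ ∑ x ∈ S, |f x| ^ p.toReal :=
    Finset.sum_nonneg fun _ _ => Real.rpow_nonneg (abs_nonneg _) _
  rw [avgNorm, if_neg hp, ← Real.rpow_mul (by positivity), one_div_mul_cancel h0.ne', Real.rpow_one]
  rcases S.eq_empty_or_nonempty with rfl | hS
  · simp
  · have : (S.card : ℝ) ≠ 0 := by exact_mod_cast hS.card_pos.ne'
    rw [mul_inv_cancel_left₀ this]

theorem inv_toReal_lt_one {p : ℝ≥0∞} (hp : 1 < p) : (p⁻¹).toReal < 1 := by
  rw [← ENNReal.toReal_one]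
  exact (ENNReal.toReal_lt_toReal (ENNReal.inv_ne_top.2 (by positivity)) ENNReal.one_ne_top).2
    (ENNReal.inv_lt_one.2 hp)

/-- Hölder's inequality with one factor measured in `avgNorm p`, where `p = ∞` is allowed. -/
theorem sum_mul_le_avgNorm {ι : Type*} {p : ℝ≥0∞} (hp : 1 ≤ p) {S T : Finset ι} (hT : T ⊆ S)
    {f g : ι → ℝ} (hf : ∀ x, 0 ≤ f x) (hg : ∀ x, 0 ≤ g x) {θ : ℝ} (hθ : θ = 1 - (p⁻¹).toReal) :
    ∑ x ∈ T, f x * g x ^ θ ≤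
      (S.card : ℝ) ^ (p⁻¹).toReal * avgNorm p S f * (∑ x ∈ T, g x) ^ θ := by
  rcases eq_or_ne p ∞ with rfl | hp'
  · simp only [ENNReal.inv_top, ENNReal.toReal_zero, sub_zero] at hθ
    subst hθ
    simp only [ENNReal.inv_top, ENNReal.toReal_zero, Real.rpow_zero, one_mul, Real.rpow_one,
      Finset.mul_sum]
    exact Finset.sum_le_sum fun x hx => mul_le_mul_of_nonneg_right
      ((le_abs_self _).trans (abs_le_avgNorm_top (hT hx))) (hg x)
  · have hp0 : p ≠ 0 := (zero_lt_one.trans_le hp).ne'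
    have h0 : 0 < p.toReal := ENNReal.toReal_pos hp0 hp'
    have ha : (p⁻¹).toReal = 1 / p.toReal := by rw [ENNReal.toReal_inv, one_div]
    have h1 : 1 ≤ p.toReal := by
      rw [← ENNReal.toReal_one]; exact ENNReal.toReal_mono hp' hp
    have ha1 : (p⁻¹).toReal ≤ 1 := by rw [ha, div_le_one h0]; exact h1
    have h := sum_rpow_mul_rpow_le T (A := fun x => f x ^ p.toReal) (B := g) (θ := θ)
      (by linarith) (by rw [hθ]; linarith [ENNReal.toReal_nonneg (a := p⁻¹)])
      (fun x _ => Real.rpow_nonneg (hf x) _) (fun x _ => hg x)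
    have e : 1 - θ = 1 / p.toReal := by rw [hθ, ha]; ring
    simp only [e, ← Real.rpow_mul (hf _), mul_one_div_cancel h0.ne', Real.rpow_one] at h
    refine h.trans (mul_le_mul_of_nonneg_right ?_ (Real.rpow_nonneg
      (Finset.sum_nonneg fun x _ => hg x) _))
    have h2 : ∑ x ∈ T, f x ^ p.toReal ≤ S.card * avgNorm p S f ^ p.toReal := by
      rw [← sum_rpow_eq_card_mul_avgNorm hp0 hp']
      simp only [abs_of_nonneg (hf _)]
      exact Finset.sum_le_sum_of_subset_of_nonneg hT fun x _ _ => Real.rpow_nonneg (hf x) _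
    refine (Real.rpow_le_rpow (Finset.sum_nonneg fun x _ => Real.rpow_nonneg (hf x) _) h2
      (by positivity)).trans (le_of_eq ?_)
    rw [Real.mul_rpow (by positivity) (Real.rpow_nonneg (avgNorm_nonneg _ _ _) _),
      ← Real.rpow_mul (avgNorm_nonneg _ _ _), mul_one_div_cancel h0.ne', Real.rpow_one, ha]

/-- Hölder's inequality on each member of a disjoint family, with a summable family of weights. -/
theorem exists_weight {ι : Type*} {p : ℝ≥0∞} (hp : 1 ≤ p) {S : Finset ι} {I : Finset ℕ}
    {T : ℕ → Finset ι} (hT : ∀ k ∈ I, T k ⊆ S) (hdisj : Set.PairwiseDisjoint (I : Set ℕ) T)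
    {f : ι → ℝ} (hf : ∀ x, 0 ≤ f x) {θ : ℝ} (hθ : θ = 1 - (p⁻¹).toReal) :
    ∃ W : ℕ → ℝ, (∀ k, 0 ≤ W k) ∧ ∑ k ∈ I, W k ≤ S.card ∧
      ∀ k ∈ I, ∀ g : ι → ℝ, (∀ x, 0 ≤ g x) →
        ∑ x ∈ T k, f x * g x ^ θ ≤
          W k ^ (p⁻¹).toReal * avgNorm p S f * (∑ x ∈ T k, g x) ^ θ := by
  classical
  -- For finite p this is the share of T k in the sum of |f|^p, normalized to total mass at most
  -- |S|. For p = ∞ the convention `p.toReal = 0` reduces it to |T k|, which is harmless since the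
  -- weight then enters with exponent 0.
  refine ⟨fun k => (T k).card * (avgNorm p (T k) f / avgNorm p S f) ^ p.toReal, fun k =>
    mul_nonneg (by positivity) (Real.rpow_nonneg (div_nonneg (avgNorm_nonneg _ _ _)
      (avgNorm_nonneg _ _ _)) _), ?_, ?_⟩
  · rcases eq_or_ne p ∞ with rfl | hp'
    · simp only [ENNReal.toReal_top, Real.rpow_zero, mul_one]
      rw [← Nat.cast_sum, ← Finset.card_biUnion hdisj]
      exact_mod_cast Finset.card_le_card (Finset.biUnion_subset.2 hT)
    · have hp0 : p ≠ 0 := (zero_lt_one.trans_le hp).ne'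
      simp only [Real.div_rpow (avgNorm_nonneg _ _ _) (avgNorm_nonneg _ _ _), ← mul_div_assoc,
        ← sum_rpow_eq_card_mul_avgNorm hp0 hp']
      rw [← Finset.sum_div, ← Finset.sum_biUnion hdisj]
      refine div_le_of_le_mul₀ (Real.rpow_nonneg (avgNorm_nonneg _ _ _) _) (by positivity) ?_
      rw [← sum_rpow_eq_card_mul_avgNorm hp0 hp']
      exact Finset.sum_le_sum_of_subset_of_nonneg (Finset.biUnion_subset.2 hT)
        fun _ _ _ => Real.rpow_nonneg (abs_nonneg _) _
  · intro k hk g hg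
    rcases eq_or_ne p ∞ with rfl | hp'
    · have h := sum_mul_le_avgNorm hp (hT k hk) hf hg hθ
      simpa using h
    · have hp0 : p ≠ 0 := (zero_lt_one.trans_le hp).ne'
      have h0 : 0 < p.toReal := ENNReal.toReal_pos hp0 hp'
      have h := sum_mul_le_avgNorm hp (Finset.Subset.refl (T k)) hf hg hθ
      refine h.trans (mul_le_mul_of_nonneg_right ?_ (Real.rpow_nonneg
        (Finset.sum_nonneg fun x _ => hg x) _))
      have ha : (p⁻¹).toReal = 1 / p.toReal := by rw [ENNReal.toReal_inv, one_div]
      have hnn : 0 ≤ avgNorm p (T k) f / avgNorm p S f :=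
        div_nonneg (avgNorm_nonneg _ _ _) (avgNorm_nonneg _ _ _)
      rw [Real.mul_rpow (by positivity) (Real.rpow_nonneg hnn _), ← Real.rpow_mul hnn, ha,
        mul_one_div_cancel h0.ne', Real.rpow_one, mul_assoc]
      refine mul_le_mul_of_nonneg_left ?_ (by positivity)
      -- If the norm on S is zero the quotient is the default value 0, but then f vanishes on T k as
      -- well.
      rcases eq_or_ne (avgNorm p S f) 0 with hz | hz
      · have h1 := sum_rpow_eq_card_mul_avgNorm hp0 hp' S f
        rw [hz, Real.zero_rpow h0.ne', mul_zero] at h1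
        have h2 : ∑ x ∈ T k, |f x| ^ p.toReal = 0 := le_antisymm
          (h1 ▸ Finset.sum_le_sum_of_subset_of_nonneg (hT k hk)
            fun _ _ _ => Real.rpow_nonneg (abs_nonneg _) _)
          (Finset.sum_nonneg fun _ _ => Real.rpow_nonneg (abs_nonneg _) _)
        rw [hz, mul_zero, avgNorm, if_neg hp', h2, mul_zero, Real.zero_rpow (by positivity)]
      · rw [div_mul_cancel₀ _ hz]

/-- Markov's inequality at four times the average. -/
theorem card_filter_large_le {I : Finset ℕ} {X : ℕ → ℝ} (hX : ∀ k, 0 ≤ X k) {A : ℝ}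
    (h : ∑ k ∈ I, X k ≤ A) :
    ((I.filter fun k => 4 * A / I.card < X k).card : ℝ) ≤ I.card / 4 := by
  set J := I.filter fun k => 4 * A / I.card < X k with hJ
  rcases I.eq_empty_or_nonempty with rfl | hI
  · simp [hJ]
  have hc : (0 : ℝ) < I.card := by exact_mod_cast hI.card_pos
  have hsum : ∑ k ∈ J, X k ≤ A :=
    (Finset.sum_le_sum_of_subset_of_nonneg (Finset.filter_subset _ _) fun k _ _ => hX k).trans h
  rcases J.eq_empty_or_nonempty with h0 | hJ0
  · rw [h0, Finset.card_empty, Nat.cast_zero]; positivity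
  have hlt : ∑ k ∈ J, 4 * A / I.card < ∑ k ∈ J, X k :=
    Finset.sum_lt_sum_of_nonempty hJ0 fun k hk => (Finset.mem_filter.1 hk).2
  rw [Finset.sum_const, nsmul_eq_mul] at hlt
  have h1 : (J.card : ℝ) * (4 * A / I.card) < A := hlt.trans_le hsum
  have hA : 0 < A := by
    have : 0 ≤ A := (Finset.sum_nonneg fun k _ => hX k).trans hsum
    rcases this.eq_or_lt with rfl | h
    · simp at h1
    · exact h
  rw [← mul_div_assoc, div_lt_iff₀ hc] at h1
  nlinarith

/-- A large subset of `I` on which two families of nonnegative numbers are at most a constant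
times their averages. -/
theorem exists_good_subset {I : Finset ℕ} {X Y : ℕ → ℝ} (hX : ∀ k, 0 ≤ X k) (hY : ∀ k, 0 ≤ Y k)
    {A B : ℝ} (hA : ∑ k ∈ I, X k ≤ A) (hB : ∑ k ∈ I, Y k ≤ B) :
    ∃ G ⊆ I, (I.card : ℝ) / 2 ≤ G.card ∧
      ∀ k ∈ G, X k ≤ 4 * A / I.card ∧ Y k ≤ 4 * B / I.card := by
  refine ⟨I.filter fun k => X k ≤ 4 * A / I.card ∧ Y k ≤ 4 * B / I.card, Finset.filter_subset _ _,
    ?_, fun k hk => (Finset.mem_filter.1 hk).2⟩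
  have h1 := card_filter_large_le hX hA
  have h2 := card_filter_large_le hY hB
  -- Each of the two exceptional sets takes at most a quarter of I.
  have h3 : I ⊆ (I.filter fun k => X k ≤ 4 * A / I.card ∧ Y k ≤ 4 * B / I.card) ∪
      ((I.filter fun k => 4 * A / I.card < X k) ∪ I.filter fun k => 4 * B / I.card < Y k) := by
    intro k hk
    simp only [Finset.mem_union, Finset.mem_filter, hk, true_and]
    rcases le_or_gt (X k) (4 * A / I.card) with h | h <;>
      rcases le_or_gt (Y k) (4 * B / I.card) with h' | h' <;> tauto
  have h4 := (Nat.cast_le (α := ℝ)).2 ((Finset.card_le_card h3).trans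
    ((Finset.card_union_le _ _).trans (Nat.add_le_add_left (Finset.card_union_le _ _) _)))
  push_cast at h4
  linarith

/-! ### Volume counts and the Caccioppoli inequality with optimised cutoff -/

theorem card_bondsIn_box_le (d n : ℕ) (hn : 1 ≤ n) :
    ((bondsIn (box (0 : Vertex d) (4 * n))).card : ℝ) ≤ d * 9 ^ d * (n : ℝ) ^ d ∧
    ((box (0 : Vertex d) (4 * n)).card : ℝ) ≤ 9 ^ d * (n : ℝ) ^ d := by
  have h2 : (box (0 : Vertex d) (4 * n)).card ≤ 9 ^ d * n ^ d := by
    have : (box (0 : Vertex d) (4 * n)).card = (8 * n + 1) ^ d := by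
      simp only [box, Fintype.card_piFinset, Pi.zero_apply, Int.card_Icc, Finset.prod_const,
        Finset.card_univ, Fintype.card_fin]
      congr 1; omega
    -- 8n + 1 ≤ 9n for n ≥ 1; this is the origin of the factors 9^d.
    rw [this, ← mul_pow]
    exact Nat.pow_le_pow_left (by omega) _
  have h1 : (bondsIn (box (0 : Vertex d) (4 * n))).card ≤ 9 ^ d * n ^ d * d := by
    refine (Finset.card_filter_le _ _).trans ?_
    rw [Finset.card_product, Finset.card_univ, Fintype.card_fin]
    exact Nat.mul_le_mul_right _ h2
  constructor
  · calc ((bondsIn (box (0 : Vertex d) (4 * n))).card : ℝ) ≤ ((9 ^ d * n ^ d * d : ℕ) : ℝ) := by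
          exact_mod_cast h1
      _ = _ := by push_cast; ring
  · exact_mod_cast h2

theorem layer_disjoint {d : ℕ} (I : Set ℕ) : I.PairwiseDisjoint (layer d) := by
  intro k _ l _ hkl
  refine Finset.disjoint_left.2 fun e hk hl => hkl ?_
  rw [mem_layer] at hk hl
  omega

/-- Caccioppoli's inequality with an optimised cutoff: the energy of a power of a harmonic function
is controlled by a weaker Sobolev energy on a larger box. -/
theorem energy_le_sobolevSum {m : ℕ} (hm : 2 ≤ m) {p : ℝ≥0∞} (hp : 1 < p) {t : ℝ} (ht : 1 ≤ t)
    (htp : 1 / t = (1 - (p⁻¹).toReal) / 2 + 1 / m) :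
    ∃ C : ℝ, 0 ≤ C ∧ ∀ ω : Bond (m + 1) → ℝ, (∀ e, 0 < ω e) → ∀ u : Vertex (m + 1) → ℝ,
      (∀ x, dvg (fun e => ω e * grad u e) x = 0) → ∀ α : ℝ, 1 ≤ α → ∀ n ρ σ : ℕ, 1 ≤ n → n ≤ ρ →
        ρ < σ → σ ≤ 4 * n →
          ∑ e ∈ bondsIn (box (0 : Vertex (m + 1)) ρ), ω e * grad (fun x => |u x| ^ α) e ^ 2 ≤
            C * α * avgNorm p (bondsIn (box 0 (4 * n))) ω *
              ((n : ℝ) ^ (m + 1) / (σ - ρ)) ^ (p⁻¹).toReal * (1 / (σ - ρ)) *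
              (sobolevSum t n (fun x => |u x| ^ α) (box 0 σ) / (σ - ρ)) ^ (2 / t) := by
  set a := (p⁻¹).toReal with ha
  have ha0 : 0 ≤ a := ENNReal.toReal_nonneg
  have ha1 : a < 1 := inv_toReal_lt_one hp
  -- T = 2p' is the exponent left for v when ω is measured in L^p, and t is the exponent that the
  -- Sobolev inequality of dimension m improves to T.
  set T := 2 / (1 - a) with hTdef
  have hT : 0 < T := div_pos two_pos (by linarith)
  have ht0 : 0 < t := by linarith
  obtain ⟨C₁, hC₁, hlayer⟩ := sum_layer_le hm ht hT (by rw [hTdef, htp]; field_simp; ring)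
  set D : ℝ := ((m + 1 : ℕ) : ℝ) with hD
  -- On a good layer the weight is at most 4 D 9^(m+1) n^(m+1)/N and the layer energy at most 4 · 4D
  -- E/N, with N = σ - ρ. The 24 is 6 from Caccioppoli, 2 from |G| ≥ N/2, and 2 for the two end
  -- points.
  refine ⟨24 * (4 * (D * 9 ^ (m + 1))) ^ a * C₁ ^ (1 - a) * (16 * D) ^ (2 / t), by positivity,
    fun ω hω u hu α hα n ρ σ hn hnρ hρσ hσ => ?_⟩
  set v : Vertex (m + 1) → ℝ := fun x => |u x| ^ α with hv
  have hv0 : ∀ x, 0 ≤ v x := fun x => Real.rpow_nonneg (abs_nonneg _) _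
  set S := bondsIn (box (0 : Vertex (m + 1)) (4 * n))
  set I := Finset.Ico ρ σ with hI
  set N : ℝ := (σ : ℝ) - ρ with hN
  have hN0 : 0 < N := by rw [hN, sub_pos]; exact_mod_cast hρσ
  have hIc : (I.card : ℝ) = N := by
    rw [hI, Nat.card_Ico, Nat.cast_sub hρσ.le]
  have hn0 : (0 : ℝ) < n := by exact_mod_cast hn
  set E := sobolevSum t (n : ℝ) v (box 0 σ) with hE
  have hE0 : 0 ≤ E := sobolevSum_nonneg hn0.le _ _
  set ω' := avgNorm p S ω
  have hω' : 0 ≤ ω' := avgNorm_nonneg _ _ _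
  obtain ⟨W, hW0, hWsum, hW⟩ := exists_weight hp.le (I := I) (T := layer (m + 1)) (S := S)
    (fun k hk => layer_subset ((Finset.mem_Ico.1 hk).2.trans_le hσ)) (layer_disjoint _)
    (fun e => (hω e).le) rfl
  obtain ⟨G, hGI, hGc, hG⟩ := exists_good_subset hW0
    (fun k => layerEnergy_nonneg (t := t) hn0.le v σ k) hWsum
    (sum_layerEnergy_le (t := t) hn0.le v σ I)
  rw [hIc] at hGc hG
  have hGc0 : (0 : ℝ) < G.card := by linarith
  have hGne : G.Nonempty := Finset.card_pos.1 (by exact_mod_cast hGc0)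
  have hcard := (card_bondsIn_box_le (m + 1) n hn).1
  set Q : ℝ := (4 * (D * 9 ^ (m + 1))) ^ a * ((n : ℝ) ^ (m + 1) / N) ^ a * ω' *
    (C₁ ^ (1 - a) * ((16 * D) ^ (2 / t) * (E / N) ^ (2 / t))) with hQ
  have hTθ : T / t * (1 - a) = 2 / t := by
    rw [hTdef]; field_simp [show 1 - a ≠ 0 by linarith]
  have hsq : ∀ x, (v x ^ T) ^ (1 - a) = v x ^ 2 := fun x => by
    rw [← Real.rpow_mul (hv0 x), hTdef, div_mul_cancel₀ _ (by linarith), Real.rpow_two]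
  have hside : ∀ k ∈ G, ∀ ε : Bond (m + 1) → Vertex (m + 1),
      ∑ e ∈ layer (m + 1) k, v (ε e) ^ T ≤ C₁ * layerEnergy t n v σ k ^ (T / t) →
      ∑ e ∈ layer (m + 1) k, ω e * v (ε e) ^ 2 ≤ Q := by
    intro k hk ε h
    have h1 := hW k (hGI hk) (fun e => v (ε e) ^ T) fun e => Real.rpow_nonneg (hv0 _) _
    simp only [← ha, hsq] at h1
    refine h1.trans ?_
    have hLE := layerEnergy_nonneg (t := t) hn0.le v σ k
    have h2 : W k ^ a ≤ (4 * (D * 9 ^ (m + 1))) ^ a * ((n : ℝ) ^ (m + 1) / N) ^ a := by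
      rw [← Real.mul_rpow (by positivity) (by positivity)]
      refine Real.rpow_le_rpow (hW0 k) ((hG k hk).1.trans ?_) ha0
      rw [← mul_div_assoc]
      refine div_le_div_of_nonneg_right ?_ hN0.le
      rw [mul_assoc]
      exact mul_le_mul_of_nonneg_left hcard (by norm_num)
    have h3 : (∑ e ∈ layer (m + 1) k, v (ε e) ^ T) ^ (1 - a) ≤
        C₁ ^ (1 - a) * ((16 * D) ^ (2 / t) * (E / N) ^ (2 / t)) := by
      refine (Real.rpow_le_rpow (Finset.sum_nonneg fun e _ => Real.rpow_nonneg (hv0 _) _) h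
        (by linarith)).trans ?_
      rw [Real.mul_rpow hC₁ (Real.rpow_nonneg hLE _), ← Real.rpow_mul hLE, hTθ,
        ← Real.mul_rpow (by positivity) (by positivity)]
      refine mul_le_mul_of_nonneg_left (Real.rpow_le_rpow hLE ((hG k hk).2.trans (le_of_eq ?_))
        (by positivity)) (by positivity)
      ring
    rw [hQ]
    refine mul_le_mul (mul_le_mul_of_nonneg_right h2 hω') h3 ?_ (by positivity)
    exact Real.rpow_nonneg (Finset.sum_nonneg fun e _ => Real.rpow_nonneg (hv0 _) _) _
  have hQ0 : 0 ≤ Q := by positivity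
  have hk2 : ∀ k ∈ G, ∑ e ∈ layer (m + 1) k, ω e * (v (lower e) ^ 2 + v (upper e) ^ 2) ≤ 2 * Q := by
    intro k hk
    have hk' := Finset.mem_Ico.1 (hGI hk)
    -- The length scale n is admissible on every layer since k ≥ ρ ≥ n.
    obtain ⟨h1, h2⟩ := hlayer k σ n hk'.2 hn0 (by
      have : (n : ℝ) ≤ k := by exact_mod_cast hnρ.trans hk'.1
      linarith) v hv0
    have h3 := hside k hk lower h1
    have h4 := hside k hk upper h2
    simp only [mul_add, Finset.sum_add_distrib]
    linarith
  refine (caccioppoli_layers hω hu hα hρσ.le hGI hGne).trans ?_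
  have hsum : ∑ k ∈ G, ∑ e ∈ layer (m + 1) k, ω e * (v (lower e) ^ 2 + v (upper e) ^ 2) ≤
      G.card * (2 * Q) := by
    refine (Finset.sum_le_sum hk2).trans (le_of_eq ?_)
    rw [Finset.sum_const, nsmul_eq_mul]
  calc _ ≤ 6 * α * ((G.card : ℝ)⁻¹ ^ 2 * (G.card * (2 * Q))) := by
        have hα0 : 0 ≤ α := by linarith
        gcongr
    _ = 6 * α * ((G.card : ℝ)⁻¹ * (2 * Q)) := by field_simp
    _ ≤ 6 * α * ((N / 2)⁻¹ * (2 * Q)) := by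
        have hα0 : 0 ≤ α := by linarith
        gcongr
    _ = _ := by rw [hQ, inv_div]; ring

/-! ### Norms scaled by n -/

/-- Scaled norm of the gradient of `v` on a box of radius comparable to `n`. -/
noncomputable def gradNorm {d : ℕ} (t : ℝ) (n : ℕ) (v : Vertex d → ℝ) (R : ℕ) : ℝ :=
  n * (((n : ℝ) ^ d)⁻¹ * ∑ e ∈ bondsIn (box 0 R), |grad v e| ^ t) ^ (1 / t)

/-- Scaled norm of `v` on a box of radius comparable to `n`. -/
noncomputable def boxNorm {d : ℕ} (t : ℝ) (n : ℕ) (v : Vertex d → ℝ) (R : ℕ) : ℝ :=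
  (((n : ℝ) ^ d)⁻¹ * ∑ x ∈ box 0 R, |v x| ^ t) ^ (1 / t)

/-- Scaled first order Sobolev norm of `v` on a box of radius comparable to `n`. -/
noncomputable def sobolevNorm {d : ℕ} (t : ℝ) (n : ℕ) (v : Vertex d → ℝ) (R : ℕ) : ℝ :=
  n * (((n : ℝ) ^ d)⁻¹ * sobolevSum t n v (box 0 R)) ^ (1 / t)

section
variable {d : ℕ} {t : ℝ} {n : ℕ} (v : Vertex d → ℝ)

theorem sum_abs_rpow_nonneg {ι : Type*} (S : Finset ι) (f : ι → ℝ) (t : ℝ) :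
    0 ≤ ∑ x ∈ S, |f x| ^ t :=
  Finset.sum_nonneg fun _ _ => Real.rpow_nonneg (abs_nonneg _) _

theorem gradNorm_nonneg (R : ℕ) : 0 ≤ gradNorm t n v R :=
  mul_nonneg (by positivity) (Real.rpow_nonneg (mul_nonneg (by positivity)
    (sum_abs_rpow_nonneg _ _ _)) _)

theorem sobolevNorm_nonneg (R : ℕ) : 0 ≤ sobolevNorm t n v R :=
  mul_nonneg (by positivity) (Real.rpow_nonneg (mul_nonneg (by positivity)
    (sobolevSum_nonneg (by positivity) _ _)) _)

theorem natCast_mul_rpow_neg (hn : 1 ≤ n) (ht : 0 < t) {x : ℝ} (hx : 0 ≤ x) :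
    (n : ℝ) * ((n : ℝ) ^ (-t) * x) ^ (1 / t) = x ^ (1 / t) := by
  have hn0 : (0 : ℝ) < n := by exact_mod_cast hn
  rw [Real.mul_rpow (by positivity) hx, ← Real.rpow_mul hn0.le, ← mul_assoc]
  have : -t * (1 / t) = -1 := by field_simp
  rw [this, Real.rpow_neg_one, mul_inv_cancel₀ hn0.ne', one_mul]

theorem sobolevNorm_le (hn : 1 ≤ n) (ht : 1 ≤ t) (R : ℕ) :
    sobolevNorm t n v R ≤ gradNorm t n v R + boxNorm t n v R := by
  have h1 := sum_abs_rpow_nonneg (bondsIn (box 0 R)) (grad v) t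
  have h2 := sum_abs_rpow_nonneg (box 0 R) v t
  have ht0 : 0 < t := by linarith
  rw [sobolevNorm, gradNorm, boxNorm, sobolevSum, mul_add]
  calc _ ≤ (n : ℝ) * ((((n : ℝ) ^ d)⁻¹ * ∑ e ∈ bondsIn (box 0 R), |grad v e| ^ t) ^ (1 / t) +
        (((n : ℝ) ^ d)⁻¹ * ((n : ℝ) ^ (-t) * ∑ x ∈ box 0 R, |v x| ^ t)) ^ (1 / t)) := by
        gcongr
        exact Real.rpow_add_le_add_rpow (by positivity) (by positivity) (by positivity)
          (by rw [div_le_one ht0]; exact ht)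
    _ = _ := by
        rw [mul_add, mul_left_comm _ ((n : ℝ) ^ (-t)), natCast_mul_rpow_neg hn ht0 (by positivity)]

theorem boxNorm_le_sobolevNorm (hn : 1 ≤ n) (ht : 0 < t) (R : ℕ) :
    boxNorm t n v R ≤ sobolevNorm t n v R := by
  have h1 := sum_abs_rpow_nonneg (bondsIn (box 0 R)) (grad v) t
  have h2 := sum_abs_rpow_nonneg (box 0 R) v t
  rw [sobolevNorm, boxNorm, sobolevSum,
    ← natCast_mul_rpow_neg hn ht (x := ((n : ℝ) ^ d)⁻¹ * _) (by positivity),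
    mul_left_comm ((n : ℝ) ^ (-t))]
  gcongr
  linarith

theorem sobolevNorm_mono (ht : 0 < t) {R R' : ℕ} (h : R ≤ R') :
    sobolevNorm t n v R ≤ sobolevNorm t n v R' := by
  have : sobolevSum t n v (box 0 R) ≤ sobolevSum t n v (box 0 R') := by
    rw [sobolevSum, sobolevSum]
    refine add_le_add (Finset.sum_le_sum_of_subset_of_nonneg (bondsIn_mono (box_mono h))
      fun _ _ _ => Real.rpow_nonneg (abs_nonneg _) _)
      (mul_le_mul_of_nonneg_left (Finset.sum_le_sum_of_subset_of_nonneg (box_mono h)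
      fun _ _ _ => Real.rpow_nonneg (abs_nonneg _) _) (by positivity))
  have h0 := sobolevSum_nonneg (t := t) (L := n) (by positivity) v (box 0 R)
  rw [sobolevNorm, sobolevNorm]
  exact mul_le_mul_of_nonneg_left (Real.rpow_le_rpow (mul_nonneg (by positivity) h0)
    (mul_le_mul_of_nonneg_left this (by positivity)) (by positivity)) (by positivity)

/-- Converts the unscaled sums of the Sobolev and Caccioppoli estimates into scaled norms, with all
powers of n collected in one factor. -/
theorem sobolevSum_rpow (hn : 1 ≤ n) (R : ℕ) (s : ℝ) :
    sobolevSum t n v (box 0 R) ^ (s / t) =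
      sobolevNorm t n v R ^ s * (n : ℝ) ^ (d * (s / t) - s) := by
  have hn0 : (0 : ℝ) < n := by exact_mod_cast hn
  have h0 := sobolevSum_nonneg (t := t) (L := n) (by positivity) v (box 0 R)
  rw [sobolevNorm, Real.mul_rpow hn0.le (by positivity), ← Real.rpow_mul (by positivity),
    Real.mul_rpow (by positivity) h0, Real.inv_rpow (by positivity), ← Real.rpow_natCast,
    ← Real.rpow_mul hn0.le, ← Real.rpow_neg hn0.le, one_div_mul_eq_div]
  have : (n : ℝ) ^ s * (n : ℝ) ^ (-((d : ℝ) * (s / t))) * (n : ℝ) ^ ((d : ℝ) * (s / t) - s) = 1 := by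
    rw [← Real.rpow_add hn0, ← Real.rpow_add hn0]
    ring_nf
    exact Real.rpow_zero _
  calc _ = 1 * sobolevSum t n v (box 0 R) ^ (s / t) := (one_mul _).symm
    _ = _ := by rw [← this]; ring

end

/-! ### From the weighted energy to the gradient in L^r -/

theorem sum_sq_le {ι : Type*} (S : Finset ι) {f g h : ι → ℝ} (hf : ∀ x, 0 ≤ f x)
    (hg : ∀ x, 0 ≤ g x) (hh : ∀ x, h x ^ 2 = f x * g x) :
    (∑ x ∈ S, h x) ^ 2 ≤ (∑ x ∈ S, f x) * ∑ x ∈ S, g x :=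
  Finset.sum_sq_le_sum_mul_sum_of_sq_le_mul S (fun x _ => hf x) (fun x _ => hg x) fun x _ => (hh x).le

/-- Hölder's inequality: the gradient norm is controlled by the energy with weight `ω`. -/
theorem gradNorm_sq_le (d : ℕ) {q : ℝ≥0∞} (hq : 1 < q) {r : ℝ}
    (hr : 1 / r = (1 + (q⁻¹).toReal) / 2) :
    ∃ C : ℝ, 0 ≤ C ∧ ∀ ω : Bond d → ℝ, (∀ e, 0 < ω e) → ∀ n R : ℕ, 1 ≤ n → R ≤ 4 * n →
      ∀ v : Vertex d → ℝ, gradNorm r n v R ^ 2 ≤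
        C * avgNorm q (bondsIn (box 0 (4 * n))) (fun e => (ω e)⁻¹) * ((n : ℝ) ^ 2 *
          (((n : ℝ) ^ d)⁻¹ * ∑ e ∈ bondsIn (box (0 : Vertex d) R), ω e * grad v e ^ 2)) := by
  set b := (q⁻¹).toReal with hb
  have hb0 : 0 ≤ b := ENNReal.toReal_nonneg
  have hb1 : b < 1 := inv_toReal_lt_one hq
  have hr0 : 0 < r := by
    have : 0 < 1 / r := by rw [hr]; linarith
    exact one_div_pos.1 this
  have hrb : r * (1 + b) = 2 := by
    have : r * (1 / r) = 1 := mul_one_div_cancel hr0.ne'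
    rw [hr] at this; linarith
  have h2r : 2 / r = 1 + b := by rw [div_eq_iff hr0.ne']; linarith
  refine ⟨(d * 9 ^ d) ^ b, by positivity, fun ω hω n R hn hR v => ?_⟩
  have hn0 : (0 : ℝ) < n := by exact_mod_cast hn
  set S := bondsIn (box (0 : Vertex d) (4 * n))
  set T := bondsIn (box (0 : Vertex d) R)
  have hTS : T ⊆ S := bondsIn_mono (box_mono hR)
  set X := ∑ e ∈ T, |grad v e| ^ r with hX
  set A := avgNorm q S fun e => (ω e)⁻¹
  have hA : 0 ≤ A := avgNorm_nonneg _ _ _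
  set En := ∑ e ∈ T, ω e * grad v e ^ 2 with hEn
  have hEn0 : 0 ≤ En := Finset.sum_nonneg fun e _ => mul_nonneg (hω e).le (sq_nonneg _)
  have hX0 : 0 ≤ X := sum_abs_rpow_nonneg _ _ _
  have hM := (card_bondsIn_box_le d n hn).1
  have h1 := sum_mul_le_avgNorm hq.le hTS (f := fun e => (ω e)⁻¹) (g := fun e => |grad v e| ^ r)
    (fun e => (inv_pos.2 (hω e)).le) (fun e => Real.rpow_nonneg (abs_nonneg _) _) rfl
  rw [← hb] at h1
  -- Cauchy-Schwarz for |∇v|^r = (√ω |∇v|)(|∇v|^(r-1)/√ω). Since r(1+b) = 2, the square of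
  -- |∇v|^(r-1) is (|∇v|^r)^(1-b), to which Hölder with ω⁻¹ in L^q applies.
  have h2 := sum_sq_le T (f := fun e => ω e * grad v e ^ 2)
    (g := fun e => (ω e)⁻¹ * (|grad v e| ^ r) ^ (1 - b)) (h := fun e => |grad v e| ^ r)
    (fun e => mul_nonneg (hω e).le (sq_nonneg _))
    (fun e => mul_nonneg (inv_pos.2 (hω e)).le (Real.rpow_nonneg (Real.rpow_nonneg
      (abs_nonneg _) _) _))
    (fun e => by
      have hωe := (hω e).ne'
      rw [← sq_abs (grad v e), ← Real.rpow_mul (abs_nonneg _)]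
      have e1 : (|grad v e| ^ r) ^ 2 = |grad v e| ^ 2 * |grad v e| ^ (r * (1 - b)) := by
        rw [← Real.rpow_natCast, ← Real.rpow_mul (abs_nonneg _), ← Real.rpow_natCast,
          ← Real.rpow_add_of_nonneg (abs_nonneg _) (by norm_num)
            (mul_nonneg hr0.le (by linarith))]
        congr 1; push_cast; linarith
      rw [e1]; field_simp)
  -- The factor X^(1-b) on the right is absorbed, leaving X^(1+b) = X^(2/r).
  have h3 : X ^ (2 / r) ≤ (S.card : ℝ) ^ b * A * En := by
    rcases hX0.eq_or_lt with hz | hpos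
    · rw [← hz, Real.zero_rpow (by positivity)]; positivity
    have h4 : X ^ 2 ≤ En * ((S.card : ℝ) ^ b * A * X ^ (1 - b)) :=
      h2.trans (mul_le_mul_of_nonneg_left h1 hEn0)
    have e2 : X ^ 2 = X ^ (2 / r) * X ^ (1 - b) := by
      rw [← Real.rpow_add hpos, h2r, ← Real.rpow_two]; ring_nf
    rw [e2] at h4
    refine le_of_mul_le_mul_right (h4.trans (le_of_eq ?_)) (Real.rpow_pos_of_pos hpos (1 - b))
    ring
  have h5 : (S.card : ℝ) ^ b ≤ (d * 9 ^ d) ^ b * ((n : ℝ) ^ d) ^ b := by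
    rw [← Real.mul_rpow (by positivity) (by positivity)]
    exact Real.rpow_le_rpow (by positivity) hM hb0
  have h6 : gradNorm r n v R ^ 2 = (n : ℝ) ^ 2 * ((((n : ℝ) ^ d)⁻¹) ^ (1 + b) * X ^ (2 / r)) := by
    rw [gradNorm, mul_pow, ← Real.rpow_two ((_ : ℝ) ^ (1 / r)), ← Real.rpow_mul (by positivity),
      Real.mul_rpow (by positivity) hX0, one_div_mul_eq_div, h2r]
  have h7 : (((n : ℝ) ^ d)⁻¹) ^ (1 + b) * ((n : ℝ) ^ d) ^ b = ((n : ℝ) ^ d)⁻¹ := by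
    have : (0 : ℝ) < (n : ℝ) ^ d := by positivity
    rw [Real.inv_rpow this.le, Real.rpow_add this, Real.rpow_one]
    have := (Real.rpow_pos_of_pos this b).ne'
    field_simp
  calc gradNorm r n v R ^ 2
      ≤ (n : ℝ) ^ 2 * ((((n : ℝ) ^ d)⁻¹) ^ (1 + b) *
        ((d * 9 ^ d) ^ b * ((n : ℝ) ^ d) ^ b * A * En)) := by
        rw [h6]
        gcongr
        exact h3.trans (by gcongr)
    _ = (d * 9 ^ d) ^ b * A * ((n : ℝ) ^ 2 * (((((n : ℝ) ^ d)⁻¹) ^ (1 + b) * ((n : ℝ) ^ d) ^ b) *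
          En)) := by ring
    _ = _ := by rw [h7]

/-- Cauchy-Schwarz gives |S|² ≤ (∑ω)(∑ω⁻¹), and averages are at most normalized L^p and L^q norms.
The bound lets lower order terms be absorbed into powers of Λ. -/
theorem one_le_ellipticity {d : ℕ} (hd : 1 ≤ d) {p q : ℝ≥0∞} (hp : 1 ≤ p) (hq : 1 ≤ q)
    {ω : Bond d → ℝ} (hω : ∀ e, 0 < ω e) {R : ℕ} (hR : 1 ≤ R) :
    1 ≤ ellipticity p q ω (box 0 R) := by
  set S := bondsIn (box (0 : Vertex d) R) with hS
  have hne : 0 < S.card := by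
    refine Finset.card_pos.2 ⟨(0, ⟨0, hd⟩), ?_⟩
    rw [hS, mem_bondsIn, mem_box_zero, mem_box_zero]
    refine ⟨fun i => by simp [lower], fun i => ?_⟩
    simp only [upper, Pi.add_apply, Pi.single_apply, Pi.zero_apply]
    split_ifs <;> omega
  have hM : (0 : ℝ) < S.card := by exact_mod_cast hne
  have haux : ∀ {p : ℝ≥0∞}, 1 ≤ p → ∀ {f : Bond d → ℝ}, (∀ e, 0 < f e) →
      ∑ e ∈ S, f e ≤ S.card * avgNorm p S f := by
    intro p hp f hf
    have h := sum_mul_le_avgNorm hp (Finset.Subset.refl S) (g := fun _ => (1 : ℝ))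
      (fun e => (hf e).le) (fun _ => zero_le_one) rfl
    simp only [Real.one_rpow, mul_one, Finset.sum_const, nsmul_eq_mul] at h
    refine h.trans (le_of_eq ?_)
    rw [mul_right_comm, ← Real.rpow_add hM, add_sub_cancel, Real.rpow_one]
  have h1 := haux hp hω
  have h2 := haux hq (f := fun e => (ω e)⁻¹) fun e => inv_pos.2 (hω e)
  have h3 := sum_sq_le S (f := ω) (g := fun e => (ω e)⁻¹) (h := fun _ => (1 : ℝ))
    (fun e => (hω e).le) (fun e => (inv_pos.2 (hω e)).le)
    (fun e => by rw [mul_inv_cancel₀ (hω e).ne', one_pow])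
  have h4 := mul_le_mul h1 h2 (Finset.sum_nonneg fun e _ => (inv_pos.2 (hω e)).le)
    (mul_nonneg hM.le (avgNorm_nonneg _ _ _))
  simp only [Finset.sum_const, nsmul_eq_mul, mul_one] at h3
  have h5 := h3.trans h4
  have e : (S.card : ℝ) * avgNorm p S ω * (S.card * avgNorm q S fun e => (ω e)⁻¹) =
      (S.card : ℝ) ^ 2 * ellipticity p q ω (box 0 R) := by rw [ellipticity]; ring
  rw [e] at h5
  exact le_of_mul_le_mul_left (by linarith) (by positivity : (0 : ℝ) < (S.card : ℝ) ^ 2)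

/-! ### Passing from w to w^(1+δ) -/

theorem add_rpow_le_two_rpow {x y t : ℝ} (hx : 0 ≤ x) (hy : 0 ≤ y) (ht : 0 ≤ t) :
    (x + y) ^ t ≤ 2 ^ t * (x ^ t + y ^ t) := by
  have h1 := Real.rpow_nonneg hx t
  have h2 := Real.rpow_nonneg hy t
  rcases le_total x y with h | h
  · calc (x + y) ^ t ≤ (2 * y) ^ t := Real.rpow_le_rpow (by linarith) (by linarith) ht
      _ = 2 ^ t * y ^ t := Real.mul_rpow two_pos.le hy
      _ ≤ _ := by gcongr; linarith
  · calc (x + y) ^ t ≤ (2 * x) ^ t := Real.rpow_le_rpow (by linarith) (by linarith) ht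
      _ = 2 ^ t * x ^ t := Real.mul_rpow two_pos.le hx
      _ ≤ _ := by gcongr; linarith

/-- Averages over boxes of radius at most `4 * n`: a power mean inequality. -/
theorem sum_box_le (d : ℕ) {θ : ℝ} (hθ0 : 0 ≤ θ) (hθ1 : θ ≤ 1) {n R : ℕ} (hn : 1 ≤ n)
    (hR : R ≤ 4 * n) {g : Vertex d → ℝ} (hg : ∀ x, 0 ≤ g x) :
    ((n : ℝ) ^ d)⁻¹ * ∑ x ∈ box 0 R, g x ^ θ ≤
      9 ^ d * (((n : ℝ) ^ d)⁻¹ * ∑ x ∈ box 0 R, g x) ^ θ := by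
  have hn0 : (0 : ℝ) < n := by exact_mod_cast hn
  have h := sum_rpow_mul_rpow_le (box (0 : Vertex d) R) (A := fun _ => 1) (B := g) hθ0 hθ1
    (fun _ _ => zero_le_one) (fun x _ => hg x)
  simp only [Real.one_rpow, one_mul, Finset.sum_const, nsmul_eq_mul, mul_one] at h
  have hc : ((box (0 : Vertex d) R).card : ℝ) ≤ 9 ^ d * (n : ℝ) ^ d :=
    le_trans (by exact_mod_cast Finset.card_le_card (box_mono hR)) (card_bondsIn_box_le d n hn).2
  have hs : 0 ≤ ∑ x ∈ box (0 : Vertex d) R, g x := Finset.sum_nonneg fun x _ => hg x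
  have hnd : (0 : ℝ) < (n : ℝ) ^ d := by positivity
  have h9 : ((9 : ℝ) ^ d) ^ (1 - θ) ≤ 9 ^ d := by
    calc ((9 : ℝ) ^ d) ^ (1 - θ) ≤ ((9 : ℝ) ^ d) ^ (1 : ℝ) :=
          Real.rpow_le_rpow_of_exponent_le (one_le_pow₀ (by norm_num)) (by linarith)
      _ = _ := Real.rpow_one _
  have h2 : ((box (0 : Vertex d) R).card : ℝ) ^ (1 - θ) ≤ 9 ^ d * ((n : ℝ) ^ d) ^ (1 - θ) := by
    refine (Real.rpow_le_rpow (by positivity) hc (by linarith)).trans ?_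
    rw [Real.mul_rpow (by positivity) hnd.le]
    gcongr
  have h3 : ((n : ℝ) ^ d)⁻¹ * ((n : ℝ) ^ d) ^ (1 - θ) = (((n : ℝ) ^ d)⁻¹) ^ θ := by
    rw [Real.inv_rpow hnd.le, ← Real.rpow_neg hnd.le, ← Real.rpow_neg_one, ← Real.rpow_add hnd]
    ring_nf
  calc _ ≤ ((n : ℝ) ^ d)⁻¹ * (9 ^ d * ((n : ℝ) ^ d) ^ (1 - θ) *
        (∑ x ∈ box (0 : Vertex d) R, g x) ^ θ) := by
        gcongr
        exact h.trans (by gcongr)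
    _ = 9 ^ d * ((((n : ℝ) ^ d)⁻¹ * ((n : ℝ) ^ d) ^ (1 - θ)) *
        (∑ x ∈ box (0 : Vertex d) R, g x) ^ θ) := by ring
    _ = _ := by rw [h3, Real.mul_rpow (by positivity) hs]

/-- A Sobolev norm of `w ^ (1 + δ)` is controlled by a stronger Sobolev norm of `w`. -/
theorem sobolevNorm_rpow_le (d : ℕ) {r t δ : ℝ} (hδ : 0 < δ) (hr : 1 ≤ r) (ht : 1 ≤ t)
    (htr : 1 / t = 1 / r + δ) :
    ∃ C : ℝ, 0 ≤ C ∧ ∀ n R : ℕ, 1 ≤ n → R ≤ 4 * n → ∀ w : Vertex d → ℝ, (∀ x, 0 ≤ w x) →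
      sobolevNorm t n (fun x => w x ^ (1 + δ)) R ≤ C * sobolevNorm r n w R ^ (1 + δ) := by
  have hr0 : 0 < r := by linarith
  have ht0 : 0 < t := by linarith
  have htt : t * (1 / t) = 1 := mul_one_div_cancel ht0.ne'
  -- Hölder for w^(δt) |∇w|^t with w in L^1 and ∇w in L^r: the exponents δt and t/r add up to 1.
  have hθ : 1 - t / r = δ * t := by
    rw [htr] at htt
    have : t / r = t * (1 / r) := by ring
    rw [this]; linarith
  have hθ0 : 0 ≤ t / r := by positivity
  have hθ1 : t / r ≤ 1 := by nlinarith
  set C₁ : ℝ := (2 * (1 + δ)) ^ t * (2 * (d : ℝ) ^ (δ * t)) + 1 with hC₁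
  have hC₁0 : 0 ≤ C₁ := by positivity
  refine ⟨C₁ ^ (1 / t) * (9 ^ d) ^ δ, by positivity, fun n R hn hR w hw => ?_⟩
  have hn0 : (0 : ℝ) < n := by exact_mod_cast hn
  set S := box (0 : Vertex d) R
  set M₁ := ∑ x ∈ S, w x with hM
  have hM0 : 0 ≤ M₁ := Finset.sum_nonneg fun x _ => hw x
  set H := sobolevSum r (n : ℝ) w S with hH
  have hH0 : 0 ≤ H := sobolevSum_nonneg hn0.le _ _
  have hg1 := sum_abs_rpow_nonneg (bondsIn S) (grad w) r
  have hg2 := sum_abs_rpow_nonneg S w r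
  have hH1 : ∑ e ∈ bondsIn S, |grad w e| ^ r ≤ H := by
    rw [hH, sobolevSum]
    exact le_add_of_nonneg_right (by positivity)
  have hH2 : (n : ℝ) ^ (-r) * ∑ x ∈ S, |w x| ^ r ≤ H := by
    rw [hH, sobolevSum]
    exact le_add_of_nonneg_left hg1
  have hpt : ∀ y : ℝ, 0 ≤ y → (y ^ r) ^ (t / r) = y ^ t := fun y hy => by
    rw [← Real.rpow_mul hy, mul_div_cancel₀ _ hr0.ne']
  have hside : ∀ ε : Bond d → Vertex d, ∑ e ∈ bondsIn S, w (ε e) ≤ d * M₁ →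
      ∑ e ∈ bondsIn S, w (ε e) ^ (δ * t) * |grad w e| ^ t ≤
        (d : ℝ) ^ (δ * t) * (M₁ ^ (δ * t) * H ^ (t / r)) := by
    intro ε hε
    have h := sum_rpow_mul_rpow_le (bondsIn S) (A := fun e => w (ε e))
      (B := fun e => |grad w e| ^ r) hθ0 hθ1 (fun e _ => hw _)
      (fun e _ => Real.rpow_nonneg (abs_nonneg _) _)
    simp only [hpt _ (abs_nonneg _), hθ] at h
    refine h.trans ?_
    rw [← mul_assoc, ← Real.mul_rpow (by positivity) hM0]
    have h0 : 0 ≤ ∑ e ∈ bondsIn S, w (ε e) := Finset.sum_nonneg fun e _ => hw _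
    gcongr
  have hlow := hside lower (sum_bondsIn_lower_le S hw)
  have hup := hside upper (sum_bondsIn_upper_le S hw)
  have hzero : (n : ℝ) ^ (-t) * ∑ x ∈ S, |w x ^ (1 + δ)| ^ t ≤ M₁ ^ (δ * t) * H ^ (t / r) := by
    have h := sum_rpow_mul_rpow_le S (A := w)
      (B := fun x => (n : ℝ) ^ (-r) * |w x| ^ r) hθ0 hθ1 (fun e _ => hw _)
      (fun e _ => mul_nonneg (by positivity) (Real.rpow_nonneg (abs_nonneg _) _))
    rw [← Finset.mul_sum, hθ] at h
    calc (n : ℝ) ^ (-t) * ∑ x ∈ S, |w x ^ (1 + δ)| ^ t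
        = ∑ x ∈ S, w x ^ (δ * t) * ((n : ℝ) ^ (-r) * |w x| ^ r) ^ (t / r) := by
          rw [Finset.mul_sum]
          refine Finset.sum_congr rfl fun x _ => ?_
          rw [Real.mul_rpow (by positivity) (by positivity), hpt _ (abs_nonneg _),
            ← Real.rpow_mul hn0.le, abs_of_nonneg (hw x), abs_of_nonneg (Real.rpow_nonneg (hw x) _),
            ← Real.rpow_mul (hw x), mul_left_comm, ← Real.rpow_add_of_nonneg (hw x)
              (by positivity) ht0.le]
          have e1 : -r * (t / r) = -t := by field_simp
          have e2 : δ * t + t = (1 + δ) * t := by ring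
          rw [e1, e2]
      _ ≤ _ := h
      _ ≤ _ := by gcongr
  have hgrad : ∑ e ∈ bondsIn S, |grad (fun x => w x ^ (1 + δ)) e| ^ t ≤
      (2 * (1 + δ)) ^ t * (2 * (d : ℝ) ^ (δ * t)) * (M₁ ^ (δ * t) * H ^ (t / r)) := by
    have h1 : ∀ e : Bond d, |grad (fun x => w x ^ (1 + δ)) e| ^ t ≤ (2 * (1 + δ)) ^ t *
        (w (lower e) ^ (δ * t) * |grad w e| ^ t + w (upper e) ^ (δ * t) * |grad w e| ^ t) := by
      intro e
      have h2 := abs_rpow_sub_rpow_le (β := 1 + δ) (by linarith) (hw (lower e)) (hw (upper e))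
      rw [add_sub_cancel_left] at h2
      have hl := Real.rpow_nonneg (hw (lower e)) δ
      have hu := Real.rpow_nonneg (hw (upper e)) δ
      refine (Real.rpow_le_rpow (abs_nonneg _) h2 ht0.le).trans ?_
      rw [Real.mul_rpow (by positivity) (abs_nonneg _), Real.mul_rpow (by positivity)
        (by positivity), Real.mul_rpow two_pos.le (by positivity), Real.rpow_mul (hw _),
        Real.rpow_mul (hw _), ← add_mul]
      have h3 := add_rpow_le_two_rpow hl hu ht0.le
      calc (1 + δ) ^ t * (w (lower e) ^ δ + w (upper e) ^ δ) ^ t * |w (upper e) - w (lower e)| ^ t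
          ≤ (1 + δ) ^ t * (2 ^ t * ((w (lower e) ^ δ) ^ t + (w (upper e) ^ δ) ^ t)) *
            |w (upper e) - w (lower e)| ^ t := by gcongr
        _ = _ := by rw [grad]; ring
    refine (Finset.sum_le_sum fun e _ => h1 e).trans ?_
    rw [← Finset.mul_sum, Finset.sum_add_distrib, mul_assoc]
    refine mul_le_mul_of_nonneg_left ?_ (by positivity)
    linarith
  have hmain : sobolevSum t (n : ℝ) (fun x => w x ^ (1 + δ)) S ≤
      C₁ * (M₁ ^ (δ * t) * H ^ (t / r)) := by
    rw [sobolevSum, hC₁, add_mul, one_mul]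
    exact add_le_add hgrad hzero
  set N : ℝ := ((n : ℝ) ^ d)⁻¹ with hN
  have hN0 : 0 < N := by positivity
  have hNsum : N * M₁ ≤ 9 ^ d * sobolevNorm r n w R := by
    have h := sum_box_le d (θ := 1 / r) (by positivity) (by rw [div_le_one hr0]; exact hr) hn hR
      (g := fun x => w x ^ r) (fun x => Real.rpow_nonneg (hw x) _)
    simp only [← Real.rpow_mul (hw _), mul_one_div_cancel hr0.ne', Real.rpow_one] at h
    refine h.trans (mul_le_mul_of_nonneg_left ?_ (by positivity))
    have h2 := boxNorm_le_sobolevNorm (t := r) w hn hr0 R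
    rw [boxNorm] at h2
    simpa only [abs_of_nonneg (hw _)] using h2
  have hsn0 := sobolevNorm_nonneg (t := r) (n := n) w R
  calc sobolevNorm t n (fun x => w x ^ (1 + δ)) R
      ≤ n * (N * (C₁ * (M₁ ^ (δ * t) * H ^ (t / r)))) ^ (1 / t) := by
        rw [sobolevNorm]
        refine mul_le_mul_of_nonneg_left (Real.rpow_le_rpow (mul_nonneg (by positivity)
          (sobolevSum_nonneg hn0.le _ _)) (mul_le_mul_of_nonneg_left hmain hN0.le)
          (by positivity)) hn0.le
    _ = C₁ ^ (1 / t) * ((N * M₁) ^ δ * (n * (N * H) ^ (1 / r))) := by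
        have e1 : (N * M₁) ^ (δ * t) * (N * H) ^ (t / r) = N * (M₁ ^ (δ * t) * H ^ (t / r)) := by
          rw [Real.mul_rpow hN0.le hM0, Real.mul_rpow hN0.le hH0]
          have : N ^ (δ * t) * N ^ (t / r) = N := by
            rw [← Real.rpow_add hN0, ← hθ, sub_add_cancel, Real.rpow_one]
          calc _ = (N ^ (δ * t) * N ^ (t / r)) * (M₁ ^ (δ * t) * H ^ (t / r)) := by ring
            _ = _ := by rw [this]
        rw [mul_left_comm N, ← e1, Real.mul_rpow hC₁0 (by positivity),
          Real.mul_rpow (by positivity) (by positivity), ← Real.rpow_mul (by positivity),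
          ← Real.rpow_mul (by positivity)]
        have e2 : δ * t * (1 / t) = δ := by field_simp
        have e3 : t / r * (1 / t) = 1 / r := by field_simp
        rw [e2, e3]; ring
    _ ≤ C₁ ^ (1 / t) * ((9 ^ d * sobolevNorm r n w R) ^ δ * sobolevNorm r n w R) := by
        have : (n : ℝ) * (N * H) ^ (1 / r) = sobolevNorm r n w R := rfl
        rw [this]
        gcongr
    _ = _ := by
        rw [Real.mul_rpow (by positivity) hsn0, add_comm 1 δ,
          Real.rpow_add_one' hsn0 (by linarith)]
        ring

/-- Gain of integrability from the Sobolev inequality. -/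
theorem boxNorm_rpow_le {d : ℕ} (hd : 2 ≤ d) {r δ : ℝ} (hr : 1 ≤ r) (hrd : r < d) (hδ : 0 < δ)
    (hδd : (1 + δ) * (1 / r - 1 / d) ≤ 1 / r) :
    ∃ C : ℝ, 0 ≤ C ∧ ∀ n R : ℕ, 1 ≤ n → n ≤ R → R ≤ 4 * n → ∀ w : Vertex d → ℝ, (∀ x, 0 ≤ w x) →
      boxNorm r n (fun x => w x ^ (1 + δ)) R ≤ C * sobolevNorm r n w R ^ (1 + δ) := by
  have hr0 : 0 < r := by linarith
  have hd0 : (0 : ℝ) < d := by linarith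
  set T := 1 / (1 / r - 1 / (d : ℝ)) with hTdef
  have hpos : 0 < 1 / r - 1 / (d : ℝ) := sub_pos.2 (one_div_lt_one_div_of_lt hr0 hrd)
  have hT : 0 < T := one_div_pos.2 hpos
  have h1T : 1 / T = 1 / r - 1 / d := by rw [hTdef, one_div_one_div]
  obtain ⟨C, hC, hsob⟩ := sobolev_box hd hr hT h1T
  -- The hypothesis on δ says (1+δ) r ≤ T, so the L^((1+δ)r) mean is dominated by the Sobolev
  -- exponent T.
  set θ := (1 + δ) * r / T with hθ
  have hθ0 : 0 ≤ θ := by positivity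
  have hθe : θ = (1 + δ) * (1 / r - 1 / d) * r := by rw [← h1T, hθ]; ring
  have hθ1 : θ ≤ 1 := by
    rw [hθe]
    calc _ ≤ 1 / r * r := by gcongr
      _ = 1 := one_div_mul_cancel hr0.ne'
  refine ⟨(9 ^ d * C ^ θ) ^ (1 / r), by positivity, fun n R hn hnR hR w hw => ?_⟩
  have hn0 : (0 : ℝ) < n := by exact_mod_cast hn
  have hs := hsob R n hn0 (by
    have : (n : ℝ) ≤ R := by exact_mod_cast hnR
    linarith) w hw
  have hE0 := sobolevNorm_nonneg (t := r) (n := n) w R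
  have h := sum_box_le d hθ0 hθ1 hn hR (g := fun x => w x ^ T) (fun x => Real.rpow_nonneg (hw x) _)
  have e1 : T * θ = (1 + δ) * r := by rw [hθ]; field_simp
  simp only [← Real.rpow_mul (hw _), e1] at h
  rw [boxNorm]
  simp only [abs_of_nonneg (Real.rpow_nonneg (hw _) _), ← Real.rpow_mul (hw _)]
  have h2 : (((n : ℝ) ^ d)⁻¹ * ∑ x ∈ box 0 R, w x ^ T) ^ θ ≤
      C ^ θ * sobolevNorm r n w R ^ ((1 + δ) * r) := by
    have h3 : ((n : ℝ) ^ d)⁻¹ * ∑ x ∈ box 0 R, w x ^ T ≤ C * sobolevNorm r n w R ^ T := by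
      rw [sobolevSum_rpow w hn] at hs
      calc _ ≤ ((n : ℝ) ^ d)⁻¹ * (C * (sobolevNorm r n w R ^ T * (n : ℝ) ^ (d * (T / r) - T))) := by
            gcongr
        _ = C * sobolevNorm r n w R ^ T * (((n : ℝ) ^ d)⁻¹ * (n : ℝ) ^ (d * (T / r) - T)) := by ring
        _ = _ := by
            have : d * (T / r) - T = d := by
              have h5 : T * (1 / r - 1 / d) = 1 := by rw [← h1T, mul_one_div_cancel hT.ne']
              have h6 : d * (T * (1 / r - 1 / d)) = d * (T / r) - T := by field_simp
              rw [← h6, h5, mul_one]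
            rw [this, Real.rpow_natCast, inv_mul_cancel₀ (by positivity), mul_one]
    have h0 : 0 ≤ ∑ x ∈ box (0 : Vertex d) R, w x ^ T :=
      Finset.sum_nonneg fun x _ => Real.rpow_nonneg (hw x) _
    refine (Real.rpow_le_rpow (by positivity) h3 hθ0).trans (le_of_eq ?_)
    rw [Real.mul_rpow hC (by positivity), ← Real.rpow_mul hE0, e1]
  have h0 : 0 ≤ ∑ x ∈ box (0 : Vertex d) R, w x ^ ((1 + δ) * r) :=
    Finset.sum_nonneg fun x _ => Real.rpow_nonneg (hw x) _
  calc _ ≤ (9 ^ d * (C ^ θ * sobolevNorm r n w R ^ ((1 + δ) * r))) ^ (1 / r) := by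
        refine Real.rpow_le_rpow (by positivity) (h.trans (by gcongr)) (by positivity)
    _ = _ := by
        rw [← mul_assoc, Real.mul_rpow (by positivity) (by positivity), ← Real.rpow_mul hE0]
        have : (1 + δ) * r * (1 / r) = 1 + δ := by field_simp
        rw [this]

/-! ### One step of the iteration -/

/-- The gradient bound obtained from the optimised Caccioppoli inequality, in scaled norms. -/
theorem gradNorm_sq_le_sobolevNorm {m : ℕ} (hm : 2 ≤ m) {p q : ℝ≥0∞} (hp : 1 < p) (hq : 1 < q)
    {r t : ℝ} (ht : 1 ≤ t) (hr : 1 / r = (1 + (q⁻¹).toReal) / 2)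
    (htp : 1 / t = (1 - (p⁻¹).toReal) / 2 + 1 / m) :
    ∃ C : ℝ, 0 ≤ C ∧ ∀ ω : Bond (m + 1) → ℝ, (∀ e, 0 < ω e) → ∀ u : Vertex (m + 1) → ℝ,
      (∀ x, dvg (fun e => ω e * grad u e) x = 0) → ∀ α : ℝ, 1 ≤ α → ∀ n ρ σ : ℕ, 1 ≤ n → n ≤ ρ →
        ρ < σ → σ ≤ 4 * n →
          gradNorm r n (fun x => |u x| ^ α) ρ ^ 2 ≤
            C * α * ellipticity p q ω (box 0 (4 * n)) *
              ((n : ℝ) / (σ - ρ)) ^ (2 + 2 / (m : ℝ)) *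
                sobolevNorm t n (fun x => |u x| ^ α) σ ^ 2 := by
  obtain ⟨C₁, hC₁, hH⟩ := gradNorm_sq_le (m + 1) hq hr
  obtain ⟨C₂, hC₂, hE⟩ := energy_le_sobolevSum hm hp ht htp
  refine ⟨C₁ * C₂, by positivity, fun ω hω u hu α hα n ρ σ hn hnρ hρσ hσ => ?_⟩
  have hn0 : (0 : ℝ) < n := by exact_mod_cast hn
  have ht0 : 0 < t := by linarith
  have hm0 : (0 : ℝ) < m := by exact_mod_cast (by omega : 0 < m)
  have h1 := hH ω hω n ρ hn (by omega) (fun x => |u x| ^ α)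
  have h2 := hE ω hω u hu α hα n ρ σ hn hnρ hρσ hσ
  set a := (p⁻¹).toReal
  set N : ℝ := (σ : ℝ) - ρ with hN
  have hN0 : 0 < N := by rw [hN, sub_pos]; exact_mod_cast hρσ
  set v : Vertex (m + 1) → ℝ := fun x => |u x| ^ α
  have hS0 := sobolevSum_nonneg (t := t) hn0.le v (box 0 σ)
  have hB := avgNorm_nonneg q (bondsIn (box (0 : Vertex (m + 1)) (4 * n))) fun e => (ω e)⁻¹
  refine h1.trans ?_
  -- The powers of 1/(σ - ρ) are a from the weight, 1 from the cutoff and 2/t from the layer energy;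
  -- by homogeneity n appears with the same total power.
  have hexp : a + 1 + 2 / t = 2 + 2 / (m : ℝ) := by
    have : 2 / t = 2 * (1 / t) := by ring
    rw [this, htp]; ring
  have hid : (n : ℝ) ^ 2 * (((n : ℝ) ^ (m + 1))⁻¹ * (((n : ℝ) ^ (m + 1) / N) ^ a * (1 / N) *
      (sobolevSum t n v (box 0 σ) / N) ^ (2 / t))) =
      (n / N) ^ (2 + 2 / (m : ℝ)) * sobolevNorm t n v σ ^ 2 := by
    rw [Real.div_rpow hS0 hN0.le, sobolevSum_rpow v hn σ 2, Real.rpow_two,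
      Real.div_rpow (by positivity) hN0.le, Real.div_rpow hn0.le hN0.le, ← hexp,
      Real.rpow_add hN0, Real.rpow_add hN0, Real.rpow_one]
    have hpow : (n : ℝ) ^ 2 * (((n : ℝ) ^ (m + 1))⁻¹ * (((n : ℝ) ^ (m + 1)) ^ a *
        (n : ℝ) ^ (((m + 1 : ℕ) : ℝ) * (2 / t) - 2))) = (n : ℝ) ^ (a + 1 + 2 / t) := by
      rw [← Real.rpow_natCast (n : ℝ) 2, ← Real.rpow_natCast (n : ℝ) (m + 1),
        ← Real.rpow_mul hn0.le, ← Real.rpow_neg hn0.le, ← Real.rpow_add hn0, ← Real.rpow_add hn0,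
        ← Real.rpow_add hn0]
      congr 1
      have h3 : 2 / t = 1 - a + 2 / m := by linarith
      rw [h3]; push_cast; field_simp; ring
    rw [← hpow]
    field_simp
  calc _ ≤ C₁ * avgNorm q (bondsIn (box 0 (4 * n))) (fun e => (ω e)⁻¹) * ((n : ℝ) ^ 2 *
          (((n : ℝ) ^ (m + 1))⁻¹ * (C₂ * α * avgNorm p (bondsIn (box 0 (4 * n))) ω *
              ((n : ℝ) ^ (m + 1) / N) ^ a * (1 / N) *
              (sobolevSum t n v (box 0 σ) / N) ^ (2 / t)))) := by gcongr
    _ = C₁ * C₂ * α * ellipticity p q ω (box 0 (4 * n)) * ((n : ℝ) ^ 2 * (((n : ℝ) ^ (m + 1))⁻¹ *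
          (((n : ℝ) ^ (m + 1) / N) ^ a * (1 / N) *
            (sobolevSum t n v (box 0 σ) / N) ^ (2 / t)))) := by rw [ellipticity]; ring
    _ = _ := by rw [hid]; ring

/-- One step of the Moser iteration. -/
theorem sobolevNorm_step {m : ℕ} (hm : 2 ≤ m) {p q : ℝ≥0∞} (hp : 1 < p) (hq : 1 < q)
    {r δ : ℝ} (hδ : 0 < δ) (hδe : δ = 1 / m - (p⁻¹).toReal / 2 - (q⁻¹).toReal / 2)
    (hr : 1 / r = (1 + (q⁻¹).toReal) / 2) :
    ∃ C : ℝ, 0 ≤ C ∧ ∀ ω : Bond (m + 1) → ℝ, (∀ e, 0 < ω e) → ∀ u : Vertex (m + 1) → ℝ,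
      (∀ x, dvg (fun e => ω e * grad u e) x = 0) → ∀ α : ℝ, 1 ≤ α → ∀ n ρ σ : ℕ, 1 ≤ n → n ≤ ρ →
        ρ < σ → σ ≤ 4 * n → σ ≤ ρ + n →
          sobolevNorm r n (fun x => |u x| ^ (α * (1 + δ))) ρ ≤
            C * (√α * √(ellipticity p q ω (box 0 (4 * n))) * ((n : ℝ) / (σ - ρ)) ^ 2) *
              sobolevNorm r n (fun x => |u x| ^ α) σ ^ (1 + δ) := by
  have ha0 : 0 ≤ (p⁻¹).toReal := ENNReal.toReal_nonneg
  have hb0 : 0 ≤ (q⁻¹).toReal := ENNReal.toReal_nonneg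
  have ha1 := inv_toReal_lt_one hp
  have hb1 := inv_toReal_lt_one hq
  have hm2 : (2 : ℝ) ≤ m := by exact_mod_cast hm
  have hm0 : (0 : ℝ) < m := by linarith
  have hm1 : 1 / (m : ℝ) ≤ 1 / 2 := one_div_le_one_div_of_le two_pos hm2
  have hrpos : 0 < 1 / r := by rw [hr]; linarith
  have hr0 : 0 < r := one_div_pos.1 hrpos
  have hr1 : 1 ≤ r := by
    have : 1 / r ≤ 1 := by rw [hr]; linarith
    rwa [div_le_one hr0] at this
  have hr2 : r ≤ 2 := by
    have h1 : 1 / 2 ≤ 1 / r := by rw [hr]; linarith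
    exact (one_div_le_one_div two_pos hr0).1 h1
  -- The t for which w^(1+δ) is controlled by the L^r energy of w is also the t of the optimised
  -- Caccioppoli inequality. This coincidence fixes δ.
  set t := 1 / (1 / r + δ) with htdef
  have htr : 1 / t = 1 / r + δ := by rw [htdef, one_div_one_div]
  have htp : 1 / t = (1 - (p⁻¹).toReal) / 2 + 1 / m := by rw [htr, hr, hδe]; ring
  have ht0 : 0 < t := by rw [htdef]; positivity
  have ht : 1 ≤ t := by
    have : 1 / t ≤ 1 := by rw [htp]; linarith
    rwa [div_le_one ht0] at this
  obtain ⟨C₁, hC₁, h₁⟩ := gradNorm_sq_le_sobolevNorm hm hp hq ht hr htp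
  obtain ⟨C₂, hC₂, h₂⟩ := sobolevNorm_rpow_le (m + 1) hδ hr1 ht htr
  obtain ⟨C₃, hC₃, h₃⟩ := boxNorm_rpow_le (d := m + 1) (by omega) hr1
    (by push_cast; linarith) hδ (by
      have hδm : δ ≤ 1 / m := by linarith
      have h1 : δ * (1 / r) ≤ 1 / m * (1 / r) := by gcongr
      have h1r : 1 / r ≤ 1 := by rw [hr]; linarith
      have hd0 : (0 : ℝ) ≤ 1 / ((m + 1 : ℕ) : ℝ) := by positivity
      have h4 : 0 ≤ 1 / r - 1 / ((m + 1 : ℕ) : ℝ) := by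
        have : 1 / ((m + 1 : ℕ) : ℝ) ≤ 1 / 2 :=
          one_div_le_one_div_of_le two_pos (by push_cast; linarith)
        rw [hr]; linarith
      -- With d = m + 1, δ(1/r - 1/d) ≤ (1/m)(1 - 1/d) = 1/d, which is the condition on δ for the
      -- zero order term.
      have h5 : δ * (1 / r - 1 / ((m + 1 : ℕ) : ℝ)) ≤ 1 / m * (1 - 1 / ((m + 1 : ℕ) : ℝ)) :=
        mul_le_mul hδm (by linarith) h4 (by positivity)
      have h6 : 1 / (m : ℝ) * (1 - 1 / ((m + 1 : ℕ) : ℝ)) = 1 / ((m + 1 : ℕ) : ℝ) := by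
        push_cast; field_simp; ring
      linarith)
  refine ⟨√(C₁ * (1 + δ)) * C₂ + C₃, by positivity,
    fun ω hω u hu α hα n ρ σ hn hnρ hρσ hσ hσn => ?_⟩
  have hn0 : (0 : ℝ) < n := by exact_mod_cast hn
  set Λ := ellipticity p q ω (box 0 (4 * n))
  have hΛ : 1 ≤ Λ := one_le_ellipticity (by omega) hp.le hq.le hω (by omega)
  set N : ℝ := (σ : ℝ) - ρ with hN
  have hN0 : 0 < N := by rw [hN, sub_pos]; exact_mod_cast hρσ
  have hNn : 1 ≤ n / N := by
    rw [le_div_iff₀ hN0, one_mul, hN, sub_le_iff_le_add']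
    exact_mod_cast hσn
  have hα0 : 0 ≤ α := by linarith
  set w : Vertex (m + 1) → ℝ := fun x => |u x| ^ α with hw
  have hw0 : ∀ x, 0 ≤ w x := fun x => Real.rpow_nonneg (abs_nonneg _) _
  have hwχ : (fun x => |u x| ^ (α * (1 + δ))) = fun x => w x ^ (1 + δ) := by
    funext x; rw [hw, Real.rpow_mul (abs_nonneg _)]
  have hg := h₁ ω hω u hu (α * (1 + δ)) (by nlinarith) n ρ σ hn hnρ hρσ hσ
  rw [hwχ] at hg ⊢
  have hE := h₂ n σ hn hσ w hw0
  have hB := h₃ n ρ hn hnρ (by omega) w hw0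
  have hEn := sobolevNorm_nonneg (t := t) (n := n) (fun x => w x ^ (1 + δ)) σ
  have hE0 := sobolevNorm_nonneg (t := r) (n := n) w σ
  have hE0' := sobolevNorm_nonneg (t := r) (n := n) w ρ
  have hmono := sobolevNorm_mono (n := n) w hr0 hρσ.le
  obtain ⟨Eσ, hEσ⟩ : ∃ E, E = sobolevNorm r n w σ := ⟨_, rfl⟩
  obtain ⟨Eρ, hEρ⟩ : ∃ E, E = sobolevNorm r n w ρ := ⟨_, rfl⟩
  obtain ⟨Et, hEt⟩ : ∃ E, E = sobolevNorm t n (fun x => w x ^ (1 + δ)) σ := ⟨_, rfl⟩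
  rw [← hEσ] at hE hE0 hmono ⊢
  rw [← hEρ] at hB hE0' hmono
  rw [← hEt] at hg hE hEn
  have hK : gradNorm r n (fun x => w x ^ (1 + δ)) ρ ≤
      √(C₁ * (1 + δ)) * (√α * √Λ * (n / N) ^ 2) * (C₂ * Eσ ^ (1 + δ)) := by
    refine (pow_le_pow_iff_left₀ (gradNorm_nonneg _ _) (by positivity) two_ne_zero).1 (hg.trans ?_)
    -- 2 + 2/m ≤ 4 since m ≥ 2, and n/N ≥ 1 because the radii differ by at most n.
    have hexp : ((n : ℝ) / N) ^ (2 + 2 / (m : ℝ)) ≤ ((n / N) ^ 2) ^ 2 := by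
      rw [← pow_mul, ← Real.rpow_natCast]
      refine Real.rpow_le_rpow_of_exponent_le hNn ?_
      have : 2 / (m : ℝ) = 2 * (1 / m) := by ring
      rw [this]; push_cast; linarith
    rw [mul_pow, mul_pow, mul_pow, mul_pow, Real.sq_sqrt (by positivity), Real.sq_sqrt hα0,
      Real.sq_sqrt (by linarith)]
    calc _ ≤ C₁ * (α * (1 + δ)) * Λ * ((n / N) ^ 2) ^ 2 * (C₂ * Eσ ^ (1 + δ)) ^ 2 := by gcongr
      _ = _ := by ring
  -- The zero order term comes without Λ; a factor at least 1 puts it in the same form as the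
  -- gradient term.
  have hone : 1 ≤ √α * √Λ * (n / N) ^ 2 := by
    have h1 : 1 ≤ √α := Real.one_le_sqrt.2 hα
    have h2 : 1 ≤ √Λ := Real.one_le_sqrt.2 hΛ
    have h3 : 1 ≤ ((n : ℝ) / N) ^ 2 := one_le_pow₀ hNn
    exact one_le_mul_of_one_le_of_one_le (one_le_mul_of_one_le_of_one_le h1 h2) h3
  set K := √α * √Λ * (n / N) ^ 2
  have hB' : boxNorm r n (fun x => w x ^ (1 + δ)) ρ ≤ C₃ * K * Eσ ^ (1 + δ) := by
    refine hB.trans ?_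
    calc _ ≤ C₃ * Eσ ^ (1 + δ) := by gcongr
      _ = C₃ * 1 * Eσ ^ (1 + δ) := by rw [mul_one]
      _ ≤ _ := by gcongr
  refine (sobolevNorm_le _ hn hr1 ρ).trans ?_
  calc _ ≤ _ := add_le_add hK hB'
    _ = _ := by ring

/-! ### The starting estimate in L^(2p') -/

theorem two_mul_conjExponent {p : ℝ≥0∞} (hp : 1 < p) :
    2 * p.conjExponent ≠ 0 ∧ 2 * p.conjExponent ≠ ∞ ∧
      (2 * p.conjExponent).toReal = 2 / (1 - (p⁻¹).toReal) := by
  have h := (ENNReal.HolderConjugate.conjExponent hp.le).inv_add_inv_eq_one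
  have ha1 := inv_toReal_lt_one hp
  have hpt : p⁻¹ ≠ ∞ := ENNReal.inv_ne_top.2 (by positivity)
  have h0 : p.conjExponent ≠ 0 := by rw [ENNReal.conjExponent]; simp
  have hinv : (p.conjExponent⁻¹).toReal = 1 - (p⁻¹).toReal := by
    have h1 := congrArg ENNReal.toReal h
    rw [ENNReal.toReal_add hpt (ENNReal.inv_ne_top.2 h0), ENNReal.toReal_one] at h1
    linarith
  have htop : p.conjExponent ≠ ∞ := fun h => by
    rw [h, ENNReal.inv_top, ENNReal.toReal_zero] at hinv; linarith
  refine ⟨mul_ne_zero two_ne_zero h0, ENNReal.mul_ne_top (by simp) htop, ?_⟩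
  rw [ENNReal.toReal_mul, ← hinv, ENNReal.toReal_inv, div_inv_eq_mul]
  simp

/-- The starting point of the iteration. -/
theorem sobolevNorm_start (d : ℕ) {p q : ℝ≥0∞} (hd : 1 ≤ d) (hp : 1 < p) (hq : 1 < q)
    {r : ℝ} (hr : 1 / r = (1 + (q⁻¹).toReal) / 2) :
    ∃ C : ℝ, 0 ≤ C ∧ ∀ ω : Bond d → ℝ, (∀ e, 0 < ω e) → ∀ u : Vertex d → ℝ,
      (∀ x, dvg (fun e => ω e * grad u e) x = 0) → ∀ n : ℕ, 1 ≤ n →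
        sobolevNorm r n (fun x => |u x| ^ (1 : ℝ)) (2 * n) ≤
          C * √(ellipticity p q ω (box 0 (4 * n))) *
            avgNorm (2 * p.conjExponent) (box 0 (4 * n)) u := by
  obtain ⟨C₁, hC₁, h₁⟩ := gradNorm_sq_le d hq hr
  obtain ⟨hP0, hPt, hPe⟩ := two_mul_conjExponent hp
  set P := 2 * p.conjExponent
  set a := (p⁻¹).toReal with ha
  have ha0 : 0 ≤ a := ENNReal.toReal_nonneg
  have hb0 : 0 ≤ (q⁻¹).toReal := ENNReal.toReal_nonneg
  have ha1 : a < 1 := inv_toReal_lt_one hp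
  have hb1 := inv_toReal_lt_one hq
  have hrpos : 0 < 1 / r := by rw [hr]; linarith
  have hr0 : 0 < r := one_div_pos.1 hrpos
  have hr1 : 1 ≤ r := by
    have : 1 / r ≤ 1 := by rw [hr]; linarith
    rwa [div_le_one hr0] at this
  have hr2 : r ≤ 2 := by
    have h1 : 1 / 2 ≤ 1 / r := by rw [hr]; linarith
    exact (one_div_le_one_div two_pos hr0).1 h1
  set T := P.toReal with hT
  have hT2 : 2 ≤ T := by rw [hPe, le_div_iff₀ (by linarith)]; linarith
  have hT0 : 0 < T := by linarith
  have hTa : T * (1 - a) = 2 := by rw [hPe, div_mul_cancel₀ _ (by linarith)]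
  refine ⟨√(C₁ * (3 * (d * 9 ^ d))) + (9 ^ d * (9 ^ d) ^ (r / T)) ^ (1 / r), by positivity,
    fun ω hω u hu n hn => ?_⟩
  have hn0 : (0 : ℝ) < n := by exact_mod_cast hn
  set Λ := ellipticity p q ω (box 0 (4 * n)) with hΛdef
  have hΛ : 1 ≤ Λ := one_le_ellipticity hd hp.le hq.le hω (by omega)
  set A := avgNorm P (box 0 (4 * n)) u
  have hA : 0 ≤ A := avgNorm_nonneg _ _ _
  set v : Vertex d → ℝ := fun x => |u x| ^ (1 : ℝ) with hv
  have hvu : ∀ x, v x = |u x| := fun x => Real.rpow_one _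
  have hv0 : ∀ x, 0 ≤ v x := fun x => (hvu x).symm ▸ abs_nonneg _
  obtain ⟨hSc, hBc⟩ := card_bondsIn_box_le d n hn
  set S := bondsIn (box (0 : Vertex d) (4 * n))
  have hvT : ∑ x ∈ box (0 : Vertex d) (4 * n), v x ^ T ≤ 9 ^ d * (n : ℝ) ^ d * A ^ T := by
    simp only [hvu]
    rw [sum_rpow_eq_card_mul_avgNorm hP0 hPt]
    gcongr
  have hside : ∀ ε : Bond d → Vertex d,
      ∑ e ∈ S, v (ε e) ^ T ≤ d * ∑ x ∈ box (0 : Vertex d) (4 * n), v x ^ T →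
      ∑ e ∈ S, ω e * v (ε e) ^ 2 ≤ avgNorm p S ω * (d * 9 ^ d * (n : ℝ) ^ d) * A ^ 2 := by
    intro ε hε
    have h := sum_mul_le_avgNorm hp.le (Finset.Subset.refl S) (g := fun e => v (ε e) ^ T)
      (fun e => (hω e).le) (fun e => Real.rpow_nonneg (hv0 _) _) rfl
    simp only [← ha, ← Real.rpow_mul (hv0 _), hTa, Real.rpow_two] at h
    refine h.trans ?_
    have hK0 : (0 : ℝ) < d * 9 ^ d * (n : ℝ) ^ d := by
      have : (0 : ℝ) < d := by exact_mod_cast hd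
      positivity
    set K : ℝ := d * 9 ^ d * (n : ℝ) ^ d with hK
    have h2 : (∑ e ∈ S, v (ε e) ^ T) ^ (1 - a) ≤ K ^ (1 - a) * A ^ 2 := by
      have h3 : ∑ e ∈ S, v (ε e) ^ T ≤ K * A ^ T := by
        refine hε.trans ?_
        calc _ ≤ (d : ℝ) * (9 ^ d * (n : ℝ) ^ d * A ^ T) := by gcongr
          _ = _ := by rw [hK]; ring
      refine (Real.rpow_le_rpow (Finset.sum_nonneg fun e _ => Real.rpow_nonneg (hv0 _) _) h3
        (by linarith)).trans (le_of_eq ?_)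
      rw [Real.mul_rpow hK0.le (by positivity), ← Real.rpow_mul hA, hTa, Real.rpow_two]
    have hω' := avgNorm_nonneg p S ω
    calc _ ≤ K ^ a * avgNorm p S ω * (K ^ (1 - a) * A ^ 2) := by
          refine mul_le_mul (mul_le_mul_of_nonneg_right
            (Real.rpow_le_rpow (by positivity) hSc ha0) hω') h2 ?_ (by positivity)
          exact Real.rpow_nonneg (Finset.sum_nonneg fun e _ => Real.rpow_nonneg (hv0 _) _) _
      _ = avgNorm p S ω * (K ^ a * K ^ (1 - a)) * A ^ 2 := by ring
      _ = _ := by rw [← Real.rpow_add hK0, add_sub_cancel, Real.rpow_one]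
  have hlow := hside lower (sum_bondsIn_lower_le _ fun x => Real.rpow_nonneg (hv0 x) _)
  have hup := hside upper (sum_bondsIn_upper_le _ fun x => Real.rpow_nonneg (hv0 x) _)
  -- For α = 1 every layer between 2n and 4n is used, that is, a linear cutoff: Hölder alone
  -- produces the L^(2p') norm, without Sobolev. The factor 6 · 2/(2n)² = 3/n² explains the 3 in the
  -- constant.
  have hen := caccioppoli_layers hω hu le_rfl (ρ := 2 * n) (σ := 4 * n) (by omega)
    (Finset.Subset.refl _) (Finset.nonempty_Ico.2 (by omega))
  have hcard : ((Finset.Ico (2 * n) (4 * n)).card : ℝ) = 2 * n := by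
    rw [Nat.card_Ico, show 4 * n - 2 * n = 2 * n by omega]; push_cast; ring
  rw [hcard] at hen
  have hlayers : ∑ k ∈ Finset.Ico (2 * n) (4 * n), ∑ e ∈ layer d k, ω e *
      (v (lower e) ^ 2 + v (upper e) ^ 2) ≤
      ∑ e ∈ S, ω e * (v (lower e) ^ 2 + v (upper e) ^ 2) := by
    rw [← Finset.sum_biUnion (layer_disjoint _)]
    refine Finset.sum_le_sum_of_subset_of_nonneg (Finset.biUnion_subset.2 fun k hk =>
      layer_subset (Finset.mem_Ico.1 hk).2) fun e _ _ => mul_nonneg (hω e).le (by positivity)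
  have hsum : ∑ e ∈ S, ω e * (v (lower e) ^ 2 + v (upper e) ^ 2) ≤
      2 * (avgNorm p S ω * (d * 9 ^ d * (n : ℝ) ^ d) * A ^ 2) := by
    simp only [mul_add, Finset.sum_add_distrib]
    linarith
  have hgrad : gradNorm r n v (2 * n) ≤ √(C₁ * (3 * (d * 9 ^ d))) * √Λ * A := by
    refine (pow_le_pow_iff_left₀ (gradNorm_nonneg _ _) (by positivity) two_ne_zero).1
      ((h₁ ω hω n (2 * n) hn (by omega) v).trans ?_)
    have hq' := avgNorm_nonneg q S fun e => (ω e)⁻¹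
    rw [mul_pow, mul_pow, Real.sq_sqrt (by positivity), Real.sq_sqrt (by linarith)]
    calc _ ≤ C₁ * avgNorm q S (fun e => (ω e)⁻¹) * ((n : ℝ) ^ 2 * (((n : ℝ) ^ d)⁻¹ *
          (6 * 1 * ((2 * (n : ℝ))⁻¹ ^ 2 *
            (2 * (avgNorm p S ω * (d * 9 ^ d * (n : ℝ) ^ d) * A ^ 2)))))) := by
          have := hen.trans (mul_le_mul_of_nonneg_left (mul_le_mul_of_nonneg_left
            (hlayers.trans hsum) (by positivity)) (by norm_num))
          gcongr
      _ = _ := by rw [hΛdef, ellipticity]; field_simp; ring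
  have hbox : boxNorm r n v (2 * n) ≤ (9 ^ d * (9 ^ d) ^ (r / T)) ^ (1 / r) * A := by
    have h := sum_box_le d (θ := r / T) (by positivity)
      (by rw [div_le_one hT0]; linarith) hn (show 2 * n ≤ 4 * n by omega)
      (g := fun x => v x ^ T) (fun x => Real.rpow_nonneg (hv0 x) _)
    simp only [← Real.rpow_mul (hv0 _), mul_div_cancel₀ _ hT0.ne'] at h
    have h0 : ∀ s : ℝ, 0 ≤ ∑ x ∈ box (0 : Vertex d) (2 * n), v x ^ s := fun s =>
      Finset.sum_nonneg fun x _ => Real.rpow_nonneg (hv0 x) _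
    have h2 : ((n : ℝ) ^ d)⁻¹ * ∑ x ∈ box (0 : Vertex d) (2 * n), v x ^ T ≤ 9 ^ d * A ^ T := by
      have h3 : ∑ x ∈ box (0 : Vertex d) (2 * n), v x ^ T ≤ 9 ^ d * (n : ℝ) ^ d * A ^ T :=
        (Finset.sum_le_sum_of_subset_of_nonneg (box_mono (by omega)) fun x _ _ =>
          Real.rpow_nonneg (hv0 x) _).trans hvT
      calc _ ≤ ((n : ℝ) ^ d)⁻¹ * (9 ^ d * (n : ℝ) ^ d * A ^ T) := by gcongr
        _ = _ := by field_simp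
    rw [boxNorm]
    simp only [abs_of_nonneg (hv0 _)]
    have hs := h0 r
    have hsT := h0 T
    calc _ ≤ (9 ^ d * (9 ^ d * A ^ T) ^ (r / T)) ^ (1 / r) :=
          Real.rpow_le_rpow (by positivity) (h.trans (by gcongr)) (by positivity)
      _ = _ := by
          rw [Real.mul_rpow (x := 9 ^ d) (y := A ^ T) (by positivity) (by positivity),
            ← Real.rpow_mul hA, mul_div_cancel₀ _ hT0.ne', ← mul_assoc,
            Real.mul_rpow (y := A ^ r) (by positivity) (by positivity), ← Real.rpow_mul hA, mul_one_div_cancel hr0.ne', Real.rpow_one]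
  refine (sobolevNorm_le v hn hr1 _).trans ?_
  have hone : 1 ≤ √Λ := Real.one_le_sqrt.2 hΛ
  have hbox' : (9 ^ d * (9 ^ d) ^ (r / T)) ^ (1 / r) * A ≤
      (9 ^ d * (9 ^ d) ^ (r / T)) ^ (1 / r) * √Λ * A := by
    have : (0 : ℝ) ≤ (9 ^ d * (9 ^ d) ^ (r / T)) ^ (1 / r) := by positivity
    nlinarith [mul_nonneg (mul_nonneg this hA) (sub_nonneg.2 hone)]
  calc _ ≤ _ := add_le_add hgrad (hbox.trans hbox')
    _ = _ := by ring

/-! ### Iteration and conclusion -/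

/-- Solving a superlinear recursion. -/
theorem le_of_recursion {X : ℕ → ℝ} {B L U δ : ℝ} {K : ℕ} (hX : ∀ k, 0 ≤ X k) (hB : 1 ≤ B)
    (hL : 1 ≤ L) (hU : 0 ≤ U) (hδ : 0 < δ) (h0 : X 0 ≤ B * L * U)
    (hstep : ∀ k, k < K → X (k + 1) ≤ B ^ (k + 1) * L * X k ^ (1 + δ)) :
    X K ≤ (B ^ (1 + (1 + δ) / δ ^ 2) * L ^ ((1 + δ) / δ) * U) ^ ((1 + δ) ^ K) := by
  have hB0 : 0 < B := by linarith
  have hL0 : 0 < L := by linarith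
  set β := 1 + (1 + δ) / δ ^ 2 with hβ
  -- Closed forms of the exponents: that of B solves e(k+1) = (k+1) + (1+δ) e(k), that of L solves
  -- l(k+1) = 1 + (1+δ) l(k), both starting from 1. The subtracted terms are dropped at the end.
  have key : ∀ k, k ≤ K → X k ≤ B ^ (β * (1 + δ) ^ k - (k / δ + (1 + δ) / δ ^ 2)) *
      L ^ (((1 + δ) * (1 + δ) ^ k - 1) / δ) * U ^ ((1 + δ) ^ k) := by
    intro k
    induction k with
    | zero =>
      intro _
      have e1 : β * (1 + δ) ^ 0 - (((0 : ℕ) : ℝ) / δ + (1 + δ) / δ ^ 2) = 1 := by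
        rw [hβ, Nat.cast_zero]; ring
      have e2 : ((1 + δ) * (1 + δ) ^ 0 - 1) / δ = 1 := by field_simp; ring
      rw [e1, e2, pow_zero, Real.rpow_one, Real.rpow_one, Real.rpow_one]
      exact h0
    | succ k ih =>
      intro hk
      have h := ih (by omega)
      refine (hstep k (by omega)).trans ?_
      have h2 := Real.rpow_le_rpow (hX k) h (by linarith : 0 ≤ 1 + δ)
      rw [Real.mul_rpow (by positivity) (by positivity), Real.mul_rpow (by positivity)
        (by positivity), ← Real.rpow_mul hB0.le, ← Real.rpow_mul hL0.le, ← Real.rpow_mul hU] at h2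
      refine (mul_le_mul_of_nonneg_left h2 (by positivity)).trans (le_of_eq ?_)
      have e1 : β * (1 + δ) ^ (k + 1) - (((k + 1 : ℕ) : ℝ) / δ + (1 + δ) / δ ^ 2) =
          ((k + 1 : ℕ) : ℝ) + (β * (1 + δ) ^ k - (k / δ + (1 + δ) / δ ^ 2)) * (1 + δ) := by
        push_cast; field_simp; ring
      have e2 : ((1 + δ) * (1 + δ) ^ (k + 1) - 1) / δ =
          1 + ((1 + δ) * (1 + δ) ^ k - 1) / δ * (1 + δ) := by field_simp; ring
      rw [e1, e2, Real.rpow_add hB0, Real.rpow_add hL0, Real.rpow_natCast, Real.rpow_one,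
        pow_succ (1 + δ) k]
      ring
  refine (key K le_rfl).trans ?_
  rw [Real.mul_rpow (by positivity) (by positivity), Real.mul_rpow (by positivity)
    (by positivity), ← Real.rpow_mul hB0.le, ← Real.rpow_mul hL0.le]
  have h1 : B ^ (β * (1 + δ) ^ K - (K / δ + (1 + δ) / δ ^ 2)) ≤ B ^ (β * (1 + δ) ^ K) := by
    refine Real.rpow_le_rpow_of_exponent_le hB (sub_le_self _ (by positivity))
  have h2 : L ^ (((1 + δ) * (1 + δ) ^ K - 1) / δ) ≤ L ^ ((1 + δ) / δ * (1 + δ) ^ K) := by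
    refine Real.rpow_le_rpow_of_exponent_le hL ?_
    rw [div_mul_eq_mul_div]
    gcongr
    linarith
  gcongr

/-- The condition on k guarantees a = ⌊n/2^k⌋ ≥ 2, so halving with rounding still leaves a gap a -
⌊a/2⌋ ≥ (a+1)/4, while n < 2^k (a+1). -/
theorem radii_gap {n k : ℕ} (hk : 2 ^ (k + 1) ≤ n) :
    n / 2 ^ (k + 1) < n / 2 ^ k ∧
      (n : ℝ) ≤ 4 * 2 ^ k * (((n + n / 2 ^ k : ℕ) : ℝ) - ((n + n / 2 ^ (k + 1) : ℕ) : ℝ)) := by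
  have e : n / 2 ^ (k + 1) = n / 2 ^ k / 2 := by rw [Nat.div_div_eq_div_mul, pow_succ]
  have h2 : 2 ≤ n / 2 ^ k := by
    rw [Nat.le_div_iff_mul_le (by positivity)]
    rw [pow_succ] at hk; omega
  have h3 : n < 2 ^ k * (n / 2 ^ k + 1) := Nat.lt_mul_div_succ n (by positivity)
  set a := n / 2 ^ k
  rw [e]
  refine ⟨by omega, ?_⟩
  have h4 : a + 1 + 4 * (a / 2) ≤ 4 * a := by omega
  have h4' : (a : ℝ) + 1 + 4 * ((a / 2 : ℕ) : ℝ) ≤ 4 * a := by exact_mod_cast h4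
  have h3' : (n : ℝ) ≤ 2 ^ k * (a + 1) := by exact_mod_cast h3.le
  have hp : (0 : ℝ) < 2 ^ k := by positivity
  push_cast
  calc (n : ℝ) ≤ 2 ^ k * (a + 1) := h3'
    _ ≤ 2 ^ k * (4 * (a - (a / 2 : ℕ))) := by gcongr; linarith
    _ = _ := by ring

/-- A single term is at most the whole sum. This replaces the limit of infinitely many Moser steps;
undoing the normalization costs at most n^d. -/
theorem rpow_abs_le_sobolevNorm {d n R : ℕ} {r α : ℝ} (hn : 1 ≤ n) (hr : 1 ≤ r)
    (u : Vertex d → ℝ) {x : Vertex d} (hx : x ∈ box 0 R) :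
    |u x| ^ α ≤ (n : ℝ) ^ d * sobolevNorm r n (fun x => |u x| ^ α) R := by
  have hn1 : (1 : ℝ) ≤ n := by exact_mod_cast hn
  have hr0 : 0 < r := by linarith
  set v : Vertex d → ℝ := fun x => |u x| ^ α with hv
  have hv0 : ∀ x, 0 ≤ v x := fun x => Real.rpow_nonneg (abs_nonneg _) _
  have h1 := boxNorm_le_sobolevNorm v hn hr0 R
  refine le_trans ?_ (mul_le_mul_of_nonneg_left h1 (by positivity))
  have hs := sum_abs_rpow_nonneg (box 0 R) v r
  rw [boxNorm, Real.mul_rpow (by positivity) hs]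
  have h2 : v x ≤ (∑ y ∈ box 0 R, |v y| ^ r) ^ (1 / r) := by
    have h3 : |v x| ^ r ≤ ∑ y ∈ box 0 R, |v y| ^ r :=
      Finset.single_le_sum (f := fun y => |v y| ^ r)
        (fun y _ => Real.rpow_nonneg (abs_nonneg _) _) hx
    have h4 := Real.rpow_le_rpow (by positivity) h3 (by positivity : 0 ≤ 1 / r)
    rwa [← Real.rpow_mul (abs_nonneg _), mul_one_div_cancel hr0.ne', Real.rpow_one,
      abs_of_nonneg (hv0 x)] at h4
  have h5 : 1 ≤ (n : ℝ) ^ d * (((n : ℝ) ^ d)⁻¹) ^ (1 / r) := by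
    have hnd : 1 ≤ (n : ℝ) ^ d := one_le_pow₀ hn1
    rw [Real.inv_rpow (by positivity), ← div_eq_mul_inv, one_le_div (by positivity)]
    calc ((n : ℝ) ^ d) ^ (1 / r) ≤ ((n : ℝ) ^ d) ^ (1 : ℝ) :=
          Real.rpow_le_rpow_of_exponent_le hnd (by rw [div_le_one hr0]; exact hr)
      _ = _ := Real.rpow_one _
  have h6 : 0 ≤ (∑ y ∈ box 0 R, |v y| ^ r) ^ (1 / r) := by positivity
  calc v x ≤ 1 * (∑ y ∈ box 0 R, |v y| ^ r) ^ (1 / r) := by rw [one_mul]; exact h2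
    _ ≤ _ := mul_le_mul_of_nonneg_right h5 h6
    _ = _ := by ring

/-- The volume factor lost when the iteration ends at unit scale is bounded. -/
theorem natCast_pow_le_rpow {n d : ℕ} (hn : 1 ≤ n) {δ : ℝ} (hδ : 0 < δ) (hδ1 : δ ≤ 1) :
    (n : ℝ) ^ d ≤ ((2 : ℝ) ^ (d / δ)) ^ ((1 + δ) ^ Nat.log 2 n) := by
  set K := Nat.log 2 n
  have h1 : (n : ℝ) ≤ 2 ^ (K + 1) := by exact_mod_cast (Nat.lt_pow_succ_log_self one_lt_two n).le
  have h2 : 1 + K * δ ≤ (1 + δ) ^ K := one_add_mul_le_pow (by linarith) K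
  rw [← Real.rpow_mul two_pos.le]
  calc (n : ℝ) ^ d ≤ (2 ^ (K + 1)) ^ d := by gcongr
    _ = (2 : ℝ) ^ (((K + 1) * d : ℕ) : ℝ) := by rw [Real.rpow_natCast, pow_mul]
    _ ≤ _ := by
      refine Real.rpow_le_rpow_of_exponent_le one_le_two ?_
      rw [div_mul_eq_mul_div, le_div_iff₀ hδ]
      -- Bernoulli's inequality together with δ ≤ 1: the exponent grows at least linearly in K, as
      -- log₂ n does.
      have h3 : ((K : ℝ) + 1) * δ ≤ (1 + δ) ^ K := by linarith
      have hd : (0 : ℝ) ≤ d := by positivity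
      push_cast
      nlinarith

/-- Local boundedness of solutions, in dimension `m + 1`. -/
theorem abs_le_ellipticity_mul_avgNorm {m : ℕ} (hm : 2 ≤ m) {p q : ℝ≥0∞} (hp : 1 < p) (hq : 1 < q)
    {δ : ℝ} (hδ : 0 < δ) (hδe : δ = 1 / m - (p⁻¹).toReal / 2 - (q⁻¹).toReal / 2) :
    ∃ c : ℝ, 1 ≤ c ∧
      ∀ ω : Bond (m + 1) → ℝ, (∀ e, 0 < ω e) →
      ∀ u : Vertex (m + 1) → ℝ, (∀ x, dvg (fun e => ω e * grad u e) x = 0) →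
      ∀ n : ℕ, 1 ≤ n → ∀ x ∈ box (0 : Vertex (m + 1)) n,
        |u x| ≤ c * ellipticity p q ω (box 0 (4 * n)) ^ ((δ + 1) / (2 * δ))
          * avgNorm (2 * p.conjExponent) (box 0 (4 * n)) u := by
  have ha0 : 0 ≤ (p⁻¹).toReal := ENNReal.toReal_nonneg
  have hb0 : 0 ≤ (q⁻¹).toReal := ENNReal.toReal_nonneg
  have hb1 := inv_toReal_lt_one hq
  have hm2 : (2 : ℝ) ≤ m := by exact_mod_cast hm
  have hm1 : 1 / (m : ℝ) ≤ 1 / 2 := one_div_le_one_div_of_le two_pos hm2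
  have hδ1 : δ ≤ 1 := by linarith
  set r := 2 / (1 + (q⁻¹).toReal) with hrdef
  have hr : 1 / r = (1 + (q⁻¹).toReal) / 2 := by rw [hrdef, one_div_div]
  have hr1 : 1 ≤ r := by rw [hrdef, le_div_iff₀ (by linarith)]; linarith
  obtain ⟨C₀, hC₀, hstart⟩ := sobolevNorm_start (m + 1) (by omega) hp hq hr
  obtain ⟨C₁, hC₁, hstep⟩ := sobolevNorm_step hm hp hq hδ hδe hr
  -- Step k costs at most 2^k from √α and (4 · 2^k)² from the radii, hence 16 · 8^k in all, and B ≥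
  -- 8 absorbs this into B^(k+1).
  set B : ℝ := 16 * (1 + C₀ + C₁) with hB
  have hB1 : 1 ≤ B := by rw [hB]; linarith
  set β := 1 + (1 + δ) / δ ^ 2 with hβ
  have hβ0 : 0 ≤ β := by positivity
  refine ⟨2 ^ (((m + 1 : ℕ) : ℝ) / δ) * B ^ β, one_le_mul_of_one_le_of_one_le
    (Real.one_le_rpow one_le_two (by positivity)) (Real.one_le_rpow hB1 hβ0),
    fun ω hω u hu n hn x hx => ?_⟩
  have hn0 : (0 : ℝ) < n := by exact_mod_cast hn
  set Λ := ellipticity p q ω (box 0 (4 * n))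
  have hΛ : 1 ≤ Λ := one_le_ellipticity (by omega) hp.le hq.le hω (by omega)
  have hL : 1 ≤ √Λ := Real.one_le_sqrt.2 hΛ
  set U := avgNorm (2 * p.conjExponent) (box 0 (4 * n)) u
  have hU : 0 ≤ U := avgNorm_nonneg _ _ _
  set K := Nat.log 2 n
  set X : ℕ → ℝ := fun k => sobolevNorm r n (fun x => |u x| ^ ((1 + δ) ^ k)) (n + n / 2 ^ k) with hX
  have hX0 : ∀ k, 0 ≤ X k := fun k => sobolevNorm_nonneg _ _
  have h0 : X 0 ≤ B * √Λ * U := by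
    have h := hstart ω hω u hu n hn
    have e : X 0 = sobolevNorm r n (fun x => |u x| ^ (1 : ℝ)) (2 * n) := by
      simp only [hX, pow_zero, Nat.div_one, two_mul]
    rw [e]
    refine h.trans ?_
    gcongr
    rw [hB]; linarith
  have hrec : ∀ k, k < K → X (k + 1) ≤ B ^ (k + 1) * √Λ * X k ^ (1 + δ) := by
    intro k hk
    have hkn : 2 ^ (k + 1) ≤ n := Nat.pow_le_of_le_log (by omega) hk
    obtain ⟨hlt, hgap⟩ := radii_gap hkn
    have hdiv : n / 2 ^ k ≤ n := Nat.div_le_self _ _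
    have hz := Nat.zero_le (n / 2 ^ (k + 1))
    have h := hstep ω hω u hu ((1 + δ) ^ k) (one_le_pow₀ (by linarith)) n (n + n / 2 ^ (k + 1))
      (n + n / 2 ^ k) hn (by omega) (by omega) (by omega) (by omega)
    rw [← pow_succ (1 + δ) k] at h
    refine h.trans (mul_le_mul_of_nonneg_right ?_ (Real.rpow_nonneg (hX0 k) _))
    set N : ℝ := ((n + n / 2 ^ k : ℕ) : ℝ) - ((n + n / 2 ^ (k + 1) : ℕ) : ℝ) with hN
    have hN0 : 0 < N := by
      rw [hN, sub_pos]; exact_mod_cast Nat.add_lt_add_left hlt n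
    have h1 : (n : ℝ) / N ≤ 4 * 2 ^ k := by rw [div_le_iff₀ hN0]; exact hgap
    have h2 : √((1 + δ) ^ k) ≤ 2 ^ k := by
      rw [Real.sqrt_le_left (by positivity), ← pow_mul, mul_comm k 2, pow_mul]
      exact pow_le_pow_left₀ (by linarith) (by linarith) k
    calc C₁ * (√((1 + δ) ^ k) * √Λ * (n / N) ^ 2)
        ≤ (1 + C₀ + C₁) * (2 ^ k * √Λ * (4 * 2 ^ k) ^ 2) := by
          gcongr
          linarith
      _ = 16 * (1 + C₀ + C₁) * (8 : ℝ) ^ k * √Λ := by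
          rw [show (8 : ℝ) = 2 ^ 3 by norm_num, ← pow_mul]; ring
      _ ≤ B * B ^ k * √Λ := by
          rw [← hB]
          gcongr
          rw [hB]; linarith
      _ = _ := by rw [pow_succ]; ring
  have hfin := le_of_recursion hX0 hB1 hL hU hδ h0 hrec
  have hpt := rpow_abs_le_sobolevNorm (α := (1 + δ) ^ K) (R := n + n / 2 ^ K) hn hr1 u
    (box_mono (Nat.le_add_right _ _) hx)
  have hvol := natCast_pow_le_rpow (d := m + 1) hn hδ hδ1
  have hχ : 0 < (1 + δ) ^ K := by positivity
  have hB0 : 0 < B := by linarith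
  have htot : |u x| ^ ((1 + δ) ^ K) ≤
      (2 ^ (((m + 1 : ℕ) : ℝ) / δ) * (B ^ β * √Λ ^ ((1 + δ) / δ) * U)) ^ ((1 + δ) ^ K) := by
    rw [Real.mul_rpow (by positivity) (by positivity)]
    exact hpt.trans (mul_le_mul hvol hfin (hX0 K) (by positivity))
  have hle := (Real.rpow_le_rpow_iff (abs_nonneg _) (by positivity) hχ).1 htot
  -- Each step contributes √Λ, which halves the exponent (1+δ)/δ of the recursion.
  have hsqrt : √Λ ^ ((1 + δ) / δ) = Λ ^ ((δ + 1) / (2 * δ)) := by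
    rw [Real.sqrt_eq_rpow, ← Real.rpow_mul (by linarith)]
    congr 1
    field_simp
    ring
  rw [hsqrt] at hle
  linarith

end RandomConductance

theorem theorem3p3 (d : ℕ) (hd : 3 ≤ d) (p q : ℝ≥0∞) (hp : 1 < p) (hq : 1 < q)
    (hpq : (p⁻¹).toReal + (q⁻¹).toReal < 2 / ((d : ℝ) - 1)) :
    0 < gap d p q ∧
    ∃ c : ℝ, 1 ≤ c ∧
      ∀ ω : Bond d → ℝ, (∀ e, 0 < ω e) →
      ∀ u : Vertex d → ℝ, (∀ x, dvg (fun e => ω e * grad u e) x = 0) →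
      ∀ n : ℕ, 1 ≤ n → ∀ x ∈ box (0 : Vertex d) n,
        |u x| ≤ c * ellipticity p q ω (box 0 (4 * n)) ^ ((gap d p q + 1) / (2 * gap d p q))
          * avgNorm (2 * p.conjExponent) (box 0 (4 * n)) u := by
  have hgap : 0 < gap d p q := by
    have h : 1 / ((d : ℝ) - 1) = 2 / ((d : ℝ) - 1) / 2 := by ring
    rw [gap, h]
    linarith
  refine ⟨hgap, ?_⟩
  obtain ⟨m, rfl⟩ : ∃ m, d = m + 1 := ⟨d - 1, by omega⟩
  exact abs_le_ellipticity_mul_avgNorm (by omega) hp hq hgap (by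
    rw [gap]; push_cast; rw [add_sub_cancel_right])
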